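/- **Setting.** For every $d$ let $\rho=\rho_d$ be a probability density on $\mathbb R^d$ with $\int|\rho\log\rho|<\infty$. Let $\alpha>0$ and let $n=n_d$ satisfy $\frac1d\log n_d\to\alpha$ as $d\to\infty$. Let $\mathcal D=\{y_1,\dots,y_n\}$ be i.i.d. with density $\rho$. For $\gamma\ge 1$ let $K(z)=\exp\big(d\,[c_{\gamma,d}-\frac1{2\gamma}(|z|^2/d)^\gamma]\big)$, where $c_{\gamma,d}$ is such that $\int_{\mathbb R^d}K=1$, and for $h>0$ let $$\hat\rho_h(x)=\frac1{nh^d}\sum_{i=1}^nK\Big(\frac{x-y_i}h\Big).$$ For $x\in\mathbb R^d$ put $\tilde f_{d,x,h}(\lambda)=\frac1d\log\mathbb E_{y\sim\rho}\,e^{-d\lambda|x-y|^2/(dh^2)}$. Assume that $\rho$ is *pure*: for all $h>0$ and $\lambda>0$, when $x\sim\rho$, $\tilde f_{d,x,h}(\lambda)$ concentrates in probability around its mean as $d\to\infty$, and this mean has a limit $\bar f_h(\lambda)$. (For $\lambda\le0$, $\bar f_h(\lambda)\in[0,+\infty]$ denotes the upper limit of the means.) Assume that $\bar f_1$ is differentiable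 on $(0,\infty)$ and that the variables $(|x|^2/d)^\gamma$, $x\sim\rho_d$, are asymptotically uniformly integrable as $d\to\infty$. Put $$\bar g(h^2,m)=\lim_{d\to\infty}\frac1d\,\mathbb E_x\log\mathbb E_y K^m\Big(\frac{x-y}h\Big)-m\log h,\qquad \phi_{\alpha,h}(m)=\frac{1-m}m\alpha+\frac1m\,\bar g(h^2,m),$$ with $x,y\sim\rho$ independent, and $D(\alpha,h)=\frac{\partial\phi_{\alpha,h}}{\partial m}(1)$. Assume that $\bar g(h^2,m)$ is strictly convex in $m>0$ for every $h>0$. Let $J_1(u)=-\inf_{\lambda\in\mathbb R}[\lambda u+\bar f_1(\lambda)]$ be the rate function of $u=|x-y|^2/d$. **Statement.** The limits defining $\bar g(h^2,m)$ exist for all $h,m>0$. Let $D_{KL}(\rho\|\hat\rho_h)=\int\rho\log(\rho/\hat\rho_h)\,dx$. 1. *(RS phase.)* For every $h>0$ with $D(\alpha,h)<0$, as $d\to\infty$, $$\tfrac1d D_{KL}(\rho\|\hat\rho_h)=\tfrac1d\int\rho\log\rho\,dx-\phi_{\alpha,h}(1)+o(1).$$ 2. *(1RSB phase.)* For every $h>0$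 with $D(\alpha,h)>0$ there is a unique $m^*=m^*(h)\in(0,1)$ with $\frac{\partial\phi_{\alpha,h}}{\partial m}(m^*)=0$, and $$\tfrac1d D_{KL}(\rho\|\hat\rho_h)=\tfrac1d\int\rho\log\rho\,dx-\phi_{\alpha,h}(m^*)+o(1).$$ In both cases the divergence is finite for all large $d$, and $o(1)$ tends to $0$ in $L^1$ with respect to the random database $\mathcal D$. 3. *(Optimal bandwidth.)* Let $0<u_G<u_{typ}$ be such that $J_1(u_G)=\alpha$, $J_1(u_{typ})<\infty$ and $J_1'(u_{typ})=0$, and suppose that $2u\,J_1'(u)>-1$ for all $u_G\le u<u_{typ}$. Then for every $h>0$ the limit $$L(h)=\lim_{d\to\infty}\tfrac1d\Big[D_{KL}(\rho\|\hat\rho_h)-\int\rho\log\rho\,dx\Big]$$ exists in $L^1$ with respect to $\mathcal D$, the function $L$ has a unique minimizer $h_{opt}$ on $(0,\infty)$, one has $D(\alpha,h_{opt})>0$ (that is, $h_{opt}$ lies in the 1RSB phase), and $$\frac{\partial\phi_{\alpha,h}(m^*)}{\partial h}\Big|_{h=h_{opt}}=0,$$ both with $m^*=m^*(h_{opt})$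 held fixed and for the function $h\mapsto\phi_{\alpha,h}(m^*(h))$. -/

import Mathlib

open MeasureTheory Filter Topology Set

namespace KDE

noncomputable section

/-- `ℝ^d` with its Euclidean norm. -/
abbrev Sp (d : ℕ) : Type := EuclideanSpace ℝ (Fin d)

/-- The measure on `ℝ^d` with Lebesgue density `q`. -/
def law {d : ℕ} (q : Sp d → ℝ) : Measure (Sp d) :=
  volume.withDensity fun x => ENNReal.ofReal (q x)

/-! ### Kernels and the kernel density estimator -/

/-- The constant `c_{γ,d}` that normalizes the `γ`-kernel on `ℝ^d` to total mass `1`. -/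
def kernelConst (γ : ℝ) (d : ℕ) : ℝ :=
  -(1 / (d : ℝ)) *
    Real.log (∫ z : Sp d, Real.exp (-((d : ℝ) * (1 / (2 * γ) * (‖z‖ ^ 2 / (d : ℝ)) ^ γ))))

/-- The `γ`-kernel `K_γ(z) = exp (d [c_{γ,d} - (|z|²/d)^γ / (2γ)])`. -/
def kernel (γ : ℝ) {d : ℕ} (z : Sp d) : ℝ :=
  Real.exp ((d : ℝ) * (kernelConst γ d - 1 / (2 * γ) * (‖z‖ ^ 2 / (d : ℝ)) ^ γ))

/-- The kernel density estimator
`ρ̂_h^𝒟(x) = (n h^d)⁻¹ ∑ i, K_γ((x - y_i) / h)` built on the database `y`. -/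
def estimator (γ h : ℝ) {d n : ℕ} (y : Fin n → Sp d) (x : Sp d) : ℝ :=
  ((n : ℝ) * h ^ d)⁻¹ * ∑ i, kernel γ (h⁻¹ • (x - y i))

/-! ### Pure densities and the rate function -/

/-- The generating function `f̃_{d,x,h}(λ) = (1/d) log 𝔼_y exp (-d λ |x-y|²/(d h²))`, where `y`
has density `q`. It is finite for `λ ≥ 0` and may be `+∞` for `λ < 0`. -/
def genFun {d : ℕ} (q : Sp d → ℝ) (h : ℝ) (x : Sp d) (lam : ℝ) : EReal :=
  (((d : ℝ)⁻¹ : ℝ) : EReal) *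
    ENNReal.log (∫⁻ y, ENNReal.ofReal
      (Real.exp (-((d : ℝ) * lam * (‖x - y‖ ^ 2 / ((d : ℝ) * h ^ 2))))) ∂(law q))

/-- The mean `∫ ρ(x) f̃_{d,x,h}(λ) dx`. At each `λ` the integrand has constant sign, so that one
of the two terms vanishes. -/
def meanGenFun {d : ℕ} (q : Sp d → ℝ) (h lam : ℝ) : EReal :=
  ((∫⁻ x, (genFun q h x lam).toENNReal ∂(law q) : ENNReal) : EReal) -
    ((∫⁻ x, (-genFun q h x lam).toENNReal ∂(law q) : ENNReal) : EReal)

/-- The large-`d` limit `f̄_h(λ)` of the mean of the generating function (as an upper limit, so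
that it is defined for all real `λ`; for pure densities and `λ > 0` it is a limit). -/
def fbar (ρ : (d : ℕ) → Sp d → ℝ) (h lam : ℝ) : EReal :=
  limsup (fun d : ℕ => meanGenFun (ρ d) h lam) atTop

/-- A family `ρ d` of probability densities on `ℝ^d`, `d = 0, 1, 2, …`, is pure if the random
function `f̃_{d,x,h}(λ)`, `x ∼ ρ d`, concentrates in probability around its mean when `d → ∞`,
and this mean has a limit. -/
structure IsPure (ρ : (d : ℕ) → Sp d → ℝ) : Prop where
  measurable : ∀ d, Measurable (ρ d)
  nonneg : ∀ d x, 0 ≤ ρ d x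
  isProbability : ∀ d, IsProbabilityMeasure (law (ρ d))
  tendsto_mean : ∀ h : ℝ, 0 < h → ∀ lam : ℝ, 0 < lam →
    Tendsto (fun d : ℕ => meanGenFun (ρ d) h lam) atTop (𝓝 (fbar ρ h lam))
  concentration : ∀ h : ℝ, 0 < h → ∀ lam : ℝ, 0 < lam → ∀ ε : ℝ, 0 < ε →
    Tendsto (fun d : ℕ => law (ρ d)
      {x | ε ≤ |(genFun (ρ d) h x lam).toReal - (meanGenFun (ρ d) h lam).toReal|})
      atTop (𝓝 0)

/-- The rate function `J_h(u) = - min_λ [λ u + f̄_h(λ)] = sup_λ (-(λ u + f̄_h(λ)))`. -/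
def rate (ρ : (d : ℕ) → Sp d → ℝ) (h u : ℝ) : EReal :=
  ⨆ lam : ℝ, -(((lam * u : ℝ) : EReal) + fbar ρ h lam)

/-- The rate function with values in `ℝ`, to be used where `rate` is finite. -/
def rateReal (ρ : (d : ℕ) → Sp d → ℝ) (h u : ℝ) : ℝ := (rate ρ h u).toReal

/-- The variables `(|x|²/d)^γ`, `x ∼ ρ d`, are asymptotically uniformly integrable. -/
def UnifIntMoment (ρ : (d : ℕ) → Sp d → ℝ) (γ : ℝ) : Prop :=
  ∀ ε : ℝ, 0 < ε → ∃ R : ℝ, ∀ᶠ d : ℕ in atTop,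
    ∫⁻ x in {x : Sp d | R ≤ ‖x‖ ^ 2 / (d : ℝ)},
      ENNReal.ofReal ((‖x‖ ^ 2 / (d : ℝ)) ^ γ) ∂(law (ρ d)) ≤ ENNReal.ofReal ε

/-! ### The replica free entropy -/

/-- `(1/d) log 𝔼_y K_γ((x-y)/h)^m`, where `y` has density `q`. -/
def logMoment (γ : ℝ) {d : ℕ} (q : Sp d → ℝ) (h m : ℝ) (x : Sp d) : ℝ :=
  1 / (d : ℝ) * Real.log (∫ y, kernel γ (h⁻¹ • (x - y)) ^ m ∂(law q))

/-- `(1/d) 𝔼_x log 𝔼_y K_γ((x-y)/h)^m - m log h`, where `x` and `y` have density `q`. -/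
def meanLogMoment (γ : ℝ) {d : ℕ} (q : Sp d → ℝ) (h m : ℝ) : ℝ :=
  (∫ x, logMoment γ q h m x ∂(law q)) - m * Real.log h

/-- `ḡ(h², m) = lim_{d → ∞} (1/d) 𝔼_x log 𝔼_y K_γ((x-y)/h)^m - m log h`. -/
def gbar (ρ : (d : ℕ) → Sp d → ℝ) (γ h m : ℝ) : ℝ :=
  limUnder atTop fun d : ℕ => meanLogMoment γ (ρ d) h m

/-- The replica free entropy `φ_{α,h}(m) = ((1-m)/m) α + ḡ(h², m)/m`. -/
def phi (ρ : (d : ℕ) → Sp d → ℝ) (γ α h m : ℝ) : ℝ :=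
  (1 - m) / m * α + 1 / m * gbar ρ γ h m

/-- `D(α, h)`, the derivative of `m ↦ φ_{α,h}(m)` at `m = 1`. -/
def glassD (ρ : (d : ℕ) → Sp d → ℝ) (γ α h : ℝ) : ℝ :=
  deriv (fun m => phi ρ γ α h m) 1

/-! ### The Kullback-Leibler divergence -/

/-- `D_KL(ρ ‖ ρ̂_h^𝒟)` for the database `y`. -/
def klEstimator (γ h : ℝ) {d n : ℕ} (q : Sp d → ℝ) (y : Fin n → Sp d) : ENNReal :=
  InformationTheory.klDiv (law q) (law (estimator γ h y))

/-- `D_KL(ρ ‖ ρ̂_h^𝒟) = ∫ ρ log ρ + d ℓ + o(d)` when `d → ∞`: for large `d` the divergence is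
finite, and `(1/d) D_KL(ρ ‖ ρ̂_h^𝒟) - (1/d) ∫ ρ log ρ` converges to `ℓ` in `L¹` with respect to the
database `𝒟` of `n d` independent points with density `ρ d`. -/
def KLAsymptotics (ρ : (d : ℕ) → Sp d → ℝ) (n : ℕ → ℕ) (γ h ℓ : ℝ) : Prop :=
  (∀ᶠ d : ℕ in atTop, ∀ y : Fin (n d) → Sp d, klEstimator γ h (ρ d) y ≠ ⊤) ∧
  Tendsto (fun d : ℕ => eLpNorm
      (fun y : Fin (n d) → Sp d =>
        1 / (d : ℝ) * (klEstimator γ h (ρ d) y).toReal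
          - 1 / (d : ℝ) * (∫ x, ρ d x * Real.log (ρ d x)) - ℓ)
      1 (Measure.pi fun _ : Fin (n d) => law (ρ d)))
    atTop (𝓝 0)

end

end KDE

/-! Write u = |x-y|²/d, F for the limit `limitMGF` of the generating functions at bandwidth 1, and β
= `invTemp γ h` for the constant with K((x-y)/h) = exp(d c_{γ,d} - d β u^γ). Up to explicit terms,
the log-likelihood of the estimator at x is (1/d) log Z, where Z = ∑ exp(-d β u_i^γ) is the
partition function of a random energy model whose exp(dα) energies are independent given x. The
divergence is the entropy minus the mean log-likelihood, so everything rests on the limit P(β) of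
(1/d) log Z.

Annealed free energy. Purity controls only the linear weights exp(-d λ u) with λ > 0. The minimizer
v(b) of b u^γ + J(u) is characterized through F alone: with slope λ = b γ v^(γ-1), one has F'(λ) =
-v (`IsTilt`). The tangent line of u^γ at v bounds (1/d) log 𝔼 exp(-d b u^γ) above by G(b) = b(γ-1)
v^γ + F(λ) (`freeEnergy`). Differentiability of F at λ gives the matching lower bound by a
Gärtner-Ellis change of measure (`eventually_exp_le_window`). The rate at v(b) is S(b) = -λ v - F(λ)
(`tiltRate`), and G' = -v^γ is an envelope theorem. Strict convexity of ḡ makes G strictly convex,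
so v decreases strictly and continuously, and S increases strictly and continuously.

Random energy model. Above: Z_β^m ≤ Z_{mβ} for m ≤ 1, and Markov's inequality for Z_{mβ}, give P ≤
(α + G(mβ))/m. Below: if S(b) < α, about exp(d(α - S(b))) of the points have u near v(b), so P ≥ α -
S(b) - β v(b)^γ. If S(β) < α, the choices m = 1 and b = β match. If S(b₀) = α with b₀ ≤ β, the
choice m = b₀/β and the limit b ↑ b₀ both give -β v(b₀)^γ. Since ∂φ/∂m = (S(mβ) - α)/m², these are
the RS phase and the 1RSB phase, with D = S(β) - α and m* = b₀/β. Domination by moments of order γ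
turns convergence in probability into L¹ convergence (`UpperUnifInt.tendsto_lintegral`).

Optimal bandwidth. As log h is a constant minus (1/(2γ)) log β, minimizing L means maximizing P(β) +
(1/(2γ)) log β. As J'(v(b)) = -λ, the hypothesis 2uJ' > -1 says 2γ b v(b)^γ < 1 for b ≤ b₀. Hence
the objective increases on the unfrozen side β < b₀. On the frozen side it is strictly concave, with
its maximum at β = 1/(2γ v(b₀)^γ) > b₀, which means h² = v(b₀) = u_G. -/

namespace KDE

noncomputable section

/-! ### Events of asymptotic probability one -/

/-- The filter of the events whose probability tends to `1` along a sequence of measures. -/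
def whp {Ω : ℕ → Type*} [∀ d, MeasurableSpace (Ω d)] (μ : ∀ d, Measure (Ω d)) :
    Filter (Σ d, Ω d) where
  sets := {s | Tendsto (fun d => μ d {x | (⟨d, x⟩ : Σ d, Ω d) ∉ s}) atTop (𝓝 0)}
  univ_sets := by simp
  sets_of_superset := by
    intro s t hs hst
    exact tendsto_of_tendsto_of_tendsto_of_le_of_le tendsto_const_nhds hs (fun _ => zero_le)
      fun d => measure_mono fun x hx hxs => hx (hst hxs)
  inter_sets := by
    intro s t hs ht
    have h := Tendsto.add hs ht
    rw [add_zero] at h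
    refine tendsto_of_tendsto_of_tendsto_of_le_of_le tendsto_const_nhds h (fun _ => zero_le)
      fun d => le_trans (measure_mono ?_) (measure_union_le _ _)
    intro x hx
    by_contra hc
    simp only [mem_union, mem_ofPred_eq, not_or, not_not] at hc
    exact hx hc

section whp

variable {Ω Ψ : ℕ → Type*} [∀ d, MeasurableSpace (Ω d)] [∀ d, MeasurableSpace (Ψ d)]
  {μ : ∀ d, Measure (Ω d)} {ν : ∀ d, Measure (Ψ d)}

lemma eventually_whp_iff {P : (Σ d, Ω d) → Prop} :
    (∀ᶠ p in whp μ, P p) ↔ Tendsto (fun d => μ d {x | ¬ P ⟨d, x⟩}) atTop (𝓝 0) := Iff.rfl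

lemma tendsto_fst_whp : Tendsto Sigma.fst (whp μ) atTop := by
  intro s hs
  change ∀ᶠ p in whp μ, p.1 ∈ s
  rw [eventually_whp_iff]
  refine tendsto_const_nhds.congr' ?_
  filter_upwards [hs] with d hd
  simp [hd]

lemma tendsto_whp_iff {X : ∀ d, Ω d → ℝ} {l : ℝ} :
    Tendsto (fun p : Σ d, Ω d => X p.1 p.2) (whp μ) (𝓝 l) ↔
      ∀ ε : ℝ, 0 < ε → Tendsto (fun d => μ d {x | ε ≤ |X d x - l|}) atTop (𝓝 0) := by
  rw [Metric.tendsto_nhds]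
  refine forall₂_congr fun ε _ => ?_
  rw [eventually_whp_iff]
  simp only [Real.dist_eq, not_lt]

lemma tendsto_whp_prod_fst [∀ d, SFinite (ν d)] [∀ d, IsProbabilityMeasure (ν d)] :
    Tendsto (fun p : Σ d, Ω d × Ψ d => (⟨p.1, p.2.1⟩ : Σ d, Ω d))
      (whp fun d => (μ d).prod (ν d)) (whp μ) := by
  intro s hs
  change ∀ᶠ p in whp fun d => (μ d).prod (ν d), (⟨p.1, p.2.1⟩ : Σ d, Ω d) ∈ s
  rw [eventually_whp_iff]
  have hs' : Tendsto (fun d => μ d {x | (⟨d, x⟩ : Σ d, Ω d) ∉ s}) atTop (𝓝 0) := hs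
  refine hs'.congr fun d => ?_
  have : {x : Ω d × Ψ d | ¬ (⟨d, x.1⟩ : Σ d, Ω d) ∈ s}
      = {x | (⟨d, x⟩ : Σ d, Ω d) ∉ s} ×ˢ univ := by
    ext x; simp
  rw [this, Measure.prod_prod, measure_univ, mul_one]

/-- An event of a product space is asymptotically negligible as soon as its sections are, for most
first coordinates. -/
lemma eventually_whp_prod [∀ d, IsProbabilityMeasure (μ d)] [∀ d, IsProbabilityMeasure (ν d)]
    {s : ∀ d, Set (Ω d × Ψ d)} (hs : ∀ d, MeasurableSet (s d))
    (h : Tendsto (fun p : Σ d, Ω d => ν p.1 (Prod.mk p.2 ⁻¹' s p.1)) (whp μ) (𝓝 0)) :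
    ∀ᶠ p in whp fun d => (μ d).prod (ν d), p.2 ∉ s p.1 := by
  rw [eventually_whp_iff, ENNReal.tendsto_nhds_zero]
  intro ε hε
  have hε2 : 0 < ε / 2 := ENNReal.half_pos hε.ne'
  have h1 := ENNReal.tendsto_nhds_zero.1 h (ε / 2) hε2
  rw [eventually_whp_iff, ENNReal.tendsto_nhds_zero] at h1
  filter_upwards [h1 (ε / 2) hε2] with d hd
  simp only [not_not]
  change (μ d).prod (ν d) (s d) ≤ ε
  rw [Measure.prod_apply (hs d)]
  have hm : Measurable fun x => ν d (Prod.mk x ⁻¹' s d) := measurable_measure_prodMk_left (hs d)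
  -- The exceptional first coordinates have probability at most ε/2 and their sections at most 1;
  -- every other section has probability at most ε/2.
  set B : Set (Ω d) := {x | ¬ ν d (Prod.mk x ⁻¹' s d) ≤ ε / 2} with hB
  have hBm : MeasurableSet B := (measurableSet_le hm measurable_const).compl
  calc ∫⁻ x, ν d (Prod.mk x ⁻¹' s d) ∂μ d
      ≤ ∫⁻ x, ε / 2 + B.indicator 1 x ∂μ d := by
        refine lintegral_mono fun x => ?_
        by_cases hx : x ∈ B
        · simp only [indicator_of_mem hx, Pi.one_apply]
          exact le_trans prob_le_one le_add_self
        · simp only [indicator_of_notMem hx, add_zero]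
          simpa [hB] using hx
    _ = ε / 2 + μ d B := by
        rw [lintegral_add_left measurable_const, lintegral_const, measure_univ, mul_one,
          lintegral_indicator_one hBm]
    _ ≤ ε / 2 + ε / 2 := by gcongr
    _ = ε := ENNReal.add_halves ε

/-- A sequence of functions is asymptotically uniformly integrable from above. -/
def UpperUnifInt (μ : ∀ d, Measure (Ω d)) (W : ∀ d, Ω d → ℝ) : Prop :=
  ∀ ε : ℝ, 0 < ε → ∃ R : ℝ, ∀ᶠ d : ℕ in atTop,
    ∫⁻ x, ENNReal.ofReal (W d x - R) ∂μ d ≤ ENNReal.ofReal ε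

/-- Vitali's theorem along a sequence of probability spaces. -/
lemma UpperUnifInt.tendsto_lintegral [∀ d, IsProbabilityMeasure (μ d)] {X W : ∀ d, Ω d → ℝ} {l : ℝ}
    (hW : UpperUnifInt μ W) (hX : ∀ d, Measurable (X d))
    (hXl : Tendsto (fun p : Σ d, Ω d => X p.1 p.2) (whp μ) (𝓝 l))
    (hXW : ∀ᶠ d in atTop, ∀ x, |X d x - l| ≤ W d x) :
    Tendsto (fun d => ∫⁻ x, ENNReal.ofReal |X d x - l| ∂μ d) atTop (𝓝 0) := by
  rw [ENNReal.tendsto_nhds_zero]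
  intro ε hε
  obtain ⟨η, hη, hηε⟩ : ∃ η : ℝ, 0 < η ∧ ENNReal.ofReal η + ENNReal.ofReal η + ENNReal.ofReal η
      ≤ ε := by
    obtain ⟨r, hr, hrε⟩ := ENNReal.lt_iff_exists_nnreal_btwn.1 hε
    have hr' : 0 < (r : ℝ) := by exact_mod_cast hr
    refine ⟨r / 3, by positivity, ?_⟩
    rw [← ENNReal.ofReal_add (by positivity) (by positivity),
      ← ENNReal.ofReal_add (by positivity) (by positivity)]
    have : (r : ℝ) / 3 + r / 3 + r / 3 = r := by ring
    rw [this, ENNReal.ofReal_coe_nnreal]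
    exact hrε.le
  obtain ⟨R, hR⟩ := hW η hη
  have h1 := tendsto_whp_iff.1 hXl η hη
  -- On the rare event where `X` is at least η away from `l`, the dominating function costs R times
  -- the probability of the event, plus its excess over R.
  have h2 : Tendsto (fun d => ENNReal.ofReal R * μ d {x | η ≤ |X d x - l|}) atTop (𝓝 0) := by
    have := ENNReal.Tendsto.const_mul (a := ENNReal.ofReal R) h1 (Or.inr ENNReal.ofReal_ne_top)
    rwa [mul_zero] at this
  filter_upwards [hXW, hR, ENNReal.tendsto_nhds_zero.1 h2 (ENNReal.ofReal η) (by simpa using hη)]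
    with d hd hRd hd2
  set A : Set (Ω d) := {x | η ≤ |X d x - l|} with hA
  have hAm : MeasurableSet A := measurableSet_le measurable_const ((hX d).sub_const l).abs
  calc ∫⁻ x, ENNReal.ofReal |X d x - l| ∂μ d
      ≤ ∫⁻ x, (ENNReal.ofReal η + A.indicator (fun _ => ENNReal.ofReal R) x)
          + ENNReal.ofReal (W d x - R) ∂μ d := by
        refine lintegral_mono fun x => ?_
        by_cases hx : x ∈ A
        · simp only [indicator_of_mem hx]
          have : |X d x - l| ≤ R + (W d x - R) := by linarith [hd x]
          calc ENNReal.ofReal |X d x - l| ≤ ENNReal.ofReal (R + (W d x - R)) :=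
                ENNReal.ofReal_le_ofReal this
            _ ≤ ENNReal.ofReal R + ENNReal.ofReal (W d x - R) := ENNReal.ofReal_add_le
            _ ≤ _ := by gcongr; exact le_add_self
        · simp only [indicator_of_notMem hx, add_zero]
          have : |X d x - l| ≤ η := by
            simp only [hA, mem_ofPred_eq, not_le] at hx; exact hx.le
          exact le_trans (ENNReal.ofReal_le_ofReal this) le_self_add
    _ = ENNReal.ofReal η + ENNReal.ofReal R * μ d A + ∫⁻ x, ENNReal.ofReal (W d x - R) ∂μ d := by
        have hm : Measurable fun x =>
            ENNReal.ofReal η + A.indicator (fun _ => ENNReal.ofReal R) x :=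
          (measurable_const.indicator hAm).const_add _
        rw [lintegral_add_left hm, lintegral_add_left measurable_const, lintegral_const, measure_univ, mul_one,
          lintegral_indicator_const hAm]
    _ ≤ ENNReal.ofReal η + ENNReal.ofReal η + ENNReal.ofReal η := by gcongr
    _ ≤ ε := hηε

end whp

/-! ### Differentiable convex functions on a half-line -/

/-- By convexity the derivative is monotone, and by Darboux its image is an interval; a monotone
function cannot jump without leaving a gap in its image. -/
lemma continuousOn_deriv_of_convexOn {f : ℝ → ℝ} (hf : ConvexOn ℝ (Ioi 0) f)
    (hd : ∀ x ∈ Ioi (0 : ℝ), DifferentiableAt ℝ f x) : ContinuousOn (deriv f) (Ioi 0) := by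
  have hmono := hf.monotoneOn_deriv hd
  intro a ha
  have ha' : (0 : ℝ) < a := ha
  refine ContinuousAt.continuousWithinAt ?_
  -- Adding x makes the derivative strictly increasing, so that its values at a/2 and 2a lie
  -- strictly on both sides of the value at a.
  have hg : StrictMonoOn (fun x => deriv f x + x) (Ioi 0) := fun x hx y hy hxy =>
    add_lt_add_of_le_of_lt (hmono hx hy hxy.le) hxy
  have hoc : ((fun x => deriv f x + x) '' Ioi 0).OrdConnected := by
    refine (ordConnected_Ioi (a := (0 : ℝ))).image_hasDerivWithinAt
      (f := fun x => f x + x ^ 2 / 2) fun x hx => ?_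
    have h1 := (hd x hx).hasDerivAt.add (((hasDerivAt_id x).pow 2).div_const 2)
    have h2 : deriv f x + ((2 : ℕ) * id x ^ (2 - 1) * 1) / 2 = deriv f x + x := by simp
    rw [h2] at h1
    exact h1.hasDerivWithinAt
  have hcont : ContinuousAt (fun x => deriv f x + x) a := by
    refine continuousAt_of_monotoneOn_of_image_mem_nhds hg.monotoneOn (Ioi_mem_nhds ha') ?_
    have h1 : deriv f (a / 2) + a / 2 < deriv f a + a :=
      hg (by simpa using ha') ha (by linarith)
    have h2 : deriv f a + a < deriv f (2 * a) + 2 * a :=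
      hg ha (by simpa using ha') (by linarith)
    refine mem_of_superset (Icc_mem_nhds h1 h2) (hoc.out ?_ ?_)
    · exact ⟨a / 2, by simpa using ha', rfl⟩
    · exact ⟨2 * a, by simpa using ha', rfl⟩
  have h3 := hcont.sub continuousAt_id
  refine h3.congr (Eventually.of_forall fun x => ?_)
  simp

/-- A function squeezed between a line and a function that touches the line to first order. This is
the form in which the envelope theorem is applied to `freeEnergy`. -/
lemma hasDerivAt_of_le_of_le {f Φ : ℝ → ℝ} {a s : ℝ} (hΦ : HasDerivAt Φ s a) (ha : f a = Φ a)
    (hlow : ∀ᶠ x in 𝓝 a, f a + s * (x - a) ≤ f x) (hup : ∀ᶠ x in 𝓝 a, f x ≤ Φ x) :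
    HasDerivAt f s a := by
  rw [hasDerivAt_iff_isLittleO] at hΦ ⊢
  refine Asymptotics.IsBigO.trans_isLittleO (Asymptotics.IsBigO.of_bound 1 ?_) hΦ
  filter_upwards [hlow, hup] with x h1 h2
  simp only [smul_eq_mul, one_mul, Real.norm_eq_abs]
  have h3 : 0 ≤ f x - f a - (x - a) * s := by linarith
  rw [abs_of_nonneg h3]
  exact le_trans (by linarith) (le_abs_self _)

/-- Bernoulli's inequality applied to w/v. This convexity of u^γ replaces weights exp(-d b u^γ) by
linear ones, the only ones that purity controls. -/
lemma rpow_tangent {γ v w : ℝ} (hγ : 1 ≤ γ) (hv : 0 ≤ v) (hw : 0 ≤ w) :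
    v ^ γ + γ * v ^ (γ - 1) * (w - v) ≤ w ^ γ := by
  rcases hv.eq_or_lt with rfl | hv
  · rcases hγ.eq_or_lt with rfl | hγ
    · simp
    · rw [Real.zero_rpow (by linarith), Real.zero_rpow (by linarith)]
      simpa using Real.rpow_nonneg hw γ
  · have h := one_add_mul_self_le_rpow_one_add (s := w / v - 1)
      (by have : 0 ≤ w / v := by positivity
          linarith) hγ
    rw [show 1 + (w / v - 1) = w / v by ring, Real.div_rpow hw hv.le,
      le_div_iff₀ (by positivity)] at h
    refine le_trans (le_of_eq ?_) h
    have : v ^ γ = v ^ (γ - 1) * v := by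
      rw [← Real.rpow_add_one hv.ne', sub_add_cancel]
    rw [this]
    field_simp

lemma rpow_sub_one_mul_self {γ v : ℝ} (hγ : 1 ≤ γ) (hv : 0 ≤ v) : v ^ (γ - 1) * v = v ^ γ := by
  rw [← Real.rpow_add_one' hv (by linarith), sub_add_cancel]

/-! ### Limits of logarithmic moment generating functions -/

/-- The properties of the limit of the logarithmic moment generating functions. -/
structure IsLimitLogMGF (F : ℝ → ℝ) (C : ℝ) : Prop where
  convex : ConvexOn ℝ (Ioi 0) F
  diff : ∀ s : ℝ, 0 < s → DifferentiableAt ℝ F s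
  nonpos : ∀ s : ℝ, 0 < s → F s ≤ 0
  lower : ∀ s : ℝ, 0 < s → -(C * s) ≤ F s

namespace IsLimitLogMGF

variable {F : ℝ → ℝ} {C : ℝ}

lemma tangent (hF : IsLimitLogMGF F C) {s t : ℝ} (hs : 0 < s) (ht : 0 < t) :
    F s + deriv F s * (t - s) ≤ F t := by
  rcases lt_trichotomy s t with h | rfl | h
  · have := hF.convex.le_slope_of_hasDerivAt hs ht h (hF.diff s hs).hasDerivAt
    rw [slope_def_field, le_div_iff₀ (by linarith)] at this
    linarith
  · simp
  · have := hF.convex.slope_le_of_hasDerivAt ht hs h (hF.diff s hs).hasDerivAt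
    rw [slope_def_field, div_le_iff₀ (by linarith)] at this
    linarith

/-- The tangent at s, followed down to t → 0, stays below F ≤ 0. This is what makes the rate
nonnegative at the tilted means. -/
lemma le_mul_deriv (hF : IsLimitLogMGF F C) {s : ℝ} (hs : 0 < s) : F s ≤ s * deriv F s := by
  have h : Tendsto (fun t : ℝ => F s + deriv F s * (t - s)) (𝓝[>] 0)
      (𝓝 (F s + deriv F s * (0 - s))) := by
    refine Tendsto.mono_left ?_ nhdsWithin_le_nhds
    exact Continuous.tendsto (by fun_prop) 0
  have h2 : F s + deriv F s * (0 - s) ≤ 0 := by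
    refine le_of_tendsto h ?_
    filter_upwards [self_mem_nhdsWithin] with t ht
    exact (hF.tangent hs ht).trans (hF.nonpos t ht)
  linarith

lemma deriv_nonpos (hF : IsLimitLogMGF F C) {s : ℝ} (hs : 0 < s) : deriv F s ≤ 0 := by
  by_contra! h
  have h1 := hF.tangent hs (t := s + (1 - F s) / deriv F s)
    (by have := hF.nonpos s hs
        have : 0 < (1 - F s) / deriv F s := div_pos (by linarith) h
        linarith)
  have h2 := hF.nonpos (s + (1 - F s) / deriv F s)
    (by have := hF.nonpos s hs
        have : 0 < (1 - F s) / deriv F s := div_pos (by linarith) h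
        linarith)
  rw [add_sub_cancel_left, mul_div_cancel₀ _ h.ne'] at h1
  linarith

lemma neg_le_deriv (hF : IsLimitLogMGF F C) {s : ℝ} (hs : 0 < s) : -C ≤ deriv F s := by
  have h1 := hF.le_mul_deriv hs
  have h2 := hF.lower s hs
  nlinarith

lemma nonneg (hF : IsLimitLogMGF F C) : 0 ≤ C := by
  have h1 := hF.neg_le_deriv one_pos
  have h2 := hF.deriv_nonpos one_pos
  linarith

lemma continuousOn_deriv (hF : IsLimitLogMGF F C) : ContinuousOn (deriv F) (Ioi 0) :=
  continuousOn_deriv_of_convexOn hF.convex fun x hx => hF.diff x hx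

end IsLimitLogMGF

/-! ### Tilted means -/

/-- The point `v` is the mean of the tilted distance `u` under the weight `exp (-d b u^γ)`. -/
def IsTilt (F : ℝ → ℝ) (γ b v : ℝ) : Prop :=
  0 ≤ v ∧ 0 < b * γ * v ^ (γ - 1) ∧ HasDerivAt F (-v) (b * γ * v ^ (γ - 1))

/-- A tilted mean solves v + F'(b γ v^(γ-1)) = 0. For γ = 1 the slope is b and the equation is
explicit. For γ > 1 the slope vanishes with v, so a zero has to be found away from v = 0 by the
intermediate value theorem; this needs F' < 0 somewhere. -/
lemma IsLimitLogMGF.exists_isTilt {F : ℝ → ℝ} {C γ b : ℝ} (hF : IsLimitLogMGF F C) (hγ : 1 ≤ γ)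
    (hb : 0 < b) (hne : ∃ s : ℝ, 0 < s ∧ F s < 0) : ∃ v, IsTilt F γ b v := by
  have key : ∀ {v : ℝ}, 0 ≤ v → 0 < b * γ * v ^ (γ - 1) → deriv F (b * γ * v ^ (γ - 1)) = -v →
      IsTilt F γ b v := fun hv hl he => ⟨hv, hl, he ▸ (hF.diff _ hl).hasDerivAt⟩
  rcases hγ.eq_or_lt with rfl | hγ
  · refine ⟨-deriv F b, key ?_ ?_ ?_⟩
    · linarith [hF.deriv_nonpos hb]
    · simpa using hb
    · simp
  obtain ⟨s, hs, hFs⟩ := hne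
  -- If F' were nonnegative throughout, F would stay below F s < 0 near 0, against F t ≥ -C t.
  obtain ⟨l, hl, hdl⟩ : ∃ l : ℝ, 0 < l ∧ deriv F l < 0 := by
    by_contra! hcon
    have hC := hF.nonneg
    set t := min s (-F s / (2 * (C + 1))) with ht
    have htpos : 0 < t := lt_min hs (div_pos (by linarith) (by linarith))
    have h1 := hF.tangent htpos hs
    have h2 := hcon t htpos
    have h3 : 0 ≤ deriv F t * (s - t) := mul_nonneg h2 (sub_nonneg.2 (min_le_left _ _))
    have h4 := hF.lower t htpos
    have h5 : t ≤ -F s / (2 * (C + 1)) := min_le_right _ _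
    rw [le_div_iff₀ (by linarith)] at h5
    nlinarith
  set q : ℝ → ℝ := fun v => b * γ * v ^ (γ - 1) with hq
  have hqpos : ∀ v, 0 < v → 0 < q v := fun v hv => by
    have := Real.rpow_pos_of_pos hv (γ - 1)
    have : 0 < γ := by linarith
    positivity
  have hqcont : Continuous q := by
    have : Continuous fun v : ℝ => v ^ (γ - 1) := Real.continuous_rpow_const (by linarith)
    exact continuous_const.mul this
  have hq0 : q 0 = 0 := by simp [hq, Real.zero_rpow (by linarith : γ - 1 ≠ 0)]
  -- At v₀ the function v + F'(q v) is at most v₀ + F'(l) ≤ 0, because F' is monotone; at v = C it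
  -- is nonnegative, because F' ≥ -C.
  obtain ⟨v₀, hv₀, hv₀', hv₀q⟩ : ∃ v₀ : ℝ, 0 < v₀ ∧ v₀ ≤ -deriv F l ∧ q v₀ ≤ l := by
    have h1 : ∀ᶠ v in 𝓝[>] (0 : ℝ), q v < l := by
      have h := hqcont.tendsto 0
      rw [hq0] at h
      exact (h.mono_left nhdsWithin_le_nhds).eventually_lt_const hl
    have h2 : ∀ᶠ v in 𝓝[>] (0 : ℝ), v < -deriv F l :=
      (tendsto_id.mono_left nhdsWithin_le_nhds).eventually_lt_const (by linarith)
    obtain ⟨v, hv1, hv2, hv3⟩ := (h1.and (h2.and self_mem_nhdsWithin)).exists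
    exact ⟨v, hv3, hv2.le, hv1.le⟩
  have hmono := hF.convex.monotoneOn_deriv fun x hx => hF.diff x hx
  have hCv : v₀ ≤ C := hv₀'.trans (by linarith [hF.neg_le_deriv hl])
  have hcont : ContinuousOn (fun v => v + deriv F (q v)) (Icc v₀ C) := by
    refine continuousOn_id.add (hF.continuousOn_deriv.comp hqcont.continuousOn ?_)
    intro v hv
    exact hqpos v (hv₀.trans_le hv.1)
  have hivt := intermediate_value_Icc hCv hcont
  have h0 : (0 : ℝ) ∈ Icc (v₀ + deriv F (q v₀)) (C + deriv F (q C)) := by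
    refine ⟨?_, ?_⟩
    · have := hmono (hqpos v₀ hv₀) hl hv₀q
      linarith
    · have := hF.neg_le_deriv (hqpos C (hv₀.trans_le hCv))
      linarith
  obtain ⟨v, hv, hv0⟩ := hivt h0
  have hvpos : 0 < v := hv₀.trans_le hv.1
  exact ⟨v, key hvpos.le (hqpos v hvpos) (by simp only at hv0; linarith)⟩

/-! ### The annealed free energy as a Legendre transform -/

/-- The slope of `u ↦ b u^γ` at `v b`. -/
def tiltSlope (γ : ℝ) (v : ℝ → ℝ) (b : ℝ) : ℝ := b * γ * v b ^ (γ - 1)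

/-- The limit of `(1/d) log 𝔼 exp (-d b u^γ)`. -/
def freeEnergy (F : ℝ → ℝ) (γ : ℝ) (v : ℝ → ℝ) (b : ℝ) : ℝ :=
  b * (γ - 1) * v b ^ γ + F (tiltSlope γ v b)

/-- The rate function at `v b`. -/
def tiltRate (F : ℝ → ℝ) (γ : ℝ) (v : ℝ → ℝ) (b : ℝ) : ℝ :=
  -(tiltSlope γ v b * v b) - F (tiltSlope γ v b)

section tilt

variable {F : ℝ → ℝ} {C γ : ℝ} {v : ℝ → ℝ}

lemma tiltSlope_mul (hγ : 1 ≤ γ) {b : ℝ} (hv : 0 ≤ v b) :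
    tiltSlope γ v b * v b = b * γ * v b ^ γ := by
  rw [tiltSlope, mul_assoc, rpow_sub_one_mul_self hγ hv]

lemma freeEnergy_eq (hγ : 1 ≤ γ) {b : ℝ} (hv : 0 ≤ v b) :
    freeEnergy F γ v b = -(b * v b ^ γ) - tiltRate F γ v b := by
  rw [freeEnergy, tiltRate, tiltSlope_mul hγ hv]; ring

/-- The tangent of F at the tilted slope. Among the parameters s > 0 this slope attains the supremum
that defines the Legendre transform at `v b`. -/
lemma le_tiltRate (hF : IsLimitLogMGF F C) {b s : ℝ} (hv : IsTilt F γ b (v b)) (hs : 0 < s) :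
    -(s * v b) - F s ≤ tiltRate F γ v b := by
  have h := hF.tangent (s := tiltSlope γ v b) hv.2.1 hs
  rw [show deriv F (tiltSlope γ v b) = -v b from hv.2.2.deriv] at h
  rw [tiltRate]; linarith

lemma tiltRate_nonneg (hF : IsLimitLogMGF F C) {b : ℝ} (hv : IsTilt F γ b (v b)) :
    0 ≤ tiltRate F γ v b := by
  have h := hF.le_mul_deriv (s := tiltSlope γ v b) hv.2.1
  rw [show deriv F (tiltSlope γ v b) = -v b from hv.2.2.deriv] at h
  rw [tiltRate]; linarith

lemma tilt_le (hF : IsLimitLogMGF F C) {b : ℝ} (hv : IsTilt F γ b (v b)) : v b ≤ C := by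
  have h := hF.neg_le_deriv (s := tiltSlope γ v b) hv.2.1
  rw [show deriv F (tiltSlope γ v b) = -v b from hv.2.2.deriv] at h
  linarith

/-- The variational form G(b) = sup_w (-b w^γ - J(w)), tested at another tilted mean w = v(b₀). As a
function of b the bound is a line. -/
lemma le_freeEnergy (hF : IsLimitLogMGF F C) (hγ : 1 ≤ γ) {b b₀ : ℝ} (hb : 0 < b)
    (hv : IsTilt F γ b (v b)) (hv₀ : IsTilt F γ b₀ (v b₀)) :
    -(b * v b₀ ^ γ) - tiltRate F γ v b₀ ≤ freeEnergy F γ v b := by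
  have h1 := le_tiltRate hF hv₀ hv.2.1
  have h2 := mul_le_mul_of_nonneg_left (rpow_tangent hγ hv.1 hv₀.1) hb.le
  have h3 := tiltSlope_mul hγ hv.1
  have h4 : b * γ * v b ^ (γ - 1) = tiltSlope γ v b := rfl
  rw [h4] at h1
  have h5 : b * (v b ^ γ + γ * v b ^ (γ - 1) * (v b₀ - v b))
      = b * v b ^ γ + tiltSlope γ v b * v b₀ - tiltSlope γ v b * v b := by
    rw [tiltSlope]; ring
  rw [h5, h3] at h2
  rw [freeEnergy]
  linarith

/-- The dual form: the tangent of u^γ at any w gives an upper bound for G(b), with equality at w =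
v(b). -/
lemma freeEnergy_le (hF : IsLimitLogMGF F C) (hγ : 1 ≤ γ) {b w : ℝ} (hb : 0 < b)
    (hv : IsTilt F γ b (v b)) (hw : 0 ≤ w) (hw' : 0 < b * γ * w ^ (γ - 1)) :
    freeEnergy F γ v b ≤ b * (γ - 1) * w ^ γ + F (b * γ * w ^ (γ - 1)) := by
  have h1 := le_tiltRate hF hv hw'
  have h2 := mul_le_mul_of_nonneg_left (rpow_tangent hγ hw hv.1) hb.le
  have h3 := rpow_sub_one_mul_self hγ hw
  have h5 : b * (w ^ γ + γ * w ^ (γ - 1) * (v b - w))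
      = b * w ^ γ + b * γ * w ^ (γ - 1) * v b - b * γ * (w ^ (γ - 1) * w) := by ring
  rw [h5, h3] at h2
  rw [freeEnergy_eq hγ hv.1]
  linarith

/-- Envelope theorem: at w = v(b) fixed, the bounds `le_freeEnergy` and `freeEnergy_le` touch G at b
with the same slope -v(b)^γ, so differentiability of v is not needed. -/
lemma hasDerivAt_freeEnergy (hF : IsLimitLogMGF F C) (hγ : 1 ≤ γ)
    (hv : ∀ b : ℝ, 0 < b → IsTilt F γ b (v b)) {b : ℝ} (hb : 0 < b) :
    HasDerivAt (freeEnergy F γ v) (-v b ^ γ) b := by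
  have hγ0 : 0 < γ := by linarith
  have hvb := hv b hb
  have hpos : 0 < v b ^ (γ - 1) := by
    have := hvb.2.1
    by_contra! hcon
    have : b * γ * v b ^ (γ - 1) ≤ 0 := mul_nonpos_of_nonneg_of_nonpos (by positivity) hcon
    linarith
  refine hasDerivAt_of_le_of_le
    (Φ := fun x => x * (γ - 1) * v b ^ γ + F (x * γ * v b ^ (γ - 1))) ?_ rfl ?_ ?_
  · have h1 : HasDerivAt (fun x : ℝ => x * γ * v b ^ (γ - 1)) (γ * v b ^ (γ - 1)) b := by
      simpa using ((hasDerivAt_id b).mul_const γ).mul_const (v b ^ (γ - 1))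
    have h2 : HasDerivAt (fun x : ℝ => x * (γ - 1) * v b ^ γ) ((γ - 1) * v b ^ γ) b := by
      simpa using ((hasDerivAt_id b).mul_const (γ - 1)).mul_const (v b ^ γ)
    have h3 := h2.add (hvb.2.2.comp b h1)
    refine h3.congr_deriv ?_
    rw [← rpow_sub_one_mul_self hγ hvb.1]; ring
  · filter_upwards [Ioi_mem_nhds hb] with x hx
    have := le_freeEnergy hF hγ hx (hv x hx) hvb
    rw [freeEnergy_eq hγ hvb.1]
    linarith
  · filter_upwards [Ioi_mem_nhds hb] with x hx
    have hx' : (0 : ℝ) < x := hx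
    exact freeEnergy_le hF hγ hx (hv x hx) hvb.1 (by positivity)

lemma deriv_freeEnergy (hF : IsLimitLogMGF F C) (hγ : 1 ≤ γ)
    (hv : ∀ b : ℝ, 0 < b → IsTilt F γ b (v b)) {b : ℝ} (hb : 0 < b) :
    deriv (freeEnergy F γ v) b = -v b ^ γ := (hasDerivAt_freeEnergy hF hγ hv hb).deriv

/-- The derivative -v^γ of a strictly convex function is strictly increasing. -/
lemma strictAntiOn_tilt (hF : IsLimitLogMGF F C) (hγ : 1 ≤ γ)
    (hv : ∀ b : ℝ, 0 < b → IsTilt F γ b (v b))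
    (hG : StrictConvexOn ℝ (Ioi 0) (freeEnergy F γ v)) : StrictAntiOn v (Ioi 0) := by
  have h := hG.strictMonoOn_deriv fun x hx => (hasDerivAt_freeEnergy hF hγ hv hx).differentiableAt
  intro x hx y hy hxy
  have h1 := h hx hy hxy
  rw [deriv_freeEnergy hF hγ hv hx, deriv_freeEnergy hF hγ hv hy] at h1
  by_contra! hcon
  have := Real.rpow_le_rpow (hv x hx).1 hcon (by linarith : (0 : ℝ) ≤ γ)
  linarith

lemma continuousOn_tilt (hF : IsLimitLogMGF F C) (hγ : 1 ≤ γ)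
    (hv : ∀ b : ℝ, 0 < b → IsTilt F γ b (v b))
    (hG : StrictConvexOn ℝ (Ioi 0) (freeEnergy F γ v)) : ContinuousOn v (Ioi 0) := by
  have h := continuousOn_deriv_of_convexOn hG.convexOn
    fun x hx => (hasDerivAt_freeEnergy hF hγ hv hx).differentiableAt
  have h2 : ContinuousOn (fun b => (-deriv (freeEnergy F γ v) b) ^ (1 / γ)) (Ioi 0) :=
    h.neg.rpow_const fun x _ => Or.inr (by positivity)
  refine h2.congr fun b hb => ?_
  beta_reduce
  rw [deriv_freeEnergy hF hγ hv hb, neg_neg, ← Real.rpow_mul (hv b hb).1,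
    mul_one_div_cancel (by linarith), Real.rpow_one]

lemma continuousOn_tiltSlope (hF : IsLimitLogMGF F C) (hγ : 1 ≤ γ)
    (hv : ∀ b : ℝ, 0 < b → IsTilt F γ b (v b))
    (hG : StrictConvexOn ℝ (Ioi 0) (freeEnergy F γ v)) :
    ContinuousOn (tiltSlope γ v) (Ioi 0) :=
  (continuousOn_id.mul continuousOn_const).mul
    ((continuousOn_tilt hF hγ hv hG).rpow_const fun _ _ => Or.inr (by linarith))

lemma tiltRate_eq (hγ : 1 ≤ γ) {b : ℝ} (hv : 0 ≤ v b) :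
    tiltRate F γ v b = -(b * v b ^ γ) - freeEnergy F γ v b := by
  rw [freeEnergy_eq hγ hv]; ring

lemma continuousOn_tiltRate (hF : IsLimitLogMGF F C) (hγ : 1 ≤ γ)
    (hv : ∀ b : ℝ, 0 < b → IsTilt F γ b (v b))
    (hG : StrictConvexOn ℝ (Ioi 0) (freeEnergy F γ v)) :
    ContinuousOn (tiltRate F γ v) (Ioi 0) := by
  have h1 : ContinuousOn (freeEnergy F γ v) (Ioi 0) := fun b hb =>
    (hasDerivAt_freeEnergy hF hγ hv hb).continuousAt.continuousWithinAt
  have h2 : ContinuousOn (fun b => b * v b ^ γ) (Ioi 0) := continuousOn_id.mul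
    ((continuousOn_tilt hF hγ hv hG).rpow_const fun _ _ => Or.inr (by linarith))
  exact (h2.neg.sub h1).congr fun b hb => tiltRate_eq hγ (hv b hb).1

/-- For x < y, optimality of v(x) at x gives S(y) - S(x) ≥ x (v(x)^γ - v(y)^γ), and this is positive
because v decreases. The freezing point is unique for this reason. -/
lemma strictMonoOn_tiltRate (hF : IsLimitLogMGF F C) (hγ : 1 ≤ γ)
    (hv : ∀ b : ℝ, 0 < b → IsTilt F γ b (v b))
    (hG : StrictConvexOn ℝ (Ioi 0) (freeEnergy F γ v)) :
    StrictMonoOn (tiltRate F γ v) (Ioi 0) := by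
  intro x hx y hy hxy
  have hx' : (0 : ℝ) < x := hx
  rw [tiltRate_eq hγ (hv x hx).1, tiltRate_eq hγ (hv y hy).1]
  have h1 := le_freeEnergy hF hγ hx (hv x hx) (hv y hy)
  rw [tiltRate_eq hγ (hv y hy).1] at h1
  have h2 := Real.rpow_lt_rpow (hv y hy).1 (strictAntiOn_tilt hF hγ hv hG hx hy hxy)
    (by linarith : (0 : ℝ) < γ)
  nlinarith

/-- The rate tends to 0 at infinite temperature b → 0: the tilted means are bounded by C, and F is
bounded below by a linear function. -/
lemma tiltRate_le (hF : IsLimitLogMGF F C) (hγ : 1 ≤ γ) {b : ℝ} (hb : 0 < b)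
    (hv : IsTilt F γ b (v b)) : tiltRate F γ v b ≤ b * (C * γ * C ^ (γ - 1)) := by
  have h1 := hF.lower _ hv.2.1
  have h2 : v b ^ (γ - 1) ≤ C ^ (γ - 1) :=
    Real.rpow_le_rpow hv.1 (tilt_le hF hv) (by linarith)
  have h3 : 0 ≤ tiltSlope γ v b * v b := mul_nonneg hv.2.1.le hv.1
  have h4 : C * (b * γ * v b ^ (γ - 1)) ≤ C * (b * γ * C ^ (γ - 1)) := by
    have := hF.nonneg
    gcongr
  have h5 : b * γ * v b ^ (γ - 1) = tiltSlope γ v b := rfl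
  rw [h5] at h1 h4
  rw [tiltRate]
  linarith

lemma exists_tiltRate_eq (hF : IsLimitLogMGF F C) (hγ : 1 ≤ γ)
    (hv : ∀ b : ℝ, 0 < b → IsTilt F γ b (v b))
    (hG : StrictConvexOn ℝ (Ioi 0) (freeEnergy F γ v)) {α β : ℝ} (hα : 0 < α) (hβ : 0 < β)
    (h : α < tiltRate F γ v β) : ∃ b, 0 < b ∧ b < β ∧ tiltRate F γ v b = α := by
  set M := C * γ * C ^ (γ - 1) with hM
  have hM0 : 0 ≤ M := by have := hF.nonneg; positivity
  set b₀ := min β (α / (M + 1)) with hb₀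
  have hb₀pos : 0 < b₀ := lt_min hβ (by positivity)
  have h1 : tiltRate F γ v b₀ ≤ α := by
    refine (tiltRate_le hF hγ hb₀pos (hv b₀ hb₀pos)).trans ?_
    have : b₀ ≤ α / (M + 1) := min_le_right _ _
    rw [le_div_iff₀ (by positivity)] at this
    nlinarith
  have hcont : ContinuousOn (tiltRate F γ v) (Icc b₀ β) :=
    (continuousOn_tiltRate hF hγ hv hG).mono fun x hx => hb₀pos.trans_le hx.1
  obtain ⟨b, hb, hbα⟩ := intermediate_value_Icc (min_le_left _ _) hcont ⟨h1, h.le⟩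
  refine ⟨b, hb₀pos.trans_le hb.1, lt_of_le_of_ne hb.2 ?_, hbα⟩
  rintro rfl
  exact h.ne' hbα

/-- A function that agrees with the rate function along the tilted means is differentiable there. -/
lemma hasDerivAt_of_eq_tiltRate (hF : IsLimitLogMGF F C) (hγ : 1 ≤ γ)
    (hv : ∀ b : ℝ, 0 < b → IsTilt F γ b (v b))
    (hG : StrictConvexOn ℝ (Ioi 0) (freeEnergy F γ v)) {J : ℝ → ℝ}
    (hJ : ∀ b, 0 < b → J (v b) = tiltRate F γ v b) {b : ℝ} (hb : 0 < b) :
    HasDerivAt J (-tiltSlope γ v b) (v b) := by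
  rw [hasDerivAt_iff_isLittleO, Asymptotics.isLittleO_iff]
  intro c hc
  have hcont : ContinuousAt (tiltSlope γ v) b :=
    (continuousOn_tiltSlope hF hγ hv hG).continuousAt (Ioi_mem_nhds hb)
  obtain ⟨δ, hδ, hδc⟩ := Metric.continuousAt_iff.1 hcont c hc
  set η := min (δ / 2) (b / 2) with hη
  have hηpos : 0 < η := lt_min (by linarith) (by linarith)
  have hη1 : η ≤ δ / 2 := min_le_left _ _
  have hη2 : η ≤ b / 2 := min_le_right _ _
  have hanti := strictAntiOn_tilt hF hγ hv hG
  have h1 : v b < v (b - η) := hanti (show 0 < b - η by linarith) hb (by linarith)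
  have h2 : v (b + η) < v b := hanti hb (show 0 < b + η by linarith) (by linarith)
  -- Since v is continuous and decreasing, every u near v(b) is itself a tilted mean v(b') with |b'
  -- - b| ≤ η, where the value of J is known.
  filter_upwards [Icc_mem_nhds h2 h1] with u hu
  have hcv : ContinuousOn v (Icc (b - η) (b + η)) :=
    (continuousOn_tilt hF hγ hv hG).mono fun x hx => (show 0 < b - η by linarith).trans_le hx.1
  obtain ⟨b', hb', rfl⟩ := intermediate_value_Icc' (by linarith) hcv hu
  have hb'pos : 0 < b' := (show 0 < b - η by linarith).trans_le hb'.1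
  have h3 : |tiltSlope γ v b' - tiltSlope γ v b| < c := by
    rw [← Real.dist_eq]
    refine hδc ?_
    rw [Real.dist_eq, abs_lt]
    constructor <;> linarith [hb'.1, hb'.2]
  have h4 := le_tiltRate hF (hv b hb) (hv b' hb'pos).2.1
  have h5 := le_tiltRate hF (hv b' hb'pos) (hv b hb).2.1
  have e4 : b' * γ * v b' ^ (γ - 1) = tiltSlope γ v b' := rfl
  have e5 : b * γ * v b ^ (γ - 1) = tiltSlope γ v b := rfl
  rw [e4] at h4
  rw [e5] at h5
  have e6 : F (tiltSlope γ v b') = -(tiltSlope γ v b' * v b') - tiltRate F γ v b' := by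
    rw [tiltRate]; ring
  have e7 : F (tiltSlope γ v b) = -(tiltSlope γ v b * v b) - tiltRate F γ v b := by
    rw [tiltRate]; ring
  rw [e6] at h4
  rw [e7] at h5
  rw [hJ b hb, hJ b' hb'pos, smul_eq_mul, Real.norm_eq_abs, Real.norm_eq_abs]
  -- The two supporting inequalities, at b and at b', place the remainder between 0 and the
  -- difference of the slopes times v(b') - v(b).
  have h6 : 0 ≤ tiltRate F γ v b' - tiltRate F γ v b - (v b' - v b) * -tiltSlope γ v b := by
    linarith
  rw [abs_of_nonneg h6]
  have h7 : (tiltSlope γ v b - tiltSlope γ v b') * (v b' - v b) ≤ c * |v b' - v b| := by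
    refine (le_abs_self _).trans ?_
    rw [abs_mul, abs_sub_comm (tiltSlope γ v b)]
    gcongr
  linarith

end tilt

/-! ### The normalization of the kernel -/

lemma tendsto_log_factorial_div_sub_log :
    Tendsto (fun n : ℕ => Real.log n.factorial / n - Real.log n) atTop (𝓝 (-1)) := by
  have h1 : Tendsto (fun n : ℕ => Real.log (Stirling.stirlingSeq n)) atTop
      (𝓝 (Real.log √Real.pi)) :=
    Stirling.tendsto_stirlingSeq_sqrt_pi.log (by positivity)
  have h2 : Tendsto (fun n : ℕ => (n : ℝ)⁻¹) atTop (𝓝 0) := tendsto_inv_atTop_nhds_zero_nat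
  have h3 : Tendsto (fun n : ℕ => Real.log n / n) atTop (𝓝 0) :=
    (Real.isLittleO_log_id_atTop.tendsto_div_nhds_zero).comp tendsto_natCast_atTop_atTop
  have h4 := ((h1.mul h2).add ((h2.const_mul (1 / 2 * Real.log 2)).add
    (h3.const_mul (1 / 2)))).sub_const 1
  have h5 : Real.log √Real.pi * 0 + (1 / 2 * Real.log 2 * 0 + 1 / 2 * 0) - 1 = -1 := by ring
  rw [h5] at h4
  refine h4.congr' ?_
  filter_upwards [eventually_ge_atTop 1] with n hn
  have hn' : (0 : ℝ) < n := by exact_mod_cast hn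
  rw [Stirling.log_stirlingSeq_formula, Real.log_mul (by norm_num) hn'.ne',
    Real.log_div hn'.ne' (Real.exp_ne_zero _), Real.log_exp]
  field_simp
  ring

/-- Stirling's formula to first order at real arguments, by comparison of x with n = ⌊x⌋ and
monotonicity of Γ: from Γ(n) = n!/n below and Γ(n+1) = n! above. -/
lemma tendsto_log_Gamma_div_sub_log :
    Tendsto (fun x : ℝ => Real.log (Real.Gamma x) / x - Real.log x) atTop (𝓝 (-1)) := by
  have ha : Tendsto (fun x : ℝ => Real.log (⌊x⌋₊).factorial / ⌊x⌋₊ - Real.log ⌊x⌋₊) atTop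
      (𝓝 (-1)) := tendsto_log_factorial_div_sub_log.comp tendsto_nat_floor_atTop
  have hr : Tendsto (fun x : ℝ => (⌊x⌋₊ : ℝ) / x) atTop (𝓝 1) := tendsto_nat_floor_div_atTop
  have h1 : Tendsto (fun x : ℝ => x⁻¹) atTop (𝓝 0) := tendsto_inv_atTop_zero
  have h2 : Tendsto (fun x : ℝ => Real.log x / x) atTop (𝓝 0) :=
    Real.isLittleO_log_id_atTop.tendsto_div_nhds_zero
  have hup := hr.mul ha
  have hlow := (hup.sub h1).sub (h2.const_mul 2)
  rw [one_mul] at hup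
  have e : (1 : ℝ) * -1 - 0 - 2 * 0 = -1 := by ring
  rw [e] at hlow
  refine tendsto_of_tendsto_of_tendsto_of_le_of_le' hlow hup ?_ ?_
  all_goals
    filter_upwards [eventually_ge_atTop (3 : ℝ)] with x hx
    have hx0 : 0 < x := by linarith
    have hn3 : 3 ≤ ⌊x⌋₊ := Nat.le_floor (by exact_mod_cast hx)
    have hnx : (⌊x⌋₊ : ℝ) ≤ x := Nat.floor_le hx0.le
    have hxn : x < ⌊x⌋₊ + 1 := Nat.lt_floor_add_one x
    have hn3' : (3 : ℝ) ≤ ⌊x⌋₊ := by exact_mod_cast hn3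
    have hlogx : 0 ≤ Real.log x := Real.log_nonneg (by linarith)
    obtain ⟨n, hn⟩ : ∃ n : ℕ, n = ⌊x⌋₊ := ⟨_, rfl⟩
    rw [← hn] at hn3 hnx hxn hn3' ⊢
    have hn0 : (0 : ℝ) < n := by linarith
    have hG0 : 0 < Real.Gamma x := Real.Gamma_pos_of_pos hx0
  · have hG : Real.Gamma n ≤ Real.Gamma x :=
      Real.Gamma_strictMonoOn_Ici.monotoneOn (by simp; linarith) (by simp; linarith) hnx
    have hf : Real.log (n.factorial : ℝ) = Real.log (Real.Gamma n) + Real.log n := by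
      rw [← Real.Gamma_nat_eq_factorial, Real.Gamma_add_one hn0.ne',
        Real.log_mul hn0.ne' (Real.Gamma_pos_of_pos hn0).ne', add_comm]
    have hl := Real.log_le_log (Real.Gamma_pos_of_pos hn0) hG
    have hln : Real.log n ≤ Real.log x := Real.log_le_log hn0 hnx
    -- Together with (x - n) log x ≤ log x and log n ≤ log x, this bounds the loss in passing from x
    -- to n by 1 + 2 log x.
    have hd : n * (Real.log x - Real.log n) ≤ 1 := by
      rw [← Real.log_div hx0.ne' hn0.ne']
      have := Real.log_le_sub_one_of_pos (show 0 < x / n by positivity)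
      calc n * Real.log (x / n) ≤ n * (x / n - 1) := by gcongr
        _ = x - n := by field_simp
        _ ≤ 1 := by linarith
    have key : (n / x * (Real.log (n.factorial : ℝ) / n - Real.log n) - x⁻¹
        - 2 * (Real.log x / x)) = (Real.log (n.factorial : ℝ) - n * Real.log n - 1
          - 2 * Real.log x) / x := by
      field_simp
    rw [key, ← sub_nonneg]
    have key2 : Real.log (Real.Gamma x) / x - Real.log x - (Real.log (n.factorial : ℝ)
        - n * Real.log n - 1 - 2 * Real.log x) / x = (Real.log (Real.Gamma x) - x * Real.log x
          - (Real.log (n.factorial : ℝ) - n * Real.log n - 1 - 2 * Real.log x)) / x := by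
      field_simp
    rw [key2]
    refine div_nonneg ?_ hx0.le
    nlinarith
  · have hG : Real.Gamma x ≤ Real.Gamma (n + 1) :=
      Real.Gamma_strictMonoOn_Ici.monotoneOn (by simp; linarith) (by simp; linarith) hxn.le
    rw [Real.Gamma_nat_eq_factorial] at hG
    have hl := Real.log_le_log hG0 hG
    have hln : Real.log n ≤ Real.log x := Real.log_le_log hn0 hnx
    have key : n / x * (Real.log (n.factorial : ℝ) / n - Real.log n)
        = (Real.log (n.factorial : ℝ) - n * Real.log n) / x := by
      field_simp
    rw [key, ← sub_nonneg]
    have key2 : (Real.log (n.factorial : ℝ) - n * Real.log n) / x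
        - (Real.log (Real.Gamma x) / x - Real.log x)
        = (Real.log (n.factorial : ℝ) - n * Real.log n
          - (Real.log (Real.Gamma x) - x * Real.log x)) / x := by
      field_simp
    rw [key2]
    refine div_nonneg ?_ hx0.le
    nlinarith

/-- The partition function of the `γ`-kernel. -/
lemma integral_exp_neg_rpow_norm {γ : ℝ} (hγ : 1 ≤ γ) {d : ℕ} (hd : 1 ≤ d) :
    ∫ z : Sp d, Real.exp (-((d : ℝ) * (1 / (2 * γ) * (‖z‖ ^ 2 / (d : ℝ)) ^ γ)))
      = d * (√Real.pi ^ d / Real.Gamma ((d : ℝ) / 2 + 1)) *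
        (((d : ℝ) * (1 / (2 * γ)) * (d : ℝ) ^ (-γ)) ^ (-(d : ℝ) / (2 * γ)) * (1 / (2 * γ)) *
          Real.Gamma ((d : ℝ) / (2 * γ))) := by
  have hd0 : (0 : ℝ) < d := by exact_mod_cast hd
  have hγ0 : 0 < γ := by linarith
  have : Nonempty (Fin d) := ⟨⟨0, hd⟩⟩
  have : Nontrivial (Sp d) := by
    refine Module.nontrivial_of_finrank_pos (R := ℝ) ?_
    rw [finrank_euclideanSpace_fin]; exact hd
  rw [integral_fun_norm_addHaar volume
    (fun r : ℝ => Real.exp (-((d : ℝ) * (1 / (2 * γ) * (r ^ 2 / (d : ℝ)) ^ γ)))),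
    finrank_euclideanSpace_fin]
  have hball : (volume : Measure (Sp d)).real (Metric.ball 0 1)
      = √Real.pi ^ d / Real.Gamma ((d : ℝ) / 2 + 1) := by
    rw [measureReal_def, EuclideanSpace.volume_ball, Fintype.card_fin, ENNReal.ofReal_one, one_pow,
      one_mul, ENNReal.toReal_ofReal]
    have := Real.Gamma_pos_of_pos (show 0 < (d : ℝ) / 2 + 1 by positivity)
    positivity
  have hint := integral_rpow_mul_exp_neg_mul_rpow (p := 2 * γ) (q := (d : ℝ) - 1)
    (b := (d : ℝ) * (1 / (2 * γ)) * (d : ℝ) ^ (-γ)) (by positivity) (by linarith)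
    (by positivity)
  rw [sub_add_cancel] at hint
  rw [hball, ← hint, nsmul_eq_mul, smul_eq_mul, ← mul_assoc]
  congr 1
  refine setIntegral_congr_fun measurableSet_Ioi fun r hr => ?_
  have hr0 : (0 : ℝ) < r := hr
  have e1 : r ^ (d - 1) = r ^ ((d : ℝ) - 1) := by
    rw [← Real.rpow_natCast, Nat.cast_sub hd, Nat.cast_one]
  have e2 : (r ^ 2 / (d : ℝ)) ^ γ = r ^ (2 * γ) * (d : ℝ) ^ (-γ) := by
    rw [Real.div_rpow (by positivity) hd0.le, Real.rpow_neg hd0.le, Real.rpow_mul hr0.le,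
      Real.rpow_two, div_eq_mul_inv]
  simp only [smul_eq_mul, e1, e2]
  congr 2
  ring

lemma integral_exp_neg_rpow_norm_pos {γ : ℝ} (hγ : 1 ≤ γ) {d : ℕ} (hd : 1 ≤ d) :
    0 < ∫ z : Sp d, Real.exp (-((d : ℝ) * (1 / (2 * γ) * (‖z‖ ^ 2 / (d : ℝ)) ^ γ))) := by
  rw [integral_exp_neg_rpow_norm hγ hd]
  have hd0 : (0 : ℝ) < d := by exact_mod_cast hd
  have hγ0 : 0 < γ := by linarith
  have h1 := Real.Gamma_pos_of_pos (show 0 < (d : ℝ) / 2 + 1 by positivity)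
  have h2 := Real.Gamma_pos_of_pos (show 0 < (d : ℝ) / (2 * γ) by positivity)
  positivity

lemma integral_kernel {γ : ℝ} (hγ : 1 ≤ γ) {d : ℕ} (hd : 1 ≤ d) :
    ∫ z : Sp d, kernel γ z = 1 := by
  have hd0 : (0 : ℝ) < d := by exact_mod_cast hd
  have hpos := integral_exp_neg_rpow_norm_pos hγ hd
  have h : ∀ z : Sp d, kernel γ z = Real.exp ((d : ℝ) * kernelConst γ d) *
      Real.exp (-((d : ℝ) * (1 / (2 * γ) * (‖z‖ ^ 2 / (d : ℝ)) ^ γ))) := fun z => by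
    rw [kernel, ← Real.exp_add]; congr 1; ring
  simp_rw [h]
  rw [integral_const_mul]
  have e : (d : ℝ) * kernelConst γ d = -Real.log (∫ z : Sp d,
      Real.exp (-((d : ℝ) * (1 / (2 * γ) * (‖z‖ ^ 2 / (d : ℝ)) ^ γ)))) := by
    rw [kernelConst]; field_simp
  rw [e, Real.exp_neg, Real.exp_log hpos, inv_mul_cancel₀ hpos.ne']

/-- In the explicit partition function the terms in log d cancel: the two Gamma factors give -1/2 +
1/(2γ) and the scale factor gives (γ-1)/(2γ). What remains converges by Stirling's formula. -/
lemma exists_tendsto_kernelConst {γ : ℝ} (hγ : 1 ≤ γ) :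
    ∃ c : ℝ, Tendsto (kernelConst γ) atTop (𝓝 c) := by
  have hγ0 : 0 < γ := by linarith
  have hnat : Tendsto (fun d : ℕ => (d : ℝ)) atTop atTop := tendsto_natCast_atTop_atTop
  have hA := tendsto_log_Gamma_div_sub_log.comp (hnat.atTop_div_const (show (0 : ℝ) < 2 by norm_num))
  have hB := tendsto_log_Gamma_div_sub_log.comp
    (hnat.atTop_div_const (show (0 : ℝ) < 2 * γ by positivity))
  have h1 : Tendsto (fun d : ℕ => (d : ℝ)⁻¹) atTop (𝓝 0) := tendsto_inv_atTop_nhds_zero_nat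
  have hC := (((h1.const_mul (Real.log 2 + Real.log (1 / (2 * γ)))).add
    (hA.const_mul (-(1 / 2)))).add (hB.const_mul (1 / (2 * γ)))).add_const
    (1 / 2 * Real.log Real.pi + 1 / 2 * Real.log 2)
  refine ⟨_, hC.neg.congr' ?_⟩
  filter_upwards [eventually_ge_atTop 1] with d hd
  have hd0 : (0 : ℝ) < d := by exact_mod_cast hd
  have hG1 := Real.Gamma_pos_of_pos (show 0 < (d : ℝ) / 2 by positivity)
  have hG2 := Real.Gamma_pos_of_pos (show 0 < (d : ℝ) / (2 * γ) by positivity)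
  have hg : Real.Gamma ((d : ℝ) / 2 + 1) = (d : ℝ) / 2 * Real.Gamma ((d : ℝ) / 2) :=
    Real.Gamma_add_one (by positivity)
  have hpi := Real.pi_pos
  have e1 : Real.log (√Real.pi ^ d / ((d : ℝ) / 2 * Real.Gamma ((d : ℝ) / 2)))
      = d * (Real.log Real.pi / 2) - (Real.log ((d : ℝ) / 2)
        + Real.log (Real.Gamma ((d : ℝ) / 2))) := by
    rw [Real.log_div (by positivity) (by positivity), Real.log_pow, Real.log_sqrt hpi.le,
      Real.log_mul (by positivity) (by positivity)]
  have e2 : Real.log ((d : ℝ) * (1 / (2 * γ)) * (d : ℝ) ^ (-γ))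
      = Real.log d + Real.log (1 / (2 * γ)) - γ * Real.log d := by
    rw [Real.log_mul (by positivity) (by positivity), Real.log_mul (by positivity) (by positivity),
      Real.log_rpow hd0]
    ring
  rw [kernelConst, integral_exp_neg_rpow_norm hγ hd, hg,
    Real.log_mul (by positivity) (by positivity), Real.log_mul hd0.ne' (by positivity), e1,
    Real.log_mul (x := _ * _) (by positivity) (by positivity),
    Real.log_mul (x := _ ^ _) (by positivity) (by positivity), Real.log_rpow (by positivity), e2]
  simp only [Function.comp_apply]
  rw [Real.log_div hd0.ne' (show (2 : ℝ) ≠ 0 by norm_num),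
    Real.log_div hd0.ne' (show 2 * γ ≠ 0 by positivity),
    show Real.log (1 / (2 * γ)) = -Real.log (2 * γ) by rw [one_div, Real.log_inv],
    show Real.log (2 * γ) = Real.log 2 + Real.log γ from
      Real.log_mul (by norm_num) hγ0.ne']
  field_simp
  ring

/-! ### Logarithmic moment generating functions of the distance to a point -/

/-- The normalized square distance `|x-y|²/d`. -/
def sqDist {d : ℕ} (x y : Sp d) : ℝ := ‖x - y‖ ^ 2 / (d : ℝ)

/-- The normalized moment `(|x|²/d)^γ`. -/
def normMoment (γ : ℝ) {d : ℕ} (x : Sp d) : ℝ := (‖x‖ ^ 2 / (d : ℝ)) ^ γ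

/-- The Boltzmann weight `exp (-d b u^p)` of `u = |x-y|²/d`. -/
def weight (p b : ℝ) {d : ℕ} (x y : Sp d) : ℝ := Real.exp (-((d : ℝ) * (b * sqDist x y ^ p)))

/-- `(1/d) log 𝔼_y exp (-d b u^p)`. -/
def logMGF {d : ℕ} (μ : Measure (Sp d)) (p b : ℝ) (x : Sp d) : ℝ :=
  1 / (d : ℝ) * Real.log (∫ y, weight p b x y ∂μ)

section basic

variable {d : ℕ} {μ : Measure (Sp d)} {p b : ℝ}

lemma sqDist_nonneg (x y : Sp d) : 0 ≤ sqDist x y := by unfold sqDist; positivity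

lemma normMoment_nonneg (γ : ℝ) (x : Sp d) : 0 ≤ normMoment γ x := by
  unfold normMoment; positivity

lemma weight_pos (x y : Sp d) : 0 < weight p b x y := Real.exp_pos _

lemma weight_le_one (hb : 0 ≤ b) (x y : Sp d) : weight p b x y ≤ 1 := by
  rw [weight, Real.exp_le_one_iff, neg_nonpos]
  have := Real.rpow_nonneg (sqDist_nonneg x y) p
  positivity

lemma continuous_sqDist : Continuous fun z : Sp d × Sp d => sqDist z.1 z.2 := by
  unfold sqDist; fun_prop

lemma continuous_sqDist_rpow (hp : 0 ≤ p) :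
    Continuous fun z : Sp d × Sp d => sqDist z.1 z.2 ^ p :=
  continuous_sqDist.rpow_const fun _ => Or.inr hp

lemma continuous_weight (hp : 0 ≤ p) : Continuous fun z : Sp d × Sp d => weight p b z.1 z.2 := by
  have := continuous_sqDist_rpow (d := d) hp
  unfold weight; fun_prop

lemma measurable_weight (hp : 0 ≤ p) : Measurable fun z : Sp d × Sp d => weight p b z.1 z.2 :=
  (continuous_weight hp).measurable

lemma measurable_weight_right (hp : 0 ≤ p) (x : Sp d) : Measurable fun y => weight p b x y :=
  ((continuous_weight hp).comp (by fun_prop : Continuous fun y : Sp d => (x, y))).measurable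

lemma continuous_normMoment {γ : ℝ} (hγ : 0 ≤ γ) : Continuous (normMoment γ : Sp d → ℝ) := by
  unfold normMoment
  exact Continuous.rpow_const (by fun_prop) fun _ => Or.inr hγ

/-- |x-y| is at most twice the larger norm. All the dominations below come from this bound. -/
lemma sqDist_rpow_le {γ : ℝ} (hγ : 0 ≤ γ) (x y : Sp d) :
    sqDist x y ^ γ ≤ 4 ^ γ * (normMoment γ x + normMoment γ y) := by
  have key : ∀ a c : Sp d, ‖a‖ ≤ ‖c‖ → (‖a - c‖ ^ 2 / (d : ℝ)) ^ γ ≤ 4 ^ γ * normMoment γ c := by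
    intro a c h
    rw [normMoment, ← Real.mul_rpow (by norm_num) (by positivity)]
    refine Real.rpow_le_rpow (by positivity) ?_ hγ
    have h1 : ‖a - c‖ ≤ 2 * ‖c‖ := (norm_sub_le a c).trans (by linarith)
    have h2 : ‖a - c‖ ^ 2 ≤ (2 * ‖c‖) ^ 2 := by gcongr
    rw [← mul_div_assoc]
    gcongr
    linarith
  have h4 : (0 : ℝ) ≤ 4 ^ γ := by positivity
  rcases le_total ‖x‖ ‖y‖ with h | h
  · refine (key x y h).trans ?_
    have := normMoment_nonneg γ x
    nlinarith
  · have := key y x h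
    rw [norm_sub_rev] at this
    refine this.trans ?_
    have := normMoment_nonneg γ y
    nlinarith

/-- Hölder's inequality for the moment generating function, for all real parameters. -/
lemma lintegral_exp_sqDist_le (x : Sp d) {s t a c : ℝ} (ha : 0 ≤ a) (hc : 0 ≤ c) (hac : a + c = 1) :
    ∫⁻ y, ENNReal.ofReal (Real.exp (-(d * ((a * s + c * t) * sqDist x y)))) ∂μ ≤
      (∫⁻ y, ENNReal.ofReal (Real.exp (-(d * (s * sqDist x y)))) ∂μ) ^ a *
        (∫⁻ y, ENNReal.ofReal (Real.exp (-(d * (t * sqDist x y)))) ∂μ) ^ c := by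
  have hm : ∀ r : ℝ, Measurable fun y => ENNReal.ofReal (Real.exp (-(d * (r * sqDist x y)))) := by
    intro r
    have h1 : Continuous fun y : Sp d => sqDist x y := by unfold sqDist; fun_prop
    have h2 : Continuous fun y => Real.exp (-(d * (r * sqDist x y))) := by fun_prop
    exact h2.measurable.ennreal_ofReal
  have hH := ENNReal.lintegral_mul_norm_pow_le (μ := μ) (hm s).aemeasurable (hm t).aemeasurable
    ha hc hac
  refine le_trans (le_of_eq ?_) hH
  congr 1
  ext y
  rw [ENNReal.ofReal_rpow_of_pos (Real.exp_pos _), ENNReal.ofReal_rpow_of_pos (Real.exp_pos _),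
    ← ENNReal.ofReal_mul (by positivity), ← Real.exp_mul, ← Real.exp_mul, ← Real.exp_add]
  congr 2
  ring

variable [IsProbabilityMeasure μ]

lemma integrable_weight (hp : 0 ≤ p) (hb : 0 ≤ b) (x : Sp d) :
    Integrable (fun y => weight p b x y) μ := by
  refine Integrable.of_bound (measurable_weight_right hp x).aestronglyMeasurable 1
    (ae_of_all _ fun y => ?_)
  rw [Real.norm_eq_abs, abs_of_pos (weight_pos x y)]
  exact weight_le_one hb x y

lemma integral_weight_pos (hp : 0 ≤ p) (hb : 0 ≤ b) (x : Sp d) :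
    0 < ∫ y, weight p b x y ∂μ := by
  rw [integral_pos_iff_support_of_nonneg (fun y => (weight_pos x y).le) (integrable_weight hp hb x)]
  have : Function.support (fun y => weight p b x y) = univ := by
    ext y; simp [(weight_pos x y).ne']
  rw [this, measure_univ]
  exact one_pos

lemma integral_weight_le_one (hp : 0 ≤ p) (hb : 0 ≤ b) (x : Sp d) :
    ∫ y, weight p b x y ∂μ ≤ 1 := by
  calc ∫ y, weight p b x y ∂μ ≤ ∫ _, (1 : ℝ) ∂μ :=
        integral_mono (integrable_weight hp hb x) (integrable_const _) (weight_le_one hb x)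
    _ = 1 := by simp

lemma logMGF_nonpos (hp : 0 ≤ p) (hb : 0 ≤ b) (x : Sp d) : logMGF μ p b x ≤ 0 :=
  mul_nonpos_of_nonneg_of_nonpos (by positivity)
    (Real.log_nonpos (integral_weight_pos hp hb x).le (integral_weight_le_one hp hb x))

lemma exp_logMGF (hd : 1 ≤ d) (hp : 0 ≤ p) (hb : 0 ≤ b) (x : Sp d) :
    Real.exp (d * logMGF μ p b x) = ∫ y, weight p b x y ∂μ := by
  have hd0 : (0 : ℝ) < d := by exact_mod_cast hd
  rw [logMGF, ← mul_assoc, mul_one_div_cancel hd0.ne', one_mul,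
    Real.exp_log (integral_weight_pos hp hb x)]

lemma measurable_logMGF (hp : 0 ≤ p) : Measurable (logMGF μ p b) := by
  have h : StronglyMeasurable fun x => ∫ y, weight p b x y ∂μ :=
    StronglyMeasurable.integral_prod_right'
      (f := fun z : Sp d × Sp d => weight p b z.1 z.2)
      (measurable_weight (p := p) (b := b) hp).stronglyMeasurable
  exact (Real.measurable_log.comp h.measurable).const_mul _

/-- Jensen's inequality for the logarithmic moment generating function. -/
lemma neg_integral_le_logMGF (hd : 1 ≤ d) (hp : 0 ≤ p) (hb : 0 ≤ b) (x : Sp d)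
    (hint : Integrable (fun y => sqDist x y ^ p) μ) :
    -(b * ∫ y, sqDist x y ^ p ∂μ) ≤ logMGF μ p b x := by
  have hd0 : (0 : ℝ) < d := by exact_mod_cast hd
  set m := ∫ y, sqDist x y ^ p ∂μ with hm
  -- The tangent line of exp at the mean energy, which is then integrated.
  have h1 : ∀ y, Real.exp (-(d * (b * m))) * (1 + (d * (b * m) - d * (b * sqDist x y ^ p)))
      ≤ weight p b x y := fun y => by
    have := Real.add_one_le_exp (d * (b * m) - d * (b * sqDist x y ^ p))
    calc _ ≤ Real.exp (-(d * (b * m))) * Real.exp (d * (b * m) - d * (b * sqDist x y ^ p)) := by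
          gcongr; linarith
      _ = weight p b x y := by rw [weight, ← Real.exp_add]; congr 1; ring
  have hi1 : Integrable (fun y => (d : ℝ) * (b * sqDist x y ^ p)) μ := (hint.const_mul b).const_mul _
  have hi2 : Integrable (fun y => d * (b * m) - d * (b * sqDist x y ^ p)) μ :=
    (integrable_const _).sub hi1
  have hi3 : Integrable (fun y => 1 + (d * (b * m) - d * (b * sqDist x y ^ p))) μ :=
    (integrable_const _).add hi2
  have h2 : Real.exp (-(d * (b * m))) ≤ ∫ y, weight p b x y ∂μ := by
    calc Real.exp (-(d * (b * m)))
        = ∫ y, Real.exp (-(d * (b * m))) * (1 + (d * (b * m) - d * (b * sqDist x y ^ p))) ∂μ := by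
          rw [integral_const_mul, integral_add (integrable_const _) hi2,
            integral_sub (integrable_const _) hi1, integral_const_mul,
            integral_const_mul (μ := μ) (d : ℝ) fun y => b * sqDist x y ^ p,
            integral_const_mul (μ := μ) b fun y => sqDist x y ^ p, ← hm]
          simp
      _ ≤ _ := integral_mono (hi3.const_mul _) (integrable_weight hp hb x) h1
  have h3 := Real.log_le_log (Real.exp_pos _) h2
  rw [Real.log_exp] at h3
  rw [logMGF, one_div, ← div_eq_inv_mul, le_div_iff₀ hd0]
  linarith

lemma integrable_sqDist_rpow {γ : ℝ} (hγ : 0 ≤ γ) (hint : Integrable (normMoment γ) μ) (x : Sp d) :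
    Integrable (fun y => sqDist x y ^ γ) μ := by
  refine Integrable.mono' (((integrable_const (normMoment γ x)).add hint).const_mul (4 ^ γ))
    ((continuous_sqDist_rpow hγ).comp (by fun_prop :
      Continuous fun y : Sp d => (x, y))).aestronglyMeasurable (ae_of_all _ fun y => ?_)
  rw [Real.norm_eq_abs, abs_of_nonneg (Real.rpow_nonneg (sqDist_nonneg x y) γ)]
  exact sqDist_rpow_le hγ x y

lemma neg_moment_le_logMGF (hd : 1 ≤ d) {γ : ℝ} (hγ : 0 ≤ γ) (hb : 0 ≤ b)
    (hint : Integrable (normMoment γ) μ) (x : Sp d) :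
    -(b * (4 ^ γ * (normMoment γ x + ∫ y, normMoment γ y ∂μ))) ≤ logMGF μ γ b x := by
  refine le_trans ?_ (neg_integral_le_logMGF hd hγ hb x (integrable_sqDist_rpow hγ hint x))
  rw [neg_le_neg_iff]
  refine mul_le_mul_of_nonneg_left ?_ hb
  calc ∫ y, sqDist x y ^ γ ∂μ ≤ ∫ y, 4 ^ γ * (normMoment γ x + normMoment γ y) ∂μ :=
        integral_mono (integrable_sqDist_rpow hγ hint x)
          (((integrable_const (normMoment γ x)).add hint).const_mul (4 ^ γ))
          fun y => sqDist_rpow_le hγ x y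
    _ = _ := by rw [integral_const_mul, integral_add (integrable_const _) hint]; simp

lemma le_one_add_rpow {γ u : ℝ} (hγ : 1 ≤ γ) (hu : 0 ≤ u) : u ≤ 1 + u ^ γ := by
  rcases le_total u 1 with h | h
  · have := Real.rpow_nonneg hu γ
    linarith
  · have := Real.self_le_rpow_of_one_le h hγ
    linarith

lemma neg_moment_le_logMGF_one (hd : 1 ≤ d) {γ : ℝ} (hγ : 1 ≤ γ) (hb : 0 ≤ b)
    (hint : Integrable (normMoment γ) μ) (x : Sp d) :
    -(b * (1 + 4 ^ γ * (normMoment γ x + ∫ y, normMoment γ y ∂μ))) ≤ logMGF μ 1 b x := by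
  have hγ0 : 0 ≤ γ := by linarith
  have hle : ∀ y, sqDist x y ^ (1 : ℝ) ≤ 1 + 4 ^ γ * (normMoment γ x + normMoment γ y) := fun y => by
    rw [Real.rpow_one]
    linarith [le_one_add_rpow hγ (sqDist_nonneg x y), sqDist_rpow_le hγ0 x y]
  have hi : Integrable (fun y => 4 ^ γ * (normMoment γ x + normMoment γ y)) μ :=
    ((integrable_const (normMoment γ x)).add hint).const_mul (4 ^ γ)
  have hi2 : Integrable (fun y => sqDist x y ^ (1 : ℝ)) μ := by
    refine Integrable.mono' ((integrable_const (1 : ℝ)).add hi)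
      ((continuous_sqDist_rpow zero_le_one).comp (by fun_prop :
        Continuous fun y : Sp d => (x, y))).aestronglyMeasurable (ae_of_all _ fun y => ?_)
    rw [Real.norm_eq_abs, abs_of_nonneg (Real.rpow_nonneg (sqDist_nonneg x y) _)]
    exact hle y
  refine le_trans ?_ (neg_integral_le_logMGF hd zero_le_one hb x hi2)
  rw [neg_le_neg_iff]
  refine mul_le_mul_of_nonneg_left ?_ hb
  calc ∫ y, sqDist x y ^ (1 : ℝ) ∂μ
      ≤ ∫ y, 1 + 4 ^ γ * (normMoment γ x + normMoment γ y) ∂μ :=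
        integral_mono hi2 ((integrable_const (1 : ℝ)).add hi) hle
    _ = _ := by
        rw [integral_add (integrable_const _) hi, integral_const_mul,
          integral_add (integrable_const _) hint]
        simp

lemma lintegral_exp_sqDist {s : ℝ} (hs : 0 ≤ s) (x : Sp d) :
    ∫⁻ y, ENNReal.ofReal (Real.exp (-(d * (s * sqDist x y)))) ∂μ
      = ENNReal.ofReal (∫ y, weight 1 s x y ∂μ) := by
  rw [ofReal_integral_eq_lintegral_ofReal (integrable_weight zero_le_one hs x)
    (ae_of_all _ fun y => (weight_pos x y).le)]
  simp only [weight, Real.rpow_one]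

lemma logMGF_convex (x : Sp d) {s t a c : ℝ} (hs : 0 ≤ s) (ht : 0 ≤ t)
    (ha : 0 ≤ a) (hc : 0 ≤ c) (hac : a + c = 1) :
    logMGF μ 1 (a * s + c * t) x ≤ a * logMGF μ 1 s x + c * logMGF μ 1 t x := by
  have h := lintegral_exp_sqDist_le (μ := μ) x (s := s) (t := t) ha hc hac
  have hst : 0 ≤ a * s + c * t := by positivity
  have p1 := integral_weight_pos (μ := μ) zero_le_one hst x
  have p2 := integral_weight_pos (μ := μ) zero_le_one hs x
  have p3 := integral_weight_pos (μ := μ) zero_le_one ht x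
  rw [lintegral_exp_sqDist hst, lintegral_exp_sqDist hs, lintegral_exp_sqDist ht,
    ENNReal.ofReal_rpow_of_pos p2, ENNReal.ofReal_rpow_of_pos p3,
    ← ENNReal.ofReal_mul (by positivity), ENNReal.ofReal_le_ofReal_iff (by positivity)] at h
  have h2 := Real.log_le_log p1 h
  rw [Real.log_mul (by positivity) (by positivity), Real.log_rpow p2, Real.log_rpow p3] at h2
  have h3 : (0 : ℝ) ≤ 1 / d := by positivity
  have h4 := mul_le_mul_of_nonneg_left h2 h3
  unfold logMGF
  linarith

/-- The reverse Jensen bound for negative parameters. -/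
lemma log_le_log_lintegral_exp (x : Sp d) {s l : ℝ} (hs : 0 < s) (hl : 0 < l) :
    ((-(l / s) * Real.log (∫ y, weight 1 s x y ∂μ) : ℝ) : EReal) ≤
      ENNReal.log (∫⁻ y, ENNReal.ofReal (Real.exp (-(d * (-l * sqDist x y)))) ∂μ) := by
  have hsl : 0 < s + l := by linarith
  -- The parameter 0 is the convex combination of -l and s with these weights, so Hölder's
  -- inequality bounds 1 by a product of powers of the two moments.
  have h := lintegral_exp_sqDist_le (μ := μ) x (s := -l) (t := s) (a := s / (s + l))
    (c := l / (s + l)) (by positivity) (by positivity) (by field_simp)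
  have e : s / (s + l) * -l + l / (s + l) * s = 0 := by field_simp; ring
  have p2 := integral_weight_pos (μ := μ) zero_le_one hs.le x
  rw [e, lintegral_exp_sqDist hs.le, ENNReal.ofReal_rpow_of_pos p2] at h
  simp only [zero_mul, mul_zero, neg_zero, Real.exp_zero, ENNReal.ofReal_one, lintegral_const,
    measure_univ, mul_one] at h
  set A := ∫⁻ y, ENNReal.ofReal (Real.exp (-(d * (-l * sqDist x y)))) ∂μ with hA
  rcases eq_or_ne A ⊤ with hAt | hAt
  · rw [hAt]; simp
  have hAe : A = ENNReal.ofReal A.toReal := (ENNReal.ofReal_toReal hAt).symm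
  have hApos : 0 < A.toReal := by
    rcases (ENNReal.toReal_nonneg (a := A)).eq_or_lt with h0 | h0
    · rw [hAe, ← h0, ENNReal.ofReal_zero, ENNReal.zero_rpow_of_pos (by positivity), zero_mul] at h
      simp at h
    · exact h0
  rw [hAe, ENNReal.ofReal_rpow_of_pos hApos, ← ENNReal.ofReal_mul (by positivity),
    ENNReal.one_le_ofReal] at h
  have h2 := Real.log_nonneg h
  rw [Real.log_mul (by positivity) (by positivity), Real.log_rpow hApos, Real.log_rpow p2] at h2
  rw [hAe, ENNReal.log_ofReal_of_pos hApos, EReal.coe_le_coe_iff]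
  have e2 : s / (s + l) * Real.log A.toReal + l / (s + l) * Real.log (∫ y, weight 1 s x y ∂μ)
      = (s * Real.log A.toReal + l * Real.log (∫ y, weight 1 s x y ∂μ)) / (s + l) := by
    field_simp
  rw [e2, le_div_iff₀ hsl, zero_mul] at h2
  rw [neg_mul, neg_le_iff_add_nonneg]
  have e3 : Real.log A.toReal + l / s * Real.log (∫ y, weight 1 s x y ∂μ)
      = (s * Real.log A.toReal + l * Real.log (∫ y, weight 1 s x y ∂μ)) / s := by
    field_simp
  rw [e3]
  positivity

end basic

/-! ### Moments -/

lemma UpperUnifInt.const_add_mul {Ω : ℕ → Type*} [∀ d, MeasurableSpace (Ω d)]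
    {μ : ∀ d, Measure (Ω d)} {W : ∀ d, Ω d → ℝ} (h : UpperUnifInt μ W) (a : ℝ) {b : ℝ}
    (hb : 0 ≤ b) : UpperUnifInt μ fun d x => a + b * W d x := by
  intro ε hε
  obtain ⟨R, hR⟩ := h (ε / (b + 1)) (by positivity)
  refine ⟨a + b * R, ?_⟩
  filter_upwards [hR] with d hd
  calc ∫⁻ x, ENNReal.ofReal (a + b * W d x - (a + b * R)) ∂μ d
      = ∫⁻ x, ENNReal.ofReal b * ENNReal.ofReal (W d x - R) ∂μ d := by
        refine lintegral_congr fun x => ?_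
        rw [← ENNReal.ofReal_mul hb]
        congr 1
        ring
    _ = ENNReal.ofReal b * ∫⁻ x, ENNReal.ofReal (W d x - R) ∂μ d :=
        lintegral_const_mul' _ _ ENNReal.ofReal_ne_top
    _ ≤ ENNReal.ofReal b * ENNReal.ofReal (ε / (b + 1)) := by gcongr
    _ = ENNReal.ofReal (b * (ε / (b + 1))) := (ENNReal.ofReal_mul hb).symm
    _ ≤ ENNReal.ofReal ε := by
        refine ENNReal.ofReal_le_ofReal ?_
        rw [← mul_div_assoc, div_le_iff₀ (by positivity)]
        nlinarith

lemma upperUnifInt_normMoment {ρ : (d : ℕ) → Sp d → ℝ} {γ : ℝ} (hγ : 0 ≤ γ)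
    (hmoment : UnifIntMoment ρ γ) :
    UpperUnifInt (fun d => law (ρ d)) fun _ => normMoment γ := by
  intro ε hε
  obtain ⟨R, hR⟩ := hmoment ε hε
  refine ⟨max R 0 ^ γ, ?_⟩
  filter_upwards [hR] with d hd
  refine le_trans ?_ hd
  have hm : MeasurableSet {x : Sp d | R ≤ ‖x‖ ^ 2 / (d : ℝ)} :=
    measurableSet_le measurable_const (by fun_prop)
  rw [← lintegral_indicator hm]
  refine lintegral_mono fun x => ?_
  by_cases hx : x ∈ {x : Sp d | R ≤ ‖x‖ ^ 2 / (d : ℝ)}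
  · rw [indicator_of_mem hx]
    refine ENNReal.ofReal_le_ofReal ?_
    have : 0 ≤ max R 0 ^ γ := by positivity
    rw [normMoment]; linarith
  · rw [indicator_of_notMem hx]
    simp only [mem_ofPred_eq, not_le] at hx
    refine (ENNReal.ofReal_eq_zero.2 ?_).le
    rw [sub_nonpos, normMoment]
    exact Real.rpow_le_rpow (by positivity) (hx.le.trans (le_max_left _ _)) hγ

lemma exists_normMoment_bound {ρ : (d : ℕ) → Sp d → ℝ} {γ : ℝ} (hγ : 0 ≤ γ)
    (hpure : IsPure ρ) (hmoment : UnifIntMoment ρ γ) :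
    ∃ M : ℝ, 0 ≤ M ∧ ∀ᶠ d : ℕ in atTop, Integrable (normMoment γ) (law (ρ d)) ∧
      ∫ x, normMoment γ x ∂law (ρ d) ≤ M := by
  obtain ⟨R, hR⟩ := upperUnifInt_normMoment hγ hmoment 1 one_pos
  refine ⟨max R 0 + 1, by positivity, ?_⟩
  filter_upwards [hR] with d hd
  have := hpure.isProbability d
  have h1 : ∫⁻ x, ENNReal.ofReal (normMoment γ x) ∂law (ρ d) ≤ ENNReal.ofReal (max R 0 + 1) := by
    calc ∫⁻ x, ENNReal.ofReal (normMoment γ x) ∂law (ρ d)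
        ≤ ∫⁻ x, ENNReal.ofReal (max R 0) + ENNReal.ofReal (normMoment γ x - R) ∂law (ρ d) := by
          refine lintegral_mono fun x => ?_
          refine le_trans (ENNReal.ofReal_le_ofReal ?_) ENNReal.ofReal_add_le
          linarith [le_max_left R 0]
      _ = ENNReal.ofReal (max R 0) + ∫⁻ x, ENNReal.ofReal (normMoment γ x - R) ∂law (ρ d) := by
          rw [lintegral_add_left measurable_const]; simp
      _ ≤ ENNReal.ofReal (max R 0) + ENNReal.ofReal 1 := by gcongr
      _ = _ := (ENNReal.ofReal_add (by positivity) zero_le_one).symm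
  have hm : AEStronglyMeasurable (normMoment γ) (law (ρ d)) :=
    (continuous_normMoment hγ).aestronglyMeasurable
  have h0 : 0 ≤ᵐ[law (ρ d)] normMoment γ := ae_of_all _ fun x => normMoment_nonneg γ x
  refine ⟨⟨hm, ?_⟩, ?_⟩
  · rw [hasFiniteIntegral_iff_ofReal h0]
    exact h1.trans_lt ENNReal.ofReal_lt_top
  · rw [integral_eq_lintegral_of_nonneg_ae h0 hm]
    exact ENNReal.toReal_le_of_le_ofReal (by positivity) h1

/-! ### The limit of the generating functions of a pure family -/

section genFun

variable {d : ℕ} {q : Sp d → ℝ}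

lemma genFun_eq_log (x : Sp d) (lam : ℝ) : genFun q 1 x lam = (((d : ℝ)⁻¹ : ℝ) : EReal) *
    ENNReal.log (∫⁻ y, ENNReal.ofReal (Real.exp (-(d * (lam * sqDist x y)))) ∂law q) := by
  unfold genFun sqDist
  simp only [one_pow, mul_one, mul_assoc]

lemma genFun_eq_logMGF [IsProbabilityMeasure (law q)] (x : Sp d) {lam : ℝ} (hlam : 0 ≤ lam) :
    genFun q 1 x lam = (logMGF (law q) 1 lam x : EReal) := by
  rw [genFun_eq_log, lintegral_exp_sqDist hlam,
    ENNReal.log_ofReal_of_pos (integral_weight_pos zero_le_one hlam x), ← EReal.coe_mul, logMGF,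
    one_div]

lemma integrable_logMGF_one [IsProbabilityMeasure (law q)] (hd : 1 ≤ d) {γ lam : ℝ} (hγ : 1 ≤ γ)
    (hint : Integrable (normMoment γ) (law q)) (hlam : 0 ≤ lam) :
    Integrable (logMGF (law q) 1 lam) (law q) := by
  refine Integrable.mono' (g := fun x => lam * (1 + 4 ^ γ * (normMoment γ x +
    ∫ y, normMoment γ y ∂law q))) ?_ (measurable_logMGF zero_le_one).aestronglyMeasurable
    (ae_of_all _ fun x => ?_)
  · exact (((integrable_const 1).add ((hint.add (integrable_const _)).const_mul _)).const_mul _)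
  · rw [Real.norm_eq_abs, abs_of_nonpos (logMGF_nonpos zero_le_one hlam x)]
    linarith [neg_moment_le_logMGF_one (μ := law q) hd hγ hlam hint x]

lemma meanGenFun_eq_integral [IsProbabilityMeasure (law q)] {lam : ℝ} (hlam : 0 ≤ lam)
    (hint : Integrable (logMGF (law q) 1 lam) (law q)) :
    meanGenFun q 1 lam = ((∫ x, logMGF (law q) 1 lam x ∂law q : ℝ) : EReal) := by
  have h0 : ∀ x, logMGF (law q) 1 lam x ≤ 0 := fun x => logMGF_nonpos zero_le_one hlam x
  unfold meanGenFun
  simp_rw [genFun_eq_logMGF _ hlam, ← EReal.coe_neg, EReal.real_coe_toENNReal]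
  have h1 : ∫⁻ x, ENNReal.ofReal (logMGF (law q) 1 lam x) ∂law q = 0 := by
    rw [lintegral_eq_zero_of_ae_eq_zero]
    exact ae_of_all _ fun x => ENNReal.ofReal_of_nonpos (h0 x)
  have h2 : Integrable (fun x => -logMGF (law q) 1 lam x) (law q) := hint.neg
  rw [h1, ← ofReal_integral_eq_lintegral_ofReal h2
    (ae_of_all _ fun x => neg_nonneg.2 (h0 x)), integral_neg,
    EReal.coe_ennreal_ofReal, max_eq_left (neg_nonneg.2 (integral_nonpos h0))]
  simp

lemma meanGenFun_zero [IsProbabilityMeasure (law q)] : meanGenFun q 1 0 = 0 := by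
  have h : ∀ x, logMGF (law q) 1 0 x = 0 := fun x => by simp [logMGF, weight]
  rw [meanGenFun_eq_integral le_rfl (by simp_rw [funext h]; simp)]
  simp [h]

/-- For a negative parameter the generating function may be infinite, but it is nonnegative, so its
mean is a single lower integral; the pointwise bound `log_le_log_lintegral_exp` then integrates. -/
lemma le_meanGenFun_neg [IsProbabilityMeasure (law q)] {s l : ℝ} (hs : 0 < s) (hl : 0 < l)
    (hint : Integrable (logMGF (law q) 1 s) (law q)) :
    ((-(l / s) * ∫ x, logMGF (law q) 1 s x ∂law q : ℝ) : EReal) ≤ meanGenFun q 1 (-l) := by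
  have h0 : ∀ x, 0 ≤ -(l / s) * logMGF (law q) 1 s x := fun x => by
    have := logMGF_nonpos (μ := law q) zero_le_one hs.le x
    have : 0 < l / s := by positivity
    nlinarith
  have h1 : ∀ x, ((-(l / s) * logMGF (law q) 1 s x : ℝ) : EReal) ≤ genFun q 1 x (-l) := fun x => by
    rw [genFun_eq_log]
    have := log_le_log_lintegral_exp (μ := law q) x hs hl
    refine le_trans (le_of_eq ?_) (mul_le_mul_of_nonneg_left this ?_)
    · rw [← EReal.coe_mul, logMGF, one_div]; congr 1; ring
    · exact_mod_cast inv_nonneg.2 (Nat.cast_nonneg d)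
  have h2 : ∫⁻ x, (-genFun q 1 x (-l)).toENNReal ∂law q = 0 := by
    rw [lintegral_eq_zero_of_ae_eq_zero]
    refine ae_of_all _ fun x => EReal.toENNReal_of_nonpos ?_
    rw [EReal.neg_le, neg_zero]
    exact le_trans (by exact_mod_cast h0 x) (h1 x)
  unfold meanGenFun
  rw [h2, EReal.coe_ennreal_zero, sub_zero, ← integral_const_mul]
  have h3 : ENNReal.ofReal (∫ x, -(l / s) * logMGF (law q) 1 s x ∂law q)
      ≤ ∫⁻ x, (genFun q 1 x (-l)).toENNReal ∂law q := by
    rw [ofReal_integral_eq_lintegral_ofReal (hint.const_mul _) (ae_of_all _ h0)]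
    refine lintegral_mono fun x => ?_
    rw [← EReal.real_coe_toENNReal]
    exact EReal.toENNReal_le_toENNReal (h1 x)
  refine le_trans ?_ (EReal.coe_ennreal_le_coe_ennreal_iff.2 h3)
  rw [EReal.coe_ennreal_ofReal]
  exact_mod_cast le_max_left _ _

end genFun

/-- The limit of the generating functions at bandwidth `1`, with real values. -/
def limitMGF (ρ : (d : ℕ) → Sp d → ℝ) (lam : ℝ) : ℝ := (fbar ρ 1 lam).toReal

section pure

variable {ρ : (d : ℕ) → Sp d → ℝ} {γ : ℝ}

/-- Jensen's inequality and the bounded moments of order γ give a lower bound linear in the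
parameter, so that the extended-real limit `fbar` is finite for positive parameters. -/
lemma exists_limitMGF_bound (hγ : 1 ≤ γ) (hpure : IsPure ρ) (hmoment : UnifIntMoment ρ γ) :
    ∃ C : ℝ, ∀ lam : ℝ, 0 < lam → fbar ρ 1 lam = (limitMGF ρ lam : EReal) ∧
      Tendsto (fun d => ∫ x, logMGF (law (ρ d)) 1 lam x ∂law (ρ d)) atTop (𝓝 (limitMGF ρ lam)) ∧
      limitMGF ρ lam ≤ 0 ∧ -(C * lam) ≤ limitMGF ρ lam := by
  have hprob := hpure.isProbability
  obtain ⟨M, hM, hMd⟩ := exists_normMoment_bound (by linarith) hpure hmoment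
  refine ⟨1 + 4 ^ γ * (M + M), fun lam hlam => ?_⟩
  set I : ℕ → ℝ := fun d => ∫ x, logMGF (law (ρ d)) 1 lam x ∂law (ρ d) with hI
  have hev : ∀ᶠ d in atTop, meanGenFun (ρ d) 1 lam = (I d : EReal) ∧ I d ≤ 0 ∧
      -((1 + 4 ^ γ * (M + M)) * lam) ≤ I d := by
    filter_upwards [hMd, eventually_ge_atTop 1] with d hd hd1
    have hi := integrable_logMGF_one hd1 hγ hd.1 hlam.le
    refine ⟨meanGenFun_eq_integral hlam.le hi,
      integral_nonpos fun x => logMGF_nonpos zero_le_one hlam.le x, ?_⟩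
    have hi2 : Integrable (fun x => 4 ^ γ * (normMoment γ x + ∫ y, normMoment γ y ∂law (ρ d)))
        (law (ρ d)) := (hd.1.add (integrable_const _)).const_mul _
    calc -((1 + 4 ^ γ * (M + M)) * lam)
        ≤ ∫ x, -(lam * (1 + 4 ^ γ * (normMoment γ x + ∫ y, normMoment γ y ∂law (ρ d))))
            ∂law (ρ d) := by
          rw [integral_neg, integral_const_mul, integral_add (integrable_const _) hi2,
            integral_const_mul, integral_add hd.1 (integrable_const _), mul_comm]
          simp only [integral_const, probReal_univ, smul_eq_mul, mul_one, one_mul]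
          have := hd.2
          gcongr
      _ ≤ I d := integral_mono (((integrable_const _).add hi2).const_mul _).neg hi
            fun x => neg_moment_le_logMGF_one hd1 hγ hlam.le hd.1 x
  have ht : Tendsto (fun d => (I d : EReal)) atTop (𝓝 (fbar ρ 1 lam)) :=
    (hpure.tendsto_mean 1 one_pos lam hlam).congr' (hev.mono fun d h => h.1)
  have hup : fbar ρ 1 lam ≤ 0 := le_of_tendsto ht (hev.mono fun d h => by exact_mod_cast h.2.1)
  have hlow : ((-((1 + 4 ^ γ * (M + M)) * lam) : ℝ) : EReal) ≤ fbar ρ 1 lam :=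
    ge_of_tendsto ht (hev.mono fun d h => by exact_mod_cast h.2.2)
  have heq : fbar ρ 1 lam = (limitMGF ρ lam : EReal) := by
    refine (EReal.coe_toReal ?_ ?_).symm
    · exact ne_top_of_le_ne_top EReal.zero_ne_top hup
    · exact ne_bot_of_le_ne_bot (EReal.coe_ne_bot _) hlow
  rw [heq] at hup hlow ht
  exact ⟨heq, EReal.tendsto_coe.1 ht, by exact_mod_cast hup, by exact_mod_cast hlow⟩

/-- Hölder's inequality gives convexity at each x and each dimension; integration over x and the
limit preserve it. -/
lemma exists_isLimitLogMGF (hγ : 1 ≤ γ) (hpure : IsPure ρ) (hmoment : UnifIntMoment ρ γ)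
    (hfbar : ∀ lam : ℝ, 0 < lam → DifferentiableAt ℝ (limitMGF ρ) lam) :
    ∃ C : ℝ, IsLimitLogMGF (limitMGF ρ) C := by
  have hprob := hpure.isProbability
  obtain ⟨C, hC⟩ := exists_limitMGF_bound hγ hpure hmoment
  obtain ⟨M, hM, hMd⟩ := exists_normMoment_bound (by linarith) hpure hmoment
  refine ⟨C, ⟨convex_Ioi 0, ?_⟩, hfbar, fun s hs => (hC s hs).2.2.1, fun s hs => (hC s hs).2.2.2⟩
  intro s hs t ht a c ha hc hac
  have hst : a • s + c • t ∈ Ioi (0 : ℝ) := (convex_Ioi 0) hs ht ha hc hac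
  have hs' : (0 : ℝ) < s := hs
  have ht' : (0 : ℝ) < t := ht
  simp only [smul_eq_mul] at hst ⊢
  refine le_of_tendsto_of_tendsto (hC _ hst).2.1
    (((hC s hs).2.1.const_mul a).add ((hC t ht).2.1.const_mul c)) ?_
  filter_upwards [hMd, eventually_ge_atTop 1] with d hd hd1
  have h1 := integrable_logMGF_one hd1 hγ hd.1 hs'.le
  have h2 := integrable_logMGF_one hd1 hγ hd.1 ht'.le
  rw [← integral_const_mul, ← integral_const_mul,
    ← integral_add (h1.const_mul a) (h2.const_mul c)]
  exact integral_mono (integrable_logMGF_one hd1 hγ hd.1 (le_of_lt hst))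
    ((h1.const_mul a).add (h2.const_mul c))
    fun x => logMGF_convex x hs'.le ht'.le ha hc hac

/-- Purity, as convergence in probability. -/
lemma tendsto_logMGF_one (hγ : 1 ≤ γ) (hpure : IsPure ρ) (hmoment : UnifIntMoment ρ γ)
    {lam : ℝ} (hlam : 0 < lam) :
    Tendsto (fun p : Σ d, Sp d => logMGF (law (ρ p.1)) 1 lam p.2) (whp fun d => law (ρ d))
      (𝓝 (limitMGF ρ lam)) := by
  have hprob := hpure.isProbability
  obtain ⟨C, hC⟩ := exists_limitMGF_bound hγ hpure hmoment
  obtain ⟨M, hM, hMd⟩ := exists_normMoment_bound (by linarith) hpure hmoment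
  have h1 : Tendsto (fun p : Σ d, Sp d => logMGF (law (ρ p.1)) 1 lam p.2 -
      (meanGenFun (ρ p.1) 1 lam).toReal) (whp fun d => law (ρ d)) (𝓝 0) := by
    refine (tendsto_whp_iff (X := fun d x => logMGF (law (ρ d)) 1 lam x -
      (meanGenFun (ρ d) 1 lam).toReal)).2 fun ε hε => ?_
    refine (hpure.concentration 1 one_pos lam hlam ε hε).congr fun d => ?_
    simp_rw [genFun_eq_logMGF _ hlam.le, EReal.toReal_coe, sub_zero]
  have h2 : Tendsto (fun d => (meanGenFun (ρ d) 1 lam).toReal) atTop (𝓝 (limitMGF ρ lam)) := by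
    refine (hC lam hlam).2.1.congr' ?_
    filter_upwards [hMd, eventually_ge_atTop 1] with d hd hd1
    rw [meanGenFun_eq_integral hlam.le (integrable_logMGF_one hd1 hγ hd.1 hlam.le),
      EReal.toReal_coe]
  have h3 := h1.add (h2.comp tendsto_fst_whp)
  rw [zero_add] at h3
  refine h3.congr fun p => ?_
  simp

lemma fbar_zero (hpure : IsPure ρ) : fbar ρ 1 0 = 0 := by
  have hprob := hpure.isProbability
  simp [fbar, meanGenFun_zero]

lemma le_fbar_neg (hγ : 1 ≤ γ) (hpure : IsPure ρ) (hmoment : UnifIntMoment ρ γ) {s l : ℝ}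
    (hs : 0 < s) (hl : 0 < l) : ((-(l / s) * limitMGF ρ s : ℝ) : EReal) ≤ fbar ρ 1 (-l) := by
  have hprob := hpure.isProbability
  obtain ⟨C, hC⟩ := exists_limitMGF_bound hγ hpure hmoment
  obtain ⟨M, hM, hMd⟩ := exists_normMoment_bound (by linarith) hpure hmoment
  have h1 := EReal.tendsto_coe.2 ((hC s hs).2.1.const_mul (-(l / s)))
  rw [fbar, ← h1.limsup_eq]
  refine limsup_le_limsup ?_
  filter_upwards [hMd, eventually_ge_atTop 1] with d hd hd1
  exact le_meanGenFun_neg hs hl (integrable_logMGF_one hd1 hγ hd.1 hs.le)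

end pure

/-! ### Large deviations of the distance, from the convergence of the generating functions -/

lemma tendsto_exp_neg_natCast_mul {η : ℝ} (hη : 0 < η) :
    Tendsto (fun d : ℕ => Real.exp (-(d * η))) atTop (𝓝 0) := by
  refine Real.tendsto_exp_neg_atTop_nhds_zero.comp ?_
  exact tendsto_natCast_atTop_atTop.atTop_mul_const hη

section fixed

variable {d : ℕ} {μ : Measure (Sp d)} [IsProbabilityMeasure μ]

/-- The weight exp(-d b u^γ) is dominated through the tangent line of u^γ at w by a constant times a
linear weight. -/
lemma logMGF_le_of_tangent (hd : 1 ≤ d) {γ b w : ℝ} (hγ : 1 ≤ γ) (hb : 0 ≤ b) (hw : 0 ≤ w)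
    (x : Sp d) :
    logMGF μ γ b x ≤ b * (γ - 1) * w ^ γ + logMGF μ 1 (b * γ * w ^ (γ - 1)) x := by
  have hd0 : (0 : ℝ) < d := by exact_mod_cast hd
  have hl : 0 ≤ b * γ * w ^ (γ - 1) := by positivity
  have h1 : ∀ y, weight γ b x y ≤ Real.exp (d * (b * (γ - 1) * w ^ γ)) *
      weight 1 (b * γ * w ^ (γ - 1)) x y := fun y => by
    rw [weight, weight, ← Real.exp_add, Real.rpow_one]
    refine Real.exp_le_exp.2 ?_
    have h2 := mul_le_mul_of_nonneg_left
      (mul_le_mul_of_nonneg_left (rpow_tangent hγ hw (sqDist_nonneg x y)) hb) hd0.le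
    have h3 := rpow_sub_one_mul_self hγ hw
    have h4 : d * (b * (w ^ γ + γ * w ^ (γ - 1) * (sqDist x y - w)))
        = d * (b * w ^ γ) + d * (b * γ * w ^ (γ - 1) * sqDist x y)
          - d * (b * γ * (w ^ (γ - 1) * w)) := by ring
    rw [h4, h3] at h2
    linarith
  have h2 : ∫ y, weight γ b x y ∂μ ≤ Real.exp (d * (b * (γ - 1) * w ^ γ)) *
      ∫ y, weight 1 (b * γ * w ^ (γ - 1)) x y ∂μ := by
    rw [← integral_const_mul]
    exact integral_mono (integrable_weight (by linarith) hb x)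
      ((integrable_weight zero_le_one hl x).const_mul _) h1
  rw [← exp_logMGF hd (by linarith) hb, ← exp_logMGF hd zero_le_one hl, ← Real.exp_add,
    Real.exp_le_exp, ← mul_add] at h2
  exact le_of_mul_le_mul_left h2 hd0

lemma measurableSet_window (x : Sp d) (v ε : ℝ) : MeasurableSet {y | |sqDist x y - v| < ε} := by
  have h1 : Continuous fun y : Sp d => sqDist x y := by unfold sqDist; fun_prop
  exact measurableSet_lt (by fun_prop) measurable_const

/-- The change of measure that bounds the probability of a window from below. -/
lemma exp_le_window_add (hd : 1 ≤ d) {lam t v ε : ℝ} (ht : 0 ≤ t) (htl : t ≤ lam) (x : Sp d) :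
    Real.exp (d * logMGF μ 1 lam x) ≤
      Real.exp (-(d * (lam * (v - ε)))) * μ.real {y | |sqDist x y - v| < ε}
      + Real.exp (d * (logMGF μ 1 (lam - t) x - t * (v + ε)))
      + Real.exp (d * (logMGF μ 1 (lam + t) x + t * (v - ε))) := by
  have hd0 : (0 : ℝ) < d := by exact_mod_cast hd
  have hl : 0 ≤ lam := ht.trans htl
  have hA := measurableSet_window x v ε
  set A : Set (Sp d) := {y | |sqDist x y - v| < ε} with hAdef
  have e1 : Real.exp (d * (logMGF μ 1 (lam - t) x - t * (v + ε)))
      = Real.exp (-(d * (t * (v + ε)))) * ∫ y, weight 1 (lam - t) x y ∂μ := by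
    rw [← exp_logMGF hd zero_le_one (by linarith), ← Real.exp_add]; congr 1; ring
  have e2 : Real.exp (d * (logMGF μ 1 (lam + t) x + t * (v - ε)))
      = Real.exp (d * (t * (v - ε))) * ∫ y, weight 1 (lam + t) x y ∂μ := by
    rw [← exp_logMGF hd zero_le_one (by linarith), ← Real.exp_add]; congr 1; ring
  have i0 : Integrable (A.indicator fun _ => (1 : ℝ)) μ := (integrable_const 1).indicator hA
  have i1 := integrable_weight (μ := μ) zero_le_one (show 0 ≤ lam - t by linarith) x
  have i2 := integrable_weight (μ := μ) zero_le_one (show 0 ≤ lam + t by linarith) x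
  have e0 : μ.real A = ∫ y, A.indicator (fun _ => (1 : ℝ)) y ∂μ := by
    rw [integral_indicator_const _ hA]; simp
  have j0 := i0.const_mul (Real.exp (-(d * (lam * (v - ε)))))
  have j1 := i1.const_mul (Real.exp (-(d * (t * (v + ε)))))
  have j2 := i2.const_mul (Real.exp (d * (t * (v - ε))))
  have j01 : Integrable (fun y => Real.exp (-(d * (lam * (v - ε)))) *
      A.indicator (fun _ => (1 : ℝ)) y + Real.exp (-(d * (t * (v + ε)))) *
        weight 1 (lam - t) x y) μ := j0.add j1
  rw [e1, e2, e0, exp_logMGF hd zero_le_one hl, ← integral_const_mul, ← integral_const_mul,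
    ← integral_const_mul, ← integral_add j0 j1, ← integral_add j01 j2]
  refine integral_mono (integrable_weight zero_le_one hl x) (j01.add j2) fun y => ?_
  have p1 : 0 ≤ Real.exp (-(d * (t * (v + ε)))) * weight 1 (lam - t) x y := by
    have := weight_pos (p := 1) (b := lam - t) x y
    positivity
  have p2 : 0 ≤ Real.exp (d * (t * (v - ε))) * weight 1 (lam + t) x y := by
    have := weight_pos (p := 1) (b := lam + t) x y
    positivity
  have p0 : 0 ≤ Real.exp (-(d * (lam * (v - ε)))) * A.indicator (fun _ => (1 : ℝ)) y :=
    mul_nonneg (Real.exp_pos _).le (indicator_nonneg (fun _ _ => zero_le_one) y)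
  by_cases hy : y ∈ A
  · have hy' := (abs_lt.1 (show |sqDist x y - v| < ε from hy)).1
    have : weight 1 lam x y ≤ Real.exp (-(d * (lam * (v - ε)))) *
        A.indicator (fun _ => (1 : ℝ)) y := by
      rw [indicator_of_mem hy, mul_one, weight, Real.rpow_one]
      refine Real.exp_le_exp.2 ?_
      have : d * (lam * (v - ε)) ≤ d * (lam * sqDist x y) := by
        gcongr; linarith
      linarith
    linarith
  -- Outside the window the parameter is shifted as in Chernoff's bound: down by t to the right of
  -- it, up by t to the left.
  · have hy' : ε ≤ |sqDist x y - v| := not_lt.1 hy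
    rcases le_abs.1 hy' with h | h
    · have : weight 1 lam x y ≤ Real.exp (-(d * (t * (v + ε)))) * weight 1 (lam - t) x y := by
        rw [weight, weight, Real.rpow_one, ← Real.exp_add]
        refine Real.exp_le_exp.2 ?_
        have : d * (t * (v + ε)) ≤ d * (t * sqDist x y) := by
          gcongr; linarith
        linarith
      linarith
    · have : weight 1 lam x y ≤ Real.exp (d * (t * (v - ε))) * weight 1 (lam + t) x y := by
        rw [weight, weight, Real.rpow_one, ← Real.exp_add]
        refine Real.exp_le_exp.2 ?_
        have : d * (t * sqDist x y) ≤ d * (t * (v - ε)) := by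
          gcongr; linarith
        linarith
      linarith

lemma le_logMGF_of_window (hd : 1 ≤ d) {γ b v ε a : ℝ} (hγ : 0 ≤ γ) (hb : 0 ≤ b) (x : Sp d)
    (ha : Real.exp (-(d * a)) ≤ μ.real {y | |sqDist x y - v| < ε}) :
    -(b * (v + ε) ^ γ) - a ≤ logMGF μ γ b x := by
  have hd0 : (0 : ℝ) < d := by exact_mod_cast hd
  have hA := measurableSet_window x v ε
  set A : Set (Sp d) := {y | |sqDist x y - v| < ε} with hAdef
  have h1 : Real.exp (-(d * (b * (v + ε) ^ γ))) * μ.real A ≤ ∫ y, weight γ b x y ∂μ := by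
    have e0 : μ.real A = ∫ y, A.indicator (fun _ => (1 : ℝ)) y ∂μ := by
      rw [integral_indicator_const _ hA]; simp
    rw [e0, ← integral_const_mul]
    refine integral_mono (((integrable_const 1).indicator hA).const_mul _)
      (integrable_weight hγ hb x) fun y => ?_
    by_cases hy : y ∈ A
    · have hy' := (abs_lt.1 (show |sqDist x y - v| < ε from hy)).2
      simp only [indicator_of_mem hy, mul_one]
      rw [weight]
      refine Real.exp_le_exp.2 (neg_le_neg ?_)
      have := Real.rpow_le_rpow (sqDist_nonneg x y) (by linarith : sqDist x y ≤ v + ε) hγ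
      gcongr
    · simp only [indicator_of_notMem hy, mul_zero]
      exact (weight_pos x y).le
  have h2 : Real.exp (d * (-(b * (v + ε) ^ γ) - a)) ≤ Real.exp (d * logMGF μ γ b x) := by
    rw [exp_logMGF hd hγ hb]
    refine le_trans ?_ h1
    calc Real.exp (d * (-(b * (v + ε) ^ γ) - a))
        = Real.exp (-(d * (b * (v + ε) ^ γ))) * Real.exp (-(d * a)) := by
          rw [← Real.exp_add]; congr 1; ring
      _ ≤ _ := by gcongr
  exact le_of_mul_le_mul_left (Real.exp_le_exp.1 h2) hd0

end fixed

section asymptotic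

variable {μ : ∀ d, Measure (Sp d)} [∀ d, IsProbabilityMeasure (μ d)] {F : ℝ → ℝ}

/-- The lower bound of the Gärtner-Ellis theorem at an exposed point. -/
lemma eventually_exp_le_window
    (hconv : ∀ lam : ℝ, 0 < lam → Tendsto (fun p : Σ d, Sp d => logMGF (μ p.1) 1 lam p.2) (whp μ)
      (𝓝 (F lam))) {lam v : ℝ} (hlam : 0 < lam) (hF : HasDerivAt F (-v) lam) {ε : ℝ} (hε : 0 < ε) :
    ∀ᶠ p in whp μ, Real.exp (-((p.1 : ℝ) * (-(lam * v) - F lam + ε))) ≤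
      (μ p.1).real {y | |sqDist p.2 y - v| < ε} := by
  -- The window is narrowed to e, so that the variation lam * e of the exponent across it uses at
  -- most half of ε.
  set e := ε / (2 * (lam + 1)) with he
  have he0 : 0 < e := by positivity
  have hee : e ≤ ε := by
    rw [he, div_le_iff₀ (by positivity)]; nlinarith
  have hle : lam * e ≤ ε / 2 := by
    rw [he, ← mul_div_assoc, div_le_iff₀ (by positivity)]; nlinarith
  -- Differentiability with F'(lam) = -v: to first order F(lam ± t) cancels ∓ t v, and the window
  -- leaves a gain t e, half of which absorbs the remainder. Both tails are thus exponentially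
  -- negligible against exp(d F(lam)).
  obtain ⟨t, ht0, htl, ht1, ht2⟩ : ∃ t : ℝ, 0 < t ∧ t < lam ∧
      F (lam - t) - t * (v + e) ≤ F lam - t * e / 2 ∧
      F (lam + t) + t * (v - e) ≤ F lam - t * e / 2 := by
    rw [hasDerivAt_iff_isLittleO_nhds_zero, Asymptotics.isLittleO_iff] at hF
    obtain ⟨δ, hδ, hδF⟩ := Metric.eventually_nhds_iff.1 (hF (show 0 < e / 2 by positivity))
    set t := min (δ / 2) (lam / 2) with ht
    have ht0 : 0 < t := lt_min (by positivity) (by positivity)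
    have htδ : t < δ := (min_le_left _ _).trans_lt (by linarith)
    have htl : t < lam := (min_le_right _ _).trans_lt (by linarith)
    have h1 := hδF (y := t) (by rwa [Real.dist_eq, sub_zero, abs_of_pos ht0])
    have h2 := hδF (y := -t) (by rwa [Real.dist_eq, sub_zero, abs_neg, abs_of_pos ht0])
    rw [Real.norm_eq_abs, Real.norm_eq_abs, abs_of_pos ht0, smul_eq_mul] at h1
    rw [Real.norm_eq_abs, Real.norm_eq_abs, abs_neg, abs_of_pos ht0, smul_eq_mul,
      ← sub_eq_add_neg] at h2
    have h1' := (le_abs_self _).trans h1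
    have h2' := (le_abs_self _).trans h2
    exact ⟨t, ht0, htl, by linarith, by linarith⟩
  set η := min (t * e / 8) (ε / 4) with hη
  have hη0 : 0 < η := lt_min (by positivity) (by positivity)
  have hη1 : 4 * η ≤ t * e / 2 := by
    have : η ≤ t * e / 8 := min_le_left _ _
    linarith
  have hη2 : 2 * η ≤ ε / 2 := by
    have : η ≤ ε / 4 := min_le_right _ _
    linarith
  filter_upwards [(hconv lam hlam).eventually_const_lt (show F lam - η < F lam by linarith),
    (hconv (lam - t) (by linarith)).eventually_lt_const
      (show F (lam - t) < F (lam - t) + η by linarith),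
    (hconv (lam + t) (by linarith)).eventually_lt_const
      (show F (lam + t) < F (lam + t) + η by linarith),
    tendsto_fst_whp.eventually (eventually_ge_atTop 1),
    tendsto_fst_whp.eventually ((tendsto_exp_neg_natCast_mul hη0).eventually_le_const
      (show (0 : ℝ) < 1 / 2 by norm_num))] with p h1 h2 h3 hd hdη
  have hd0 : (0 : ℝ) < p.1 := by exact_mod_cast hd
  have key := exp_le_window_add (μ := μ p.1) hd (v := v) (ε := e) ht0.le htl.le p.2
  set P := (μ p.1).real {y | |sqDist p.2 y - v| < e} with hP
  have hPle : P ≤ (μ p.1).real {y | |sqDist p.2 y - v| < ε} :=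
    measureReal_mono fun y hy => lt_of_lt_of_le hy hee
  refine le_trans ?_ hPle
  set E := Real.exp (p.1 * (F lam - η)) with hE
  set X := Real.exp (-(p.1 * η)) with hX
  have hX0 : 0 < X := Real.exp_pos _
  have hE0 : 0 < E := Real.exp_pos _
  have k0 : E ≤ Real.exp (p.1 * logMGF (μ p.1) 1 lam p.2) := by
    refine Real.exp_le_exp.2 ?_; gcongr
  have k3 : Real.exp (p.1 * (F lam - 3 * η)) = E * X * X := by
    rw [hE, hX, ← Real.exp_add, ← Real.exp_add]; congr 1; ring
  have k1 : Real.exp (p.1 * (logMGF (μ p.1) 1 (lam - t) p.2 - t * (v + e))) ≤ E * X * X := by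
    rw [← k3]
    exact Real.exp_le_exp.2 (mul_le_mul_of_nonneg_left (by linarith) hd0.le)
  have k2 : Real.exp (p.1 * (logMGF (μ p.1) 1 (lam + t) p.2 + t * (v - e))) ≤ E * X * X := by
    rw [← k3]
    exact Real.exp_le_exp.2 (mul_le_mul_of_nonneg_left (by linarith) hd0.le)
  have k4 : E * X ≤ Real.exp (-(p.1 * (lam * (v - e)))) * P := by
    have a1 : E * X ≤ E * (1 / 2) := by gcongr
    have a2 : E * X * X ≤ E * (1 / 2) * (1 / 2) := by gcongr
    linarith
  have k5 : E * X * Real.exp (p.1 * (lam * (v - e))) ≤ P := by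
    calc E * X * Real.exp (p.1 * (lam * (v - e)))
        ≤ Real.exp (-(p.1 * (lam * (v - e)))) * P * Real.exp (p.1 * (lam * (v - e))) := by gcongr
      _ = P := by rw [Real.exp_neg]; field_simp
  refine le_trans ?_ k5
  rw [hE, hX, ← Real.exp_add, ← Real.exp_add]
  refine Real.exp_le_exp.2 ?_
  have : p.1 * (lam * e + 2 * η) ≤ p.1 * ε := by gcongr; linarith
  linarith

lemma exists_rpow_add_le {b v γ ε : ℝ} (hγ : 0 ≤ γ) (hε : 0 < ε) :
    ∃ δ : ℝ, 0 < δ ∧ δ ≤ ε ∧ b * (v + δ) ^ γ ≤ b * v ^ γ + ε := by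
  have h : Tendsto (fun δ : ℝ => b * (v + δ) ^ γ) (𝓝[>] 0) (𝓝 (b * (v + 0) ^ γ)) := by
    refine Tendsto.mono_left (Continuous.tendsto ?_ 0) nhdsWithin_le_nhds
    exact continuous_const.mul (Continuous.rpow_const (by fun_prop) fun _ => Or.inr hγ)
  rw [add_zero] at h
  obtain ⟨δ, h1, h2, h3⟩ := ((h.eventually_le_const (show b * v ^ γ < b * v ^ γ + ε by linarith)).and
    ((tendsto_id.mono_left nhdsWithin_le_nhds).eventually_le_const hε |>.and
      self_mem_nhdsWithin)).exists
  exact ⟨δ, h3, h2, h1⟩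

lemma eventually_le_logMGF
    (hconv : ∀ lam : ℝ, 0 < lam → Tendsto (fun p : Σ d, Sp d => logMGF (μ p.1) 1 lam p.2) (whp μ)
      (𝓝 (F lam))) {lam v : ℝ} (hlam : 0 < lam) (hF : HasDerivAt F (-v) lam) {γ b : ℝ}
    (hγ : 0 ≤ γ) (hb : 0 ≤ b) {ε : ℝ} (hε : 0 < ε) :
    ∀ᶠ p in whp μ, -(b * v ^ γ) + lam * v + F lam - ε ≤ logMGF (μ p.1) γ b p.2 := by
  obtain ⟨δ, hδ, hδε, hδb⟩ := exists_rpow_add_le (b := b) (v := v) hγ (half_pos hε)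
  filter_upwards [eventually_exp_le_window hconv hlam hF hδ,
    tendsto_fst_whp.eventually (eventually_ge_atTop 1)] with p hp hd
  have := le_logMGF_of_window (γ := γ) (b := b) hd hγ hb p.2 hp
  linarith

/-- The limit of `(1/d) log 𝔼_y exp (-d b u^γ)` for most `x`. -/
lemma tendsto_logMGF_freeEnergy
    (hconv : ∀ lam : ℝ, 0 < lam → Tendsto (fun p : Σ d, Sp d => logMGF (μ p.1) 1 lam p.2) (whp μ)
      (𝓝 (F lam))) {γ b : ℝ} {v : ℝ → ℝ} (hγ : 1 ≤ γ) (hb : 0 ≤ b) (hv : IsTilt F γ b (v b)) :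
    Tendsto (fun p : Σ d, Sp d => logMGF (μ p.1) γ b p.2) (whp μ) (𝓝 (freeEnergy F γ v b)) := by
  refine tendsto_order.2 ⟨fun a ha => ?_, fun a ha => ?_⟩
  · have hε : 0 < (freeEnergy F γ v b - a) / 2 := by linarith
    filter_upwards [eventually_le_logMGF hconv hv.2.1 hv.2.2 (by linarith : 0 ≤ γ) hb hε] with p hp
    rw [freeEnergy_eq hγ hv.1, tiltRate] at ha hp
    have : b * γ * v b ^ (γ - 1) = tiltSlope γ v b := rfl
    rw [this] at hp
    linarith
  · have hlim := (hconv (tiltSlope γ v b) hv.2.1).const_add (b * (γ - 1) * v b ^ γ)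
    filter_upwards [hlim.eventually_lt_const ha,
      tendsto_fst_whp.eventually (eventually_ge_atTop 1)] with p hp hd
    exact (logMGF_le_of_tangent hd hγ hb hv.1 p.2).trans_lt hp

/-- If F vanishes then F'(1) = 0, so the distance concentrates at 0 at no exponential cost. This
degenerate case serves only to be refuted by strict convexity. -/
lemma tendsto_logMGF_zero
    (hconv : ∀ lam : ℝ, 0 < lam → Tendsto (fun p : Σ d, Sp d => logMGF (μ p.1) 1 lam p.2) (whp μ)
      (𝓝 (F lam))) (hF : ∀ lam : ℝ, 0 < lam → F lam = 0) {γ b : ℝ} (hγ : 1 ≤ γ) (hb : 0 ≤ b) :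
    Tendsto (fun p : Σ d, Sp d => logMGF (μ p.1) γ b p.2) (whp μ) (𝓝 0) := by
  have hd : HasDerivAt F (-0) 1 := by
    rw [neg_zero]
    refine (hasDerivAt_const (1 : ℝ) (0 : ℝ)).congr_of_eventuallyEq ?_
    filter_upwards [Ioi_mem_nhds one_pos] with x hx
    exact hF x hx
  refine tendsto_order.2 ⟨fun a ha => ?_, fun a ha => ?_⟩
  · have hε : 0 < -a / 2 := by linarith
    filter_upwards [eventually_le_logMGF hconv one_pos hd (by linarith : 0 ≤ γ) hb hε] with p hp
    rw [Real.zero_rpow (by linarith), hF 1 one_pos] at hp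
    linarith
  · exact Eventually.of_forall fun p => (logMGF_nonpos (by linarith) hb p.2).trans_lt ha

end asymptotic

/-! ### The random energy model -/

/-- The partition function `∑ i, exp (-d b u_i^γ)` of the database `y`. -/
def partition (γ b : ℝ) {d n : ℕ} (x : Sp d) (y : Fin n → Sp d) : ℝ := ∑ i, weight γ b x (y i)

section fixed

variable {d n : ℕ} {γ b : ℝ}

lemma partition_pos (hn : 0 < n) (x : Sp d) (y : Fin n → Sp d) : 0 < partition γ b x y := by
  have : Nonempty (Fin n) := ⟨⟨0, hn⟩⟩
  exact Finset.sum_pos (fun i _ => weight_pos x (y i)) Finset.univ_nonempty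

lemma partition_le (hb : 0 ≤ b) (x : Sp d) (y : Fin n → Sp d) : partition γ b x y ≤ n := by
  calc partition γ b x y ≤ ∑ _i : Fin n, (1 : ℝ) :=
        Finset.sum_le_sum fun i _ => weight_le_one hb x (y i)
    _ = n := by simp

lemma measurable_partition (hγ : 0 ≤ γ) :
    Measurable fun z : Sp d × (Fin n → Sp d) => partition γ b z.1 z.2 := by
  have : Continuous fun z : Sp d × (Fin n → Sp d) => partition γ b z.1 z.2 := by
    unfold partition weight sqDist
    refine continuous_finsetSum _ fun i _ => Real.continuous_exp.comp ?_
    refine (continuous_const.mul (continuous_const.mul ?_)).neg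
    exact Continuous.rpow_const (by fun_prop) fun _ => Or.inr hγ
  exact this.measurable

lemma measurable_partition_right (hγ : 0 ≤ γ) (x : Sp d) :
    Measurable fun y : Fin n → Sp d => partition γ b x y := by
  have : Continuous fun y : Fin n → Sp d => partition γ b x y := by
    unfold partition weight sqDist
    refine continuous_finsetSum _ fun i _ => Real.continuous_exp.comp ?_
    refine (continuous_const.mul (continuous_const.mul ?_)).neg
    exact Continuous.rpow_const (by fun_prop) fun _ => Or.inr hγ
  exact this.measurable

/-- Monotonicity of the `ℓ^p` norms: the partition function at a higher temperature. -/
lemma partition_rpow_le (hn : 0 < n) {m : ℝ} (hm1 : m ≤ 1) (x : Sp d)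
    (y : Fin n → Sp d) : partition γ b x y ^ m ≤ partition γ (m * b) x y := by
  set Z := partition γ b x y with hZ
  have hZ0 : 0 < Z := partition_pos hn x y
  have h1 : ∀ i, weight γ b x (y i) ≤ Z := fun i =>
    Finset.single_le_sum (f := fun i => weight γ b x (y i)) (fun j _ => (weight_pos x (y j)).le)
      (Finset.mem_univ i)
  have h2 : ∀ i, weight γ b x (y i) ≤ Z ^ (1 - m) * weight γ (m * b) x (y i) := fun i => by
    have e : weight γ (m * b) x (y i) = weight γ b x (y i) ^ m := by
      rw [weight, weight, ← Real.exp_mul]; congr 1; ring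
    have hw := weight_pos (p := γ) (b := b) x (y i)
    calc weight γ b x (y i) = weight γ b x (y i) ^ (1 - m) * weight γ b x (y i) ^ m := by
          rw [← Real.rpow_add hw, sub_add_cancel, Real.rpow_one]
      _ ≤ Z ^ (1 - m) * weight γ b x (y i) ^ m := by
          gcongr
          exact h1 i
      _ = _ := by rw [e]
  have h3 : Z ≤ Z ^ (1 - m) * partition γ (m * b) x y := by
    rw [partition, Finset.mul_sum]
    exact Finset.sum_le_sum fun i _ => h2 i
  have h4 : Z = Z ^ (1 - m) * Z ^ m := by
    rw [← Real.rpow_add hZ0, sub_add_cancel, Real.rpow_one]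
  have h5 : Z ^ (1 - m) * Z ^ m ≤ Z ^ (1 - m) * partition γ (m * b) x y := h4 ▸ h3
  exact le_of_mul_le_mul_left h5 (by positivity)

variable {μ : Measure (Sp d)} [IsProbabilityMeasure μ]

/-- Markov's inequality for the partition function. -/
lemma measure_partition_ge_le (hn : 0 < n) (hγ : 0 ≤ γ) (hb : 0 ≤ b) (a : ℝ) (x : Sp d) :
    Measure.pi (fun _ : Fin n => μ)
      {y | Real.exp a * (n * ∫ y, weight γ b x y ∂μ) ≤ partition γ b x y}
      ≤ ENNReal.ofReal (Real.exp (-a)) := by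
  have hI := integral_weight_pos (μ := μ) hγ hb x
  have hn0 : (0 : ℝ) < n := by exact_mod_cast hn
  set I := ∫ y, weight γ b x y ∂μ with hIdef
  have hT : 0 < Real.exp a * (n * I) := by positivity
  have h1 : ∫⁻ y, ENNReal.ofReal (partition γ b x y) ∂Measure.pi (fun _ : Fin n => μ)
      = ENNReal.ofReal (n * I) := by
    have e : ∀ y : Fin n → Sp d, ENNReal.ofReal (partition γ b x y)
        = ∑ i, ENNReal.ofReal (weight γ b x (y i)) := fun y =>
      ENNReal.ofReal_sum_of_nonneg fun i _ => (weight_pos x (y i)).le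
    simp_rw [e]
    have hm : Measurable fun z => ENNReal.ofReal (weight γ b x z) :=
      (measurable_weight_right hγ x).ennreal_ofReal
    have hmi : ∀ i : Fin n, Measurable fun y : Fin n → Sp d => ENNReal.ofReal (weight γ b x (y i)) :=
      fun i => hm.comp (measurable_pi_apply i)
    rw [lintegral_finsetSum _ fun i _ => hmi i]
    have e2 : ∀ i : Fin n, ∫⁻ y, ENNReal.ofReal (weight γ b x (y i)) ∂Measure.pi (fun _ : Fin n => μ)
        = ENNReal.ofReal I := fun i => by
      rw [(measurePreserving_eval (fun _ : Fin n => μ) i).lintegral_comp hm,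
        hIdef, ofReal_integral_eq_lintegral_ofReal (integrable_weight hγ hb x)
        (ae_of_all _ fun z => (weight_pos x z).le)]
    simp_rw [e2]
    rw [Finset.sum_const, Finset.card_univ, Fintype.card_fin, nsmul_eq_mul,
      ENNReal.ofReal_mul hn0.le, ENNReal.ofReal_natCast]
  have h2 := meas_ge_le_lintegral_div (μ := Measure.pi (fun _ : Fin n => μ))
    (measurable_partition_right (b := b) (n := n) hγ x).ennreal_ofReal.aemeasurable
    (ε := ENNReal.ofReal (Real.exp a * (n * I))) (by simpa using hT) ENNReal.ofReal_ne_top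
  rw [h1, ← ENNReal.ofReal_div_of_pos hT] at h2
  refine le_trans (measure_mono fun y hy => ?_) (h2.trans (ENNReal.ofReal_le_ofReal (le_of_eq ?_)))
  · exact ENNReal.ofReal_le_ofReal hy
  · rw [Real.exp_neg]; field_simp

end fixed

/-- A lower deviation bound for the binomial distribution. -/
lemma measure_count_le {E : Type*} [MeasurableSpace E] {μ : Measure E} [IsProbabilityMeasure μ]
    {A : Set E} (hA : MeasurableSet A) (n : ℕ) :
    Measure.pi (fun _ : Fin n => μ) {y | ∑ i, A.indicator (fun _ => (1 : ℝ)) (y i) ≤ n * μ.real A / 4}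
      ≤ ENNReal.ofReal (Real.exp (-(n * μ.real A / 4))) := by
  set p := μ.real A with hp
  have hp0 : 0 ≤ p := measureReal_nonneg
  -- Chernoff's method with exponential parameter -1: the mean of f is at most exp(-p/2), and
  -- Markov's inequality is applied to the product at the level exp(-n p/4).
  set f : E → ℝ := fun z => Real.exp (-A.indicator (fun _ => (1 : ℝ)) z) with hf
  have hfm : Measurable f := (measurable_const.indicator hA).neg.exp
  have hf0 : ∀ z, 0 < f z := fun z => Real.exp_pos _
  have hfe : ∀ z, f z = 1 - A.indicator (fun _ => (1 - Real.exp (-1))) z := fun z => by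
    by_cases hz : z ∈ A <;> simp [hf, hz]
  have hfint : ∫ z, f z ∂μ = 1 - p * (1 - Real.exp (-1)) := by
    simp_rw [hfe]
    rw [integral_sub (integrable_const _) ((integrable_const _).indicator hA),
      integral_indicator_const _ hA]
    simp [hp]
  have he1 : Real.exp (-1) ≤ 1 / 2 := by
    rw [Real.exp_neg, inv_le_comm₀ (Real.exp_pos _) (by norm_num)]
    have := Real.add_one_le_exp (1 : ℝ)
    linarith
  have hbound : ∫ z, f z ∂μ ≤ Real.exp (-(p / 2)) := by
    rw [hfint]
    have := Real.add_one_le_exp (-(p / 2))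
    nlinarith
  have hint0 : 0 ≤ ∫ z, f z ∂μ := integral_nonneg fun z => (hf0 z).le
  have h1 : ∫ y : Fin n → E, ∏ i, f (y i) ∂Measure.pi (fun _ : Fin n => μ)
      ≤ Real.exp (-(n * p / 2)) := by
    rw [integral_fintype_prod_eq_pow, Fintype.card_fin]
    calc (∫ z, f z ∂μ) ^ n ≤ Real.exp (-(p / 2)) ^ n := by gcongr
      _ = _ := by rw [← Real.exp_nat_mul]; congr 1; ring
  have hle1 : ∀ y : Fin n → E, ∏ i, f (y i) ≤ 1 := fun y =>
    Finset.prod_le_one (fun i _ => (hf0 _).le) fun i _ => by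
      simp only [hf]
      rw [Real.exp_le_one_iff, neg_nonpos]
      exact indicator_nonneg (fun _ _ => zero_le_one) _
  have hpm : Measurable fun y : Fin n → E => ∏ i, f (y i) :=
    Finset.measurable_prod _ fun i _ => hfm.comp (measurable_pi_apply i)
  have hp00 : ∀ y : Fin n → E, 0 ≤ ∏ i, f (y i) := fun y => Finset.prod_nonneg fun i _ => (hf0 _).le
  have hpi : Integrable (fun y : Fin n → E => ∏ i, f (y i)) (Measure.pi fun _ : Fin n => μ) := by
    refine Integrable.of_bound hpm.aestronglyMeasurable 1 (ae_of_all _ fun y => ?_)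
    rw [Real.norm_eq_abs, abs_of_nonneg (hp00 y)]
    exact hle1 y
  have h2 := mul_meas_ge_le_integral_of_nonneg (ae_of_all _ hp00) hpi (Real.exp (-(n * p / 4)))
  have h3 : (Measure.pi fun _ : Fin n => μ).real {y | Real.exp (-(n * p / 4)) ≤ ∏ i, f (y i)}
      ≤ Real.exp (-(n * p / 4)) := by
    have h4 := h2.trans h1
    have e : Real.exp (-(n * p / 2)) = Real.exp (-(n * p / 4)) * Real.exp (-(n * p / 4)) := by
      rw [← Real.exp_add]; congr 1; ring
    rw [e] at h4
    exact le_of_mul_le_mul_left h4 (Real.exp_pos _)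
  rw [← ofReal_measureReal (measure_ne_top _ _)]
  refine ENNReal.ofReal_le_ofReal (le_trans (measureReal_mono fun y hy => ?_) h3)
  have hy' : ∑ i, A.indicator (fun _ => (1 : ℝ)) (y i) ≤ n * p / 4 := hy
  simp only [mem_ofPred_eq, hf]
  rw [← Real.exp_sum, Finset.sum_neg_distrib]
  exact Real.exp_le_exp.2 (neg_le_neg hy')

section asymptotic

variable {μ : ∀ d, Measure (Sp d)} [∀ d, IsProbabilityMeasure (μ d)] {n : ℕ → ℕ} {α : ℝ}

/-- The joint law of a point and of a database of `n d` points, all independent. -/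
def jointLaw (μ : ∀ d, Measure (Sp d)) (n : ℕ → ℕ) (d : ℕ) :
    Measure (Sp d × (Fin (n d) → Sp d)) :=
  (μ d).prod (Measure.pi fun _ : Fin (n d) => μ d)

instance (d : ℕ) : IsProbabilityMeasure (jointLaw μ n d) := by unfold jointLaw; infer_instance

lemma tendsto_whp_jointLaw_fst : Tendsto
    (fun p : Σ d, Sp d × (Fin (n d) → Sp d) => (⟨p.1, p.2.1⟩ : Σ d, Sp d))
    (whp (jointLaw μ n)) (whp μ) :=
  tendsto_whp_prod_fst (ν := fun d => Measure.pi fun _ : Fin (n d) => μ d)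

lemma eventually_pos_of_tendsto_log (hα : 0 < α)
    (hn : Tendsto (fun d : ℕ => Real.log (n d) / (d : ℝ)) atTop (𝓝 α)) :
    ∀ᶠ d in atTop, 0 < n d := by
  filter_upwards [hn.eventually_const_lt hα] with d hd
  by_contra! hcon
  rw [Nat.le_zero.1 hcon] at hd
  simp at hd

/-- First-moment bound: given x, the partition function exceeds its mean by a factor exp(dε/3) only
with exponentially small probability. -/
lemma eventually_log_partition_le_self (hα : 0 < α)
    (hn : Tendsto (fun d : ℕ => Real.log (n d) / (d : ℝ)) atTop (𝓝 α)) {γ b g : ℝ} (hγ : 0 ≤ γ)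
    (hb : 0 ≤ b) (hg : Tendsto (fun p : Σ d, Sp d => logMGF (μ p.1) γ b p.2) (whp μ) (𝓝 g))
    {ε : ℝ} (hε : 0 < ε) :
    ∀ᶠ p in whp (jointLaw μ n),
      Real.log (partition γ b p.2.1 p.2.2) ≤ p.1 * (α + g + ε) := by
  have h1 := eventually_whp_prod (μ := μ) (ν := fun d => Measure.pi fun _ : Fin (n d) => μ d)
    (s := fun d => {z | Real.exp (d * (ε / 3)) * (n d * ∫ y, weight γ b z.1 y ∂μ d)
      ≤ partition γ b z.1 z.2}) ?_ ?_
  · have hg' := tendsto_whp_jointLaw_fst (n := n) |>.eventually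
      (hg.eventually_lt_const (show g < g + ε / 3 by linarith))
    filter_upwards [h1, hg', tendsto_fst_whp.eventually (eventually_ge_atTop 1),
      tendsto_fst_whp.eventually (eventually_pos_of_tendsto_log hα hn),
      tendsto_fst_whp.eventually (hn.eventually_lt_const (show α < α + ε / 3 by linarith))]
      with p hp hgp hd hnp hnp2
    have hd0 : (0 : ℝ) < p.1 := by exact_mod_cast hd
    have hn0 : (0 : ℝ) < n p.1 := by exact_mod_cast hnp
    have hp' : partition γ b p.2.1 p.2.2
        < Real.exp (p.1 * (ε / 3)) * (n p.1 * ∫ y, weight γ b p.2.1 y ∂μ p.1) := not_le.1 hp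
    rw [← exp_logMGF hd hγ hb] at hp'
    have h2 := Real.log_lt_log (partition_pos hnp _ _) hp'
    rw [Real.log_mul (by positivity) (by positivity), Real.log_mul (by positivity) (by positivity),
      Real.log_exp, Real.log_exp] at h2
    rw [div_lt_iff₀ hd0] at hnp2
    have h3 := mul_lt_mul_of_pos_left hgp hd0
    linarith
  · intro d
    refine measurableSet_le ?_ (measurable_partition hγ)
    have h2 : StronglyMeasurable fun x => ∫ y, weight γ b x y ∂μ d :=
      StronglyMeasurable.integral_prod_right'
        (f := fun z : Sp d × Sp d => weight γ b z.1 z.2)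
        (measurable_weight (p := γ) (b := b) hγ).stronglyMeasurable
    exact ((h2.measurable.comp measurable_fst).const_mul _).const_mul _
  · have h2 : Tendsto (fun p : Σ d, Sp d => ENNReal.ofReal (Real.exp (-(p.1 * (ε / 3))))) (whp μ)
        (𝓝 0) := by
      have := ENNReal.tendsto_ofReal (tendsto_exp_neg_natCast_mul (show 0 < ε / 3 by positivity))
      rw [ENNReal.ofReal_zero] at this
      exact this.comp tendsto_fst_whp
    refine tendsto_of_tendsto_of_tendsto_of_le_of_le' tendsto_const_nhds h2
      (Eventually.of_forall fun _ => zero_le) ?_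
    filter_upwards [tendsto_fst_whp.eventually (eventually_pos_of_tendsto_log hα hn)] with p hp
    exact measure_partition_ge_le hp hγ hb _ p.2

/-- The upper bound on the free energy, at an arbitrary breaking parameter `m`. -/
lemma eventually_log_partition_le (hα : 0 < α)
    (hn : Tendsto (fun d : ℕ => Real.log (n d) / (d : ℝ)) atTop (𝓝 α)) {γ b g m : ℝ} (hγ : 0 ≤ γ)
    (hb : 0 ≤ b) (hm : 0 < m) (hm1 : m ≤ 1)
    (hg : Tendsto (fun p : Σ d, Sp d => logMGF (μ p.1) γ (m * b) p.2) (whp μ) (𝓝 g))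
    {ε : ℝ} (hε : 0 < ε) :
    ∀ᶠ p in whp (jointLaw μ n),
      Real.log (partition γ b p.2.1 p.2.2) ≤ p.1 * ((α + g) / m + ε) := by
  filter_upwards [eventually_log_partition_le_self hα hn hγ (by positivity : 0 ≤ m * b) hg
    (show 0 < m * ε by positivity),
    tendsto_fst_whp.eventually (eventually_pos_of_tendsto_log hα hn)] with p hp hnp
  have h1 := Real.log_le_log (Real.rpow_pos_of_pos (partition_pos hnp p.2.1 p.2.2) m)
    (partition_rpow_le (γ := γ) (b := b) hnp hm1 p.2.1 p.2.2)
  rw [Real.log_rpow (partition_pos hnp p.2.1 p.2.2)] at h1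
  have h2 : p.1 * ((α + g) / m + ε) = (p.1 * (α + g + m * ε)) / m := by field_simp
  rw [h2, le_div_iff₀ hm]
  linarith

/-- The lower bound on the free energy, at a point that is not frozen. -/
lemma eventually_le_log_partition (hα : 0 < α)
    (hn : Tendsto (fun d : ℕ => Real.log (n d) / (d : ℝ)) atTop (𝓝 α)) {F : ℝ → ℝ}
    (hconv : ∀ lam : ℝ, 0 < lam → Tendsto (fun p : Σ d, Sp d => logMGF (μ p.1) 1 lam p.2) (whp μ)
      (𝓝 (F lam))) {lam v : ℝ} (hlam : 0 < lam) (hF : HasDerivAt F (-v) lam)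
    (hS : -(lam * v) - F lam < α) {γ b : ℝ} (hγ : 0 ≤ γ) (hb : 0 ≤ b) {ε : ℝ} (hε : 0 < ε) :
    ∀ᶠ p in whp (jointLaw μ n),
      p.1 * (α + lam * v + F lam - b * v ^ γ - ε) ≤ Real.log (partition γ b p.2.1 p.2.2) := by
  set S := -(lam * v) - F lam with hSdef
  -- The bound by (α - S)/3 keeps α - S - 2η positive, so the expected number of points in the
  -- window grows exponentially and the counting bound applies.
  set η := min (ε / 4) ((α - S) / 3) with hη
  have hη0 : 0 < η := lt_min (by positivity) (by linarith)
  have hη1 : η ≤ ε / 4 := min_le_left _ _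
  have hη2 : η ≤ (α - S) / 3 := min_le_right _ _
  obtain ⟨δ, hδ, hδη, hδb⟩ := exists_rpow_add_le (b := b) (v := v) hγ hη0
  have hwin : ∀ᶠ p in whp μ, Real.exp (p.1 * (α - S - 2 * η)) ≤
      n p.1 * (μ p.1).real {y | |sqDist p.2 y - v| < δ} := by
    filter_upwards [eventually_exp_le_window hconv hlam hF hδ,
      tendsto_fst_whp.eventually (eventually_ge_atTop 1),
      tendsto_fst_whp.eventually (eventually_pos_of_tendsto_log hα hn),
      tendsto_fst_whp.eventually (hn.eventually_const_lt (show α - η < α by linarith))]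
      with p hp hd hnp hnp2
    have hd0 : (0 : ℝ) < p.1 := by exact_mod_cast hd
    have hn0 : (0 : ℝ) < n p.1 := by exact_mod_cast hnp
    rw [lt_div_iff₀ hd0] at hnp2
    have e1 : Real.exp (p.1 * (α - η)) ≤ n p.1 := by
      rw [← Real.exp_log hn0]
      exact Real.exp_le_exp.2 (by linarith)
    calc Real.exp (p.1 * (α - S - 2 * η))
        ≤ Real.exp (p.1 * (α - η)) * Real.exp (-(p.1 * (S + δ))) := by
          rw [← Real.exp_add]
          refine Real.exp_le_exp.2 ?_
          have := mul_le_mul_of_nonneg_left hδη hd0.le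
          linarith
      _ ≤ _ := by gcongr
  have h1 := eventually_whp_prod (μ := μ) (ν := fun d => Measure.pi fun _ : Fin (n d) => μ d)
    (s := fun d => {z | ∑ i, {y | |sqDist z.1 y - v| < δ}.indicator (fun _ => (1 : ℝ)) (z.2 i)
      ≤ n d * (μ d).real {y | |sqDist z.1 y - v| < δ} / 4}) ?_ ?_
  · have hlog4 : ∀ᶠ d : ℕ in atTop, Real.log 4 ≤ d * η := by
      have : Tendsto (fun d : ℕ => (d : ℝ) * η) atTop atTop :=
        tendsto_natCast_atTop_atTop.atTop_mul_const hη0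
      exact this.eventually_ge_atTop _
    filter_upwards [h1, (tendsto_whp_jointLaw_fst (n := n)).eventually hwin,
      tendsto_fst_whp.eventually hlog4] with p hp hwp h4
    have hp' := not_le.1 hp
    set A := {y | |sqDist p.2.1 y - v| < δ} with hA
    have hd0 : (0 : ℝ) ≤ p.1 := Nat.cast_nonneg _
    have k1 : Real.exp (-(p.1 * (b * (v + δ) ^ γ))) *
        ∑ i, A.indicator (fun _ => (1 : ℝ)) (p.2.2 i) ≤ partition γ b p.2.1 p.2.2 := by
      rw [partition, Finset.mul_sum]
      refine Finset.sum_le_sum fun i _ => ?_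
      by_cases hy : p.2.2 i ∈ A
      · have hy' := (abs_lt.1 (show |sqDist p.2.1 (p.2.2 i) - v| < δ from hy)).2
        rw [indicator_of_mem hy, mul_one, weight]
        refine Real.exp_le_exp.2 (neg_le_neg ?_)
        have := Real.rpow_le_rpow (sqDist_nonneg p.2.1 (p.2.2 i))
          (by linarith : sqDist p.2.1 (p.2.2 i) ≤ v + δ) hγ
        gcongr
      · rw [indicator_of_notMem hy, mul_zero]
        exact (weight_pos _ _).le
    have k2 : Real.exp (-(p.1 * (b * (v + δ) ^ γ))) * (Real.exp (p.1 * (α - S - 2 * η)) / 4)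
        ≤ partition γ b p.2.1 p.2.2 := by
      refine le_trans ?_ k1
      refine mul_le_mul_of_nonneg_left ?_ (Real.exp_pos _).le
      refine le_trans ?_ hp'.le
      gcongr
    have k3 := Real.log_le_log (by positivity) k2
    rw [Real.log_mul (by positivity) (by positivity), Real.log_div (by positivity) (by norm_num),
      Real.log_exp, Real.log_exp] at k3
    refine le_trans ?_ k3
    have k4 : p.1 * (b * (v + δ) ^ γ) ≤ p.1 * (b * v ^ γ + η) :=
      mul_le_mul_of_nonneg_left hδb hd0
    have k5 : p.1 * (4 * η) ≤ p.1 * ε := mul_le_mul_of_nonneg_left (by linarith) hd0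
    have k6 : α + lam * v + F lam - b * v ^ γ - ε = α - S - b * v ^ γ - ε := by
      rw [hSdef]; ring
    rw [k6]
    linarith
  · intro d
    have hset : MeasurableSet {z : Sp d × Sp d | |sqDist z.1 z.2 - v| < δ} := by
      have := continuous_sqDist (d := d)
      exact measurableSet_lt (by fun_prop) measurable_const
    refine measurableSet_le ?_ ?_
    · refine Finset.measurable_fun_sum _ fun i _ => ?_
      have h2 : MeasurableSet {z : Sp d × (Fin (n d) → Sp d) | |sqDist z.1 (z.2 i) - v| < δ} := by
        have h3 : Measurable fun z : Sp d × (Fin (n d) → Sp d) => sqDist z.1 (z.2 i) := by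
          unfold sqDist; fun_prop
        exact measurableSet_lt (h3.sub_const v).abs measurable_const
      have h4 : (fun z : Sp d × (Fin (n d) → Sp d) =>
          {y | |sqDist z.1 y - v| < δ}.indicator (fun _ => (1 : ℝ)) (z.2 i))
          = {z : Sp d × (Fin (n d) → Sp d) | |sqDist z.1 (z.2 i) - v| < δ}.indicator
            fun _ => (1 : ℝ) := by
        ext z
        simp only [indicator_apply, mem_ofPred_eq]
      rw [h4]
      exact measurable_const.indicator h2
    · have h2 : Measurable fun x : Sp d => μ d {y | |sqDist x y - v| < δ} :=
        measurable_measure_prodMk_left hset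
      exact (((h2.comp measurable_fst).ennreal_toReal).const_mul _).div_const _
  · have h2 : Tendsto (fun d : ℕ => Real.exp (-(Real.exp (d * (α - S - 2 * η)) / 4))) atTop
        (𝓝 0) := by
      refine Real.tendsto_exp_neg_atTop_nhds_zero.comp ?_
      refine Tendsto.atTop_div_const (by norm_num) (Real.tendsto_exp_atTop.comp ?_)
      exact tendsto_natCast_atTop_atTop.atTop_mul_const (by linarith)
    have h3 : Tendsto (fun p : Σ d, Sp d => ENNReal.ofReal
        (Real.exp (-(Real.exp (p.1 * (α - S - 2 * η)) / 4)))) (whp μ) (𝓝 0) := by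
      have := ENNReal.tendsto_ofReal h2
      rw [ENNReal.ofReal_zero] at this
      exact this.comp tendsto_fst_whp
    refine tendsto_of_tendsto_of_tendsto_of_le_of_le' tendsto_const_nhds h3
      (Eventually.of_forall fun _ => zero_le) ?_
    filter_upwards [hwin] with p hp
    refine (measure_count_le (measurableSet_window p.2 v δ) (n p.1)).trans
      (ENNReal.ofReal_le_ofReal (Real.exp_le_exp.2 ?_))
    linarith

end asymptotic

/-! ### The Kullback-Leibler divergence of the estimator -/

/-- The inverse temperature of the kernel of bandwidth `h`. -/
def invTemp (γ h : ℝ) : ℝ := 1 / (2 * γ) * (h ^ 2) ^ (-γ)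

lemma invTemp_pos {γ h : ℝ} (hγ : 1 ≤ γ) (hh : 0 < h) : 0 < invTemp γ h := by
  unfold invTemp; positivity

lemma kernel_eq {γ h : ℝ} (hh : 0 < h) {d : ℕ} (x y : Sp d) :
    kernel γ (h⁻¹ • (x - y)) = Real.exp (d * kernelConst γ d) * weight γ (invTemp γ h) x y := by
  have e : (‖h⁻¹ • (x - y)‖ ^ 2 / (d : ℝ)) ^ γ = (h ^ 2) ^ (-γ) * sqDist x y ^ γ := by
    rw [norm_smul, Real.norm_eq_abs, abs_of_pos (by positivity), mul_pow, mul_div_assoc,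
      Real.mul_rpow (by positivity) (by positivity), inv_pow, Real.inv_rpow (by positivity),
      Real.rpow_neg (by positivity), sqDist]
  rw [kernel, e, weight, ← Real.exp_add, invTemp]
  congr 1
  ring

lemma measurable_kernel {γ : ℝ} (hγ : 0 ≤ γ) {d : ℕ} : Measurable (kernel γ : Sp d → ℝ) := by
  have : Continuous (kernel γ : Sp d → ℝ) := by
    unfold kernel
    refine Real.continuous_exp.comp (continuous_const.mul (continuous_const.sub
      (continuous_const.mul ?_)))
    exact Continuous.rpow_const (by fun_prop) fun _ => Or.inr hγ
  exact this.measurable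

section estimator

variable {γ h : ℝ} {d n : ℕ}

lemma estimator_eq (hh : 0 < h) (y : Fin n → Sp d) (x : Sp d) :
    estimator γ h y x = ((n : ℝ) * h ^ d)⁻¹ *
      (Real.exp (d * kernelConst γ d) * partition γ (invTemp γ h) x y) := by
  rw [estimator, partition]
  simp_rw [kernel_eq hh]
  rw [← Finset.mul_sum]

lemma estimator_pos (hh : 0 < h) (hn : 0 < n) (y : Fin n → Sp d) (x : Sp d) :
    0 < estimator γ h y x := by
  rw [estimator_eq hh]
  have := partition_pos (γ := γ) (b := invTemp γ h) hn x y
  positivity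

lemma measurable_estimator (hγ : 0 ≤ γ) (y : Fin n → Sp d) : Measurable (estimator γ h y) := by
  unfold estimator
  refine (Finset.measurable_fun_sum _ fun i _ => ?_).const_mul _
  exact (measurable_kernel hγ).comp (by fun_prop)

lemma log_estimator (hh : 0 < h) (hn : 0 < n) (y : Fin n → Sp d) (x : Sp d) :
    Real.log (estimator γ h y x) = d * kernelConst γ d - Real.log n - d * Real.log h
      + Real.log (partition γ (invTemp γ h) x y) := by
  have hn0 : (0 : ℝ) < n := by exact_mod_cast hn
  have hp := partition_pos (γ := γ) (b := invTemp γ h) hn x y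
  rw [estimator_eq hh, Real.log_mul (by positivity) (by positivity), Real.log_inv,
    Real.log_mul (by positivity) (by positivity), Real.log_mul (by positivity) (by positivity),
    Real.log_pow, Real.log_exp]
  ring

/-- With equal total masses the mass correction in `InformationTheory.klDiv` drops out. -/
lemma law_estimator_univ (hγ : 1 ≤ γ) (hh : 0 < h) (hd : 1 ≤ d) (hn : 0 < n) (y : Fin n → Sp d) :
    law (estimator γ h y) univ = 1 := by
  have hn0 : (0 : ℝ) < n := by exact_mod_cast hn
  have hk : Integrable (kernel γ : Sp d → ℝ) :=
    Integrable.of_integral_ne_zero (by rw [integral_kernel hγ hd]; exact one_ne_zero)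
  have hki : ∀ i, Integrable fun x => kernel γ (h⁻¹ • (x - y i)) := fun i =>
    (hk.comp_smul (inv_ne_zero hh.ne')).comp_sub_right (y i)
  have hint : ∀ i, ∫ x, kernel γ (h⁻¹ • (x - y i)) = h ^ d := fun i => by
    rw [integral_sub_right_eq_self (fun x => kernel γ (h⁻¹ • x)) (y i),
      Measure.integral_comp_inv_smul, integral_kernel hγ hd, finrank_euclideanSpace_fin,
      abs_of_pos (by positivity), smul_eq_mul, mul_one]
  have hest : Integrable (estimator γ h y) := by
    unfold estimator
    exact (integrable_finsetSum _ fun i _ => hki i).const_mul _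
  have h1 : ∫ x, estimator γ h y x = 1 := by
    unfold estimator
    rw [integral_const_mul, integral_finsetSum _ fun i _ => hki i]
    simp_rw [hint]
    rw [Finset.sum_const, Finset.card_univ, Fintype.card_fin, nsmul_eq_mul, inv_mul_cancel₀]
    positivity
  rw [law, withDensity_apply _ MeasurableSet.univ, Measure.restrict_univ,
    ← ofReal_integral_eq_lintegral_ofReal hest
      (ae_of_all _ fun x => (estimator_pos hh hn y x).le), h1, ENNReal.ofReal_one]

/-- Convexity of exp over the uniform measure on the database. It bounds the log-likelihood below by
moments for every database, which gives both finiteness of the divergence and the domination for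
Vitali's theorem. -/
lemma log_partition_ge (hγ : 0 ≤ γ) {b : ℝ} (hb : 0 ≤ b) (hn : 0 < n) (x : Sp d)
    (y : Fin n → Sp d) :
    Real.log n - d * (b * 4 ^ γ * (normMoment γ x + (n : ℝ)⁻¹ * ∑ i, normMoment γ (y i)))
      ≤ Real.log (partition γ b x y) := by
  have hn0 : (0 : ℝ) < n := by exact_mod_cast hn
  have hJ := convexOn_exp.map_sum_le (t := Finset.univ) (w := fun _ : Fin n => (n : ℝ)⁻¹)
    (p := fun i => -((d : ℝ) * (b * sqDist x (y i) ^ γ))) (fun _ _ => by positivity)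
    (by simp [hn0.ne']) (fun _ _ => mem_univ _)
  simp only [smul_eq_mul] at hJ
  rw [← Finset.mul_sum, ← Finset.mul_sum] at hJ
  have h2 : Real.exp (Real.log n + (n : ℝ)⁻¹ * ∑ i, -((d : ℝ) * (b * sqDist x (y i) ^ γ)))
      ≤ partition γ b x y := by
    rw [Real.exp_add, Real.exp_log hn0]
    calc _ ≤ (n : ℝ) * ((n : ℝ)⁻¹ * ∑ i, Real.exp (-((d : ℝ) * (b * sqDist x (y i) ^ γ)))) := by
          gcongr
      _ = _ := by rw [← mul_assoc, mul_inv_cancel₀ hn0.ne', one_mul]; rfl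
  have h3 := Real.log_le_log (Real.exp_pos _) h2
  rw [Real.log_exp] at h3
  refine le_trans ?_ h3
  have h4 : ∑ i, (d : ℝ) * (b * sqDist x (y i) ^ γ)
      ≤ ∑ i, (d : ℝ) * (b * (4 ^ γ * (normMoment γ x + normMoment γ (y i)))) :=
    Finset.sum_le_sum fun i _ => by
      have := sqDist_rpow_le hγ x (y i)
      gcongr
  have h5 : (n : ℝ)⁻¹ * ∑ i, (d : ℝ) * (b * (4 ^ γ * (normMoment γ x + normMoment γ (y i))))
      = d * (b * 4 ^ γ * (normMoment γ x + (n : ℝ)⁻¹ * ∑ i, normMoment γ (y i))) := by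
    simp_rw [← mul_assoc, mul_add, Finset.sum_add_distrib, ← Finset.mul_sum]
    rw [Finset.sum_const, Finset.card_univ, Fintype.card_fin, nsmul_eq_mul]
    field_simp
  rw [Finset.sum_neg_distrib]
  have h6 := mul_le_mul_of_nonneg_left h4 (inv_nonneg.2 hn0.le)
  rw [h5] at h6
  linarith

variable {q : Sp d → ℝ}

/-- The Kullback-Leibler divergence is finite and splits into the entropy and the mean
log-likelihood of the estimator. -/
lemma klEstimator_eq (hγ : 1 ≤ γ) (hh : 0 < h) (hd : 1 ≤ d) (hn : 0 < n) (hq : Measurable q)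
    (hq0 : ∀ x, 0 ≤ q x) (hprob : IsProbabilityMeasure (law q))
    (hent : Integrable fun x => q x * Real.log (q x)) (y : Fin n → Sp d)
    (hlog : Integrable (fun x => Real.log (estimator γ h y x)) (law q)) :
    klEstimator γ h q y ≠ ⊤ ∧ (klEstimator γ h q y).toReal
      = (∫ x, q x * Real.log (q x)) - ∫ x, Real.log (estimator γ h y x) ∂law q := by
  have hpos := estimator_pos (γ := γ) hh hn y
  have hem : Measurable (estimator γ h y) := measurable_estimator (by linarith) y
  have huniv := law_estimator_univ hγ hh hd hn y
  have hprob2 : IsProbabilityMeasure (law (estimator γ h y)) := ⟨huniv⟩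
  have hac : law q ≪ law (estimator γ h y) := by
    refine (withDensity_absolutelyContinuous _ _).trans
      (withDensity_absolutelyContinuous' hem.ennreal_ofReal.aemeasurable (ae_of_all _ fun x => ?_))
    simpa using hpos x
  have hgm : Measurable fun x => ENNReal.ofReal (q x / estimator γ h y x) :=
    (hq.div hem).ennreal_ofReal
  have hwd : law q = (law (estimator γ h y)).withDensity
      fun x => ENNReal.ofReal (q x / estimator γ h y x) := by
    rw [law, law, ← withDensity_mul _ hem.ennreal_ofReal hgm]
    congr 1
    ext x
    simp only [Pi.mul_apply]
    rw [← ENNReal.ofReal_mul (hpos x).le, mul_div_cancel₀ _ (hpos x).ne']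
  have hrn : (law q).rnDeriv (law (estimator γ h y)) =ᵐ[law (estimator γ h y)]
      fun x => ENNReal.ofReal (q x / estimator γ h y x) := by
    have := Measure.rnDeriv_withDensity (law (estimator γ h y)) hgm
    rwa [← hwd] at this
  have hq1 : ∀ᵐ x ∂law q, q x ≠ 0 := by
    rw [law, ae_withDensity_iff hq.ennreal_ofReal]
    refine ae_of_all _ fun x hx h0 => hx ?_
    rw [h0, ENNReal.ofReal_zero]
  have hllr : llr (law q) (law (estimator γ h y)) =ᵐ[law q]
      fun x => Real.log (q x) - Real.log (estimator γ h y x) := by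
    filter_upwards [hac.ae_eq hrn, hq1] with x hx hx1
    rw [llr, hx, ENNReal.toReal_ofReal (div_nonneg (hq0 x) (hpos x).le),
      Real.log_div hx1 (hpos x).ne']
  have htop : ∀ᵐ x : Sp d, ENNReal.ofReal (q x) < ⊤ := ae_of_all _ fun x => ENNReal.ofReal_lt_top
  have hlogq : Integrable (fun x => Real.log (q x)) (law q) := by
    rw [law, integrable_withDensity_iff_integrable_smul' hq.ennreal_ofReal htop]
    refine hent.congr (ae_of_all _ fun x => ?_)
    simp only [ENNReal.toReal_ofReal (hq0 x), smul_eq_mul]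
  have hlogq2 : ∫ x, Real.log (q x) ∂law q = ∫ x, q x * Real.log (q x) := by
    rw [law, integral_withDensity_eq_integral_toReal_smul hq.ennreal_ofReal htop]
    simp only [ENNReal.toReal_ofReal (hq0 _), smul_eq_mul]
  have hi : Integrable (llr (law q) (law (estimator γ h y))) (law q) :=
    (hlogq.sub hlog).congr hllr.symm
  refine ⟨InformationTheory.klDiv_ne_top hac hi, ?_⟩
  rw [klEstimator, InformationTheory.toReal_klDiv_of_measure_eq hac (by rw [huniv, measure_univ]),
    integral_congr_ae hllr, integral_sub hlogq hlog, hlogq2]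

end estimator

section asymptotic

variable {μ : ∀ d, Measure (Sp d)} [∀ d, IsProbabilityMeasure (μ d)] {n : ℕ → ℕ} {α γ : ℝ}

/-- The excess of the sum over 2R is at most the excess of the first term over R plus the average of
the excesses of the others; all have the same law, so the number of points plays no role. -/
lemma upperUnifInt_jointMoment (hγ : 0 ≤ γ) (hn : ∀ᶠ d in atTop, 0 < n d)
    (h : UpperUnifInt μ fun _ => normMoment γ) :
    UpperUnifInt (jointLaw μ n) fun d z =>
      normMoment γ z.1 + (n d : ℝ)⁻¹ * ∑ i, normMoment γ (z.2 i) := by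
  intro ε hε
  obtain ⟨R, hR⟩ := h (ε / 2) (by positivity)
  refine ⟨R + R, ?_⟩
  filter_upwards [hR, hn] with d hd hnd
  have hn0 : (0 : ℝ) < n d := by exact_mod_cast hnd
  set f : Sp d → ENNReal := fun x => ENNReal.ofReal (normMoment γ x - R) with hf
  have hfm : Measurable f := ((continuous_normMoment hγ).measurable.sub_const R).ennreal_ofReal
  have hle : ∀ z : Sp d × (Fin (n d) → Sp d),
      ENNReal.ofReal (normMoment γ z.1 + (n d : ℝ)⁻¹ * ∑ i, normMoment γ (z.2 i) - (R + R))
      ≤ f z.1 + ENNReal.ofReal (n d : ℝ)⁻¹ * ∑ i, f (z.2 i) := fun z => by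
    have e : normMoment γ z.1 + (n d : ℝ)⁻¹ * ∑ i, normMoment γ (z.2 i) - (R + R)
        = (normMoment γ z.1 - R) + (n d : ℝ)⁻¹ * ∑ i, (normMoment γ (z.2 i) - R) := by
      rw [Finset.sum_sub_distrib, Finset.sum_const, Finset.card_univ, Fintype.card_fin,
        nsmul_eq_mul]
      field_simp
      ring
    rw [e]
    refine ENNReal.ofReal_add_le.trans ?_
    rw [ENNReal.ofReal_mul (by positivity)]
    gcongr
    calc ENNReal.ofReal (∑ i, (normMoment γ (z.2 i) - R))
        ≤ ENNReal.ofReal (∑ i, max (normMoment γ (z.2 i) - R) 0) :=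
          ENNReal.ofReal_le_ofReal (Finset.sum_le_sum fun i _ => le_max_left _ _)
      _ = ∑ i, ENNReal.ofReal (max (normMoment γ (z.2 i) - R) 0) :=
          ENNReal.ofReal_sum_of_nonneg fun i _ => le_max_right _ _
      _ = ∑ i, f (z.2 i) := by simp [hf]
  have hsum : Measurable fun y : Fin (n d) → Sp d => ∑ i, f (y i) :=
    Finset.measurable_fun_sum _ fun i _ => hfm.comp (measurable_pi_apply i)
  have h1 : ∫⁻ z, f z.1 ∂jointLaw μ n d = ∫⁻ x, f x ∂μ d :=
    (measurePreserving_fst (μ := μ d)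
      (ν := Measure.pi fun _ : Fin (n d) => μ d)).lintegral_comp hfm
  have h2 : ∫⁻ z, ∑ i, f (z.2 i) ∂jointLaw μ n d = n d * ∫⁻ x, f x ∂μ d := by
    have e := (measurePreserving_snd (μ := μ d)
      (ν := Measure.pi fun _ : Fin (n d) => μ d)).lintegral_comp hsum
    rw [jointLaw, e]
    have hmi : ∀ i : Fin (n d), Measurable fun y : Fin (n d) → Sp d => f (y i) :=
      fun i => hfm.comp (measurable_pi_apply i)
    rw [lintegral_finsetSum _ fun i _ => hmi i]
    have e2 : ∀ i : Fin (n d), ∫⁻ y, f (y i) ∂Measure.pi (fun _ : Fin (n d) => μ d)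
        = ∫⁻ x, f x ∂μ d := fun i =>
      (measurePreserving_eval (fun _ : Fin (n d) => μ d) i).lintegral_comp hfm
    simp_rw [e2]
    rw [Finset.sum_const, Finset.card_univ, Fintype.card_fin, nsmul_eq_mul]
  have hm1 : Measurable fun z : Sp d × (Fin (n d) → Sp d) => f z.1 := hfm.comp measurable_fst
  calc _ ≤ ∫⁻ z, f z.1 + ENNReal.ofReal (n d : ℝ)⁻¹ * ∑ i, f (z.2 i) ∂jointLaw μ n d :=
        lintegral_mono hle
    _ = ∫⁻ x, f x ∂μ d + ENNReal.ofReal (n d : ℝ)⁻¹ * (n d * ∫⁻ x, f x ∂μ d) := by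
        rw [lintegral_add_left hm1, lintegral_const_mul' _ _ ENNReal.ofReal_ne_top, h1, h2]
    _ = ∫⁻ x, f x ∂μ d + ∫⁻ x, f x ∂μ d := by
        rw [← mul_assoc, ← ENNReal.ofReal_natCast, ← ENNReal.ofReal_mul (by positivity),
          inv_mul_cancel₀ hn0.ne', ENNReal.ofReal_one, one_mul]
    _ ≤ ENNReal.ofReal (ε / 2) + ENNReal.ofReal (ε / 2) := by gcongr
    _ = ENNReal.ofReal ε := by
        rw [← ENNReal.ofReal_add (by positivity) (by positivity), add_halves]

end asymptotic

/-- The divergence is governed by the free energy of the random energy model. -/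
lemma kLAsymptotics_of_tendsto {ρ : (d : ℕ) → Sp d → ℝ} {γ α h c P : ℝ} {n : ℕ → ℕ}
    (hγ : 1 ≤ γ) (hα : 0 < α)
    (hn : Tendsto (fun d : ℕ => Real.log (n d) / (d : ℝ)) atTop (𝓝 α))
    (hpure : IsPure ρ) (hentropy : ∀ d, Integrable fun x => ρ d x * Real.log (ρ d x))
    (hmoment : UnifIntMoment ρ γ) (hc : Tendsto (kernelConst γ) atTop (𝓝 c)) (hh : 0 < h)
    (hP : Tendsto (fun p : Σ d, Sp d × (Fin (n d) → Sp d) =>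
      1 / (p.1 : ℝ) * Real.log (partition γ (invTemp γ h) p.2.1 p.2.2))
      (whp (jointLaw (fun d => law (ρ d)) n)) (𝓝 P)) :
    KLAsymptotics ρ n γ h (-(c - α - Real.log h + P)) := by
  have hprob := hpure.isProbability
  have hγ0 : 0 ≤ γ := by linarith
  have hβ := invTemp_pos hγ hh
  set β := invTemp γ h with hβdef
  obtain ⟨M, hM, hMd⟩ := exists_normMoment_bound hγ0 hpure hmoment
  have hnpos := eventually_pos_of_tendsto_log hα hn
  set T := c - α - Real.log h + P with hT
  set K : ℝ := β * 4 ^ γ with hK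
  have hK0 : 0 ≤ K := by positivity
  have hcn : Tendsto (fun d : ℕ => kernelConst γ d - Real.log (n d) / (d : ℝ) - Real.log h) atTop
      (𝓝 (c - α - Real.log h)) := (hc.sub hn).sub_const _
  -- the normalized log-likelihood, as a function of the point and the database
  set X : ∀ d, Sp d × (Fin (n d) → Sp d) → ℝ := fun d z =>
    kernelConst γ d - Real.log (n d) / (d : ℝ) - Real.log h
      + 1 / (d : ℝ) * Real.log (partition γ β z.1 z.2) with hX
  have hXlog : ∀ d, 1 ≤ d → 0 < n d → ∀ (x : Sp d) (y : Fin (n d) → Sp d),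
      Real.log (estimator γ h y x) = d * X d (x, y) := fun d hd hnd x y => by
    have hd0 : (0 : ℝ) < d := by exact_mod_cast hd
    rw [log_estimator hh hnd, ← hβdef]
    simp only [hX]
    field_simp
  have hXm : ∀ d, Measurable (X d) := fun d =>
    ((Real.measurable_log.comp (measurable_partition hγ0)).const_mul _).const_add _
  have hXT : Tendsto (fun p : Σ d, Sp d × (Fin (n d) → Sp d) => X p.1 p.2)
      (whp (jointLaw (fun d => law (ρ d)) n)) (𝓝 T) :=
    (hcn.comp tendsto_fst_whp).add hP
  set w : ∀ d, Sp d × (Fin (n d) → Sp d) → ℝ := fun d z =>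
    normMoment γ z.1 + (n d : ℝ)⁻¹ * ∑ i, normMoment γ (z.2 i) with hw
  have hw0 : ∀ d z, 0 ≤ w d z := fun d z => by
    have h1 := normMoment_nonneg γ z.1
    have h2 : 0 ≤ ∑ i, normMoment γ (z.2 i) := Finset.sum_nonneg fun i _ => normMoment_nonneg γ _
    have h3 : (0 : ℝ) ≤ (n d : ℝ)⁻¹ := by positivity
    have := mul_nonneg h3 h2
    simp only [hw]
    linarith
  -- The partition function is at most n, as the weights are at most 1, and `log_partition_ge`
  -- bounds it below; the two terms in log n cancel.
  have hbound : ∀ d, 1 ≤ d → 0 < n d → ∀ z,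
      |X d z - (kernelConst γ d - Real.log h)| ≤ K * w d z := fun d hd hnd z => by
    have hd0 : (0 : ℝ) < d := by exact_mod_cast hd
    have h1 := log_partition_ge hγ0 hβ.le hnd z.1 z.2
    have h2 := Real.log_le_log (partition_pos hnd z.1 z.2) (partition_le (γ := γ) hβ.le z.1 z.2)
    have e : X d z - (kernelConst γ d - Real.log h)
        = (Real.log (partition γ β z.1 z.2) - Real.log (n d)) / d := by
      simp only [hX]; ring
    have h3 : Real.log (partition γ β z.1 z.2) - Real.log (n d) ≤ 0 := by linarith
    rw [e, abs_of_nonpos (div_nonpos_of_nonpos_of_nonneg h3 hd0.le), ← neg_div,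
      div_le_iff₀ hd0]
    simp only [hw, hK]
    linarith
  set a : ℝ := |c - Real.log h - T| + 1 with ha
  have ha' : ∀ᶠ d in atTop, |kernelConst γ d - Real.log h - T| ≤ a := by
    have := ((hc.sub_const (Real.log h)).sub_const T).abs
    filter_upwards [this.eventually_lt_const (show |c - Real.log h - T| < a by rw [ha]; linarith)]
      with d hd using hd.le
  have hvit := ((upperUnifInt_jointMoment (μ := fun d => law (ρ d)) hγ0 hnpos
    (upperUnifInt_normMoment hγ0 hmoment)).const_add_mul a hK0).tendsto_lintegral hXm hXT (by
      filter_upwards [ha', hnpos, eventually_ge_atTop 1] with d hd hnd hd1 z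
      calc |X d z - T| = |(kernelConst γ d - Real.log h - T) +
            (X d z - (kernelConst γ d - Real.log h))| := by congr 1; ring
        _ ≤ |kernelConst γ d - Real.log h - T| + |X d z - (kernelConst γ d - Real.log h)| :=
            abs_add_le _ _
        _ ≤ a + K * w d z := add_le_add hd (hbound d hd1 hnd z))
  have hXint : ∀ᶠ d in atTop, ∀ y : Fin (n d) → Sp d,
      Integrable (fun x => X d (x, y)) (law (ρ d)) := by
    filter_upwards [hMd, hnpos, eventually_ge_atTop 1] with d hd hnd hd1 y
    have hm : Measurable fun x => X d (x, y) := (hXm d).comp (by fun_prop)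
    have hwi : Integrable (fun x => |kernelConst γ d - Real.log h| +
        K * (normMoment γ x + (n d : ℝ)⁻¹ * ∑ i, normMoment γ (y i))) (law (ρ d)) :=
      (integrable_const _).add ((hd.1.add
        (integrable_const ((n d : ℝ)⁻¹ * ∑ i, normMoment γ (y i)))).const_mul K)
    refine Integrable.mono' hwi
      hm.aestronglyMeasurable (ae_of_all _ fun x => ?_)
    have h1 := hbound d hd1 hnd (x, y)
    rw [Real.norm_eq_abs]
    calc |X d (x, y)| = |(kernelConst γ d - Real.log h) +
          (X d (x, y) - (kernelConst γ d - Real.log h))| := by congr 1; ring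
      _ ≤ |kernelConst γ d - Real.log h| + |X d (x, y) - (kernelConst γ d - Real.log h)| :=
          abs_add_le _ _
      _ ≤ |kernelConst γ d - Real.log h| + K * w d (x, y) := by gcongr
  have hkl : ∀ᶠ d in atTop, ∀ y : Fin (n d) → Sp d, klEstimator γ h (ρ d) y ≠ ⊤ ∧
      (klEstimator γ h (ρ d) y).toReal = (∫ x, ρ d x * Real.log (ρ d x))
        - d * ∫ x, X d (x, y) ∂law (ρ d) := by
    filter_upwards [hXint, hnpos, eventually_ge_atTop 1] with d hd hnd hd1 y
    have hl := funext fun x => hXlog d hd1 hnd x y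
    have h1 := klEstimator_eq hγ hh hd1 hnd (hpure.measurable d) (hpure.nonneg d) (hprob d)
      (hentropy d) y (by rw [hl]; exact (hd y).const_mul _)
    rw [hl, integral_const_mul] at h1
    exact h1
  refine ⟨hkl.mono fun d hd y => (hd y).1, ?_⟩
  refine tendsto_of_tendsto_of_tendsto_of_le_of_le' tendsto_const_nhds hvit
    (Eventually.of_forall fun _ => zero_le) ?_
  filter_upwards [hkl, hXint, eventually_ge_atTop 1] with d hd hi hd1
  have hd0 : (0 : ℝ) < d := by exact_mod_cast hd1
  rw [eLpNorm_one_eq_lintegral_enorm]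
  have hmeas : Measurable fun z : Sp d × (Fin (n d) → Sp d) => ENNReal.ofReal |X d z - T| :=
    ((hXm d).sub_const T).abs.ennreal_ofReal
  -- The divergence is an integral over x of the log-likelihood, so its L¹ distance over the
  -- database is at most the L¹ distance on the joint space.
  rw [jointLaw, lintegral_prod_symm _ hmeas.aemeasurable]
  refine lintegral_mono fun y => ?_
  have e : 1 / (d : ℝ) * (klEstimator γ h (ρ d) y).toReal
      - 1 / (d : ℝ) * (∫ x, ρ d x * Real.log (ρ d x)) - -T
      = ∫ x, (T - X d (x, y)) ∂law (ρ d) := by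
    rw [(hd y).2, integral_sub (integrable_const _) (hi y)]
    simp only [integral_const, probReal_univ, smul_eq_mul, one_mul]
    field_simp
    ring
  rw [e]
  refine (enorm_integral_le_lintegral_enorm _).trans (le_of_eq (lintegral_congr fun x => ?_))
  rw [Real.enorm_eq_ofReal_abs, abs_sub_comm]

/-! ### The replica free entropy -/

section gbar

variable {ρ : (d : ℕ) → Sp d → ℝ} {γ h m c g : ℝ}

lemma logMoment_eq {d : ℕ} {q : Sp d → ℝ} [IsProbabilityMeasure (law q)] (hγ : 1 ≤ γ) (hh : 0 < h)
    (hm : 0 < m) (hd : 1 ≤ d) (x : Sp d) : logMoment γ q h m x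
      = m * kernelConst γ d + logMGF (law q) γ (m * invTemp γ h) x := by
  have hd0 : (0 : ℝ) < d := by exact_mod_cast hd
  have hβ := invTemp_pos hγ hh
  have e : ∀ y, kernel γ (h⁻¹ • (x - y)) ^ m
      = Real.exp (d * (m * kernelConst γ d)) * weight γ (m * invTemp γ h) x y := fun y => by
    rw [kernel_eq hh, Real.mul_rpow (Real.exp_pos _).le (weight_pos x y).le, weight, weight,
      ← Real.exp_mul, ← Real.exp_mul, ← Real.exp_add, ← Real.exp_add]
    congr 1
    ring
  have hI := integral_weight_pos (μ := law q) (by linarith : 0 ≤ γ)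
    (by positivity : 0 ≤ m * invTemp γ h) x
  rw [logMoment, logMGF]
  simp_rw [e]
  rw [integral_const_mul, Real.log_mul (Real.exp_ne_zero _) hI.ne', Real.log_exp]
  field_simp

lemma integrable_logMGF {d : ℕ} {q : Sp d → ℝ} [IsProbabilityMeasure (law q)] (hd : 1 ≤ d)
    {b : ℝ} (hγ : 0 ≤ γ) (hint : Integrable (normMoment γ) (law q)) (hb : 0 ≤ b) :
    Integrable (logMGF (law q) γ b) (law q) := by
  refine Integrable.mono' (g := fun x => b * (4 ^ γ * (normMoment γ x +
    ∫ y, normMoment γ y ∂law q))) ?_ (measurable_logMGF hγ).aestronglyMeasurable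
    (ae_of_all _ fun x => ?_)
  · exact ((hint.add (integrable_const _)).const_mul _).const_mul _
  · rw [Real.norm_eq_abs, abs_of_nonpos (logMGF_nonpos hγ hb x)]
    linarith [neg_moment_le_logMGF (μ := law q) hd hγ hb hint x]

/-- Convergence in probability passes to the mean by Vitali's theorem, the domination being affine
in the moment of order γ. -/
lemma tendsto_integral_logMGF (hγ : 0 ≤ γ) (hpure : IsPure ρ) (hmoment : UnifIntMoment ρ γ)
    {b : ℝ} (hb : 0 ≤ b)
    (hg : Tendsto (fun p : Σ d, Sp d => logMGF (law (ρ p.1)) γ b p.2) (whp fun d => law (ρ d))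
      (𝓝 g)) :
    Tendsto (fun d => ∫ x, logMGF (law (ρ d)) γ b x ∂law (ρ d)) atTop (𝓝 g) := by
  have hprob := hpure.isProbability
  obtain ⟨M, hM, hMd⟩ := exists_normMoment_bound hγ hpure hmoment
  set K : ℝ := b * 4 ^ γ with hK
  have hK0 : 0 ≤ K := by positivity
  have hvit := ((upperUnifInt_normMoment hγ hmoment).const_add_mul (|g| + K * M)
    hK0).tendsto_lintegral (X := fun d => logMGF (law (ρ d)) γ b) (fun d => measurable_logMGF hγ)
    hg (by
      filter_upwards [hMd, eventually_ge_atTop 1] with d hd hd1 x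
      have h1 := neg_moment_le_logMGF (μ := law (ρ d)) hd1 hγ hb hd.1 x
      have h2 := logMGF_nonpos (μ := law (ρ d)) hγ hb x
      have h3 := mul_le_mul_of_nonneg_left hd.2 hK0
      have h4 : |logMGF (law (ρ d)) γ b x| ≤ K * (normMoment γ x + M) := by
        rw [abs_of_nonpos h2, hK]
        rw [hK] at h3
        linarith
      calc |logMGF (law (ρ d)) γ b x - g| ≤ |logMGF (law (ρ d)) γ b x| + |g| := abs_sub _ _
        _ ≤ |g| + K * M + K * normMoment γ x := by linarith)
  rw [tendsto_iff_edist_tendsto_0]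
  refine tendsto_of_tendsto_of_tendsto_of_le_of_le' tendsto_const_nhds hvit
    (Eventually.of_forall fun _ => zero_le) ?_
  filter_upwards [hMd, eventually_ge_atTop 1] with d hd hd1
  have hi := integrable_logMGF hd1 hγ hd.1 hb
  have e : (∫ x, logMGF (law (ρ d)) γ b x ∂law (ρ d)) - g
      = ∫ x, (logMGF (law (ρ d)) γ b x - g) ∂law (ρ d) := by
    rw [integral_sub hi (integrable_const _)]; simp
  rw [edist_eq_enorm_sub, e]
  refine (enorm_integral_le_lintegral_enorm _).trans (le_of_eq (lintegral_congr fun x => ?_))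
  rw [Real.enorm_eq_ofReal_abs]

lemma tendsto_meanLogMoment (hγ : 1 ≤ γ) (hpure : IsPure ρ) (hmoment : UnifIntMoment ρ γ)
    (hc : Tendsto (kernelConst γ) atTop (𝓝 c)) (hh : 0 < h) (hm : 0 < m)
    (hg : Tendsto (fun p : Σ d, Sp d => logMGF (law (ρ p.1)) γ (m * invTemp γ h) p.2)
      (whp fun d => law (ρ d)) (𝓝 g)) :
    (∀ᶠ d : ℕ in atTop, Integrable (logMoment γ (ρ d) h m) (law (ρ d))) ∧
      Tendsto (fun d => meanLogMoment γ (ρ d) h m) atTop (𝓝 (m * c + g - m * Real.log h)) := by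
  have hprob := hpure.isProbability
  have hγ0 : 0 ≤ γ := by linarith
  have hb : 0 ≤ m * invTemp γ h := by have := invTemp_pos hγ hh; positivity
  obtain ⟨M, hM, hMd⟩ := exists_normMoment_bound hγ0 hpure hmoment
  have hfun : ∀ d, 1 ≤ d → logMoment γ (ρ d) h m
      = fun x => m * kernelConst γ d + logMGF (law (ρ d)) γ (m * invTemp γ h) x :=
    fun d hd => funext fun x => logMoment_eq hγ hh hm hd x
  refine ⟨?_, ?_⟩
  · filter_upwards [hMd, eventually_ge_atTop 1] with d hd hd1
    rw [hfun d hd1]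
    exact (integrable_const _).add (integrable_logMGF hd1 hγ0 hd.1 hb)
  · refine (((hc.const_mul m).add
      (tendsto_integral_logMGF hγ0 hpure hmoment hb hg)).sub_const (m * Real.log h)).congr' ?_
    filter_upwards [hMd, eventually_ge_atTop 1] with d hd hd1
    rw [meanLogMoment, hfun d hd1,
      integral_add (integrable_const _) (integrable_logMGF hd1 hγ0 hd.1 hb)]
    simp

/-- Strict convexity of the replica entropy excludes a vanishing generating function. -/
lemma exists_limitMGF_neg (hγ : 1 ≤ γ) (hpure : IsPure ρ) (hmoment : UnifIntMoment ρ γ)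
    (hc : Tendsto (kernelConst γ) atTop (𝓝 c))
    (hconvex : StrictConvexOn ℝ (Ioi 0) fun m => gbar ρ γ 1 m) :
    ∃ s : ℝ, 0 < s ∧ limitMGF ρ s < 0 := by
  have hprob := hpure.isProbability
  by_contra! hcon
  obtain ⟨C, hC⟩ := exists_limitMGF_bound hγ hpure hmoment
  have h0 : ∀ s : ℝ, 0 < s → limitMGF ρ s = 0 := fun s hs => le_antisymm (hC s hs).2.2.1 (hcon s hs)
  have hg : ∀ m : ℝ, 0 < m → gbar ρ γ 1 m = m * c := fun m hm => by
    have hb : 0 ≤ m * invTemp γ 1 := by have := invTemp_pos hγ one_pos; positivity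
    have h1 := tendsto_logMGF_zero (μ := fun d => law (ρ d))
      (fun lam hlam => tendsto_logMGF_one hγ hpure hmoment hlam) h0 hγ hb
    have h2 := (tendsto_meanLogMoment hγ hpure hmoment hc one_pos hm h1).2
    rw [gbar, h2.limUnder_eq]
    simp
  -- A vanishing F would make ḡ(1, m) = m c linear; strict convexity fails already at 1, 3 and their
  -- midpoint.
  have h3 := hconvex.2 (show (1 : ℝ) ∈ Ioi 0 by simp) (show (3 : ℝ) ∈ Ioi 0 by simp)
    (by norm_num) (show (0 : ℝ) < 1 / 2 by norm_num) (show (0 : ℝ) < 1 / 2 by norm_num)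
    (by norm_num)
  simp only [smul_eq_mul] at h3
  rw [hg _ (by norm_num), hg _ (by norm_num), hg _ (by norm_num)] at h3
  linarith

/-- At bandwidth 1, ḡ and G differ by a linear term and a rescaling of the variable. -/
lemma strictConvexOn_freeEnergy {F : ℝ → ℝ} {v : ℝ → ℝ} (hγ : 1 ≤ γ)
    (hconvex : StrictConvexOn ℝ (Ioi 0) fun m => gbar ρ γ 1 m)
    (hgbar : ∀ m : ℝ, 0 < m → gbar ρ γ 1 m = m * c + freeEnergy F γ v (m * invTemp γ 1)) :
    StrictConvexOn ℝ (Ioi 0) (freeEnergy F γ v) := by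
  have hβ := invTemp_pos hγ one_pos
  set β := invTemp γ 1 with hβdef
  refine ⟨convex_Ioi 0, fun x hx y hy hxy a b ha hb hab => ?_⟩
  have hx' : (0 : ℝ) < x := hx
  have hy' : (0 : ℝ) < y := hy
  have hne : x / β ≠ y / β := fun h => hxy (by field_simp at h; exact h)
  have h := hconvex.2 (x := x / β) (y := y / β) (div_pos hx' hβ) (div_pos hy' hβ) hne ha hb hab
  simp only [smul_eq_mul] at h ⊢
  rw [hgbar _ (by positivity), hgbar _ (by positivity), hgbar _ (by positivity)] at h
  have e1 : (a * (x / β) + b * (y / β)) * β = a * x + b * y := by field_simp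
  rw [e1, div_mul_cancel₀ _ hβ.ne', div_mul_cancel₀ _ hβ.ne'] at h
  linarith

end gbar

/-! ### The two phases of the random energy model -/

section freeEntropy

variable {F : ℝ → ℝ} {C γ α : ℝ} {v : ℝ → ℝ} {μ : ∀ d, Measure (Sp d)}
  [∀ d, IsProbabilityMeasure (μ d)] {n : ℕ → ℕ}

/-- The free energy of the random energy model, from matching bounds. -/
lemma tendsto_log_partition (hγ : 1 ≤ γ) (hα : 0 < α)
    (hn : Tendsto (fun d : ℕ => Real.log (n d) / (d : ℝ)) atTop (𝓝 α))
    (hconv : ∀ lam : ℝ, 0 < lam → Tendsto (fun p : Σ d, Sp d => logMGF (μ p.1) 1 lam p.2) (whp μ)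
      (𝓝 (F lam))) (hv : ∀ b : ℝ, 0 < b → IsTilt F γ b (v b)) {β P : ℝ} (hβ : 0 < β)
    (hup : ∃ m : ℝ, 0 < m ∧ m ≤ 1 ∧ (α + freeEnergy F γ v (m * β)) / m ≤ P)
    (hlow : ∀ ε : ℝ, 0 < ε → ∃ b : ℝ, 0 < b ∧ tiltRate F γ v b < α ∧
      P - ε ≤ α - tiltRate F γ v b - β * v b ^ γ) :
    Tendsto (fun p : Σ d, Sp d × (Fin (n d) → Sp d) =>
      1 / (p.1 : ℝ) * Real.log (partition γ β p.2.1 p.2.2)) (whp (jointLaw μ n)) (𝓝 P) := by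
  have hγ0 : 0 ≤ γ := by linarith
  refine tendsto_order.2 ⟨fun a ha => ?_, fun a ha => ?_⟩
  · obtain ⟨b, hb, hbα, hbP⟩ := hlow ((P - a) / 3) (by linarith)
    filter_upwards [eventually_le_log_partition hα hn hconv (hv b hb).2.1 (hv b hb).2.2 hbα hγ0
      hβ.le (show 0 < (P - a) / 3 by linarith),
      tendsto_fst_whp.eventually (eventually_ge_atTop 1)] with p hp hd
    have hd0 : (0 : ℝ) < p.1 := by exact_mod_cast hd
    rw [one_div, ← div_eq_inv_mul, lt_div_iff₀ hd0]
    refine lt_of_lt_of_le ?_ hp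
    rw [mul_comm]
    refine mul_lt_mul_of_pos_left ?_ hd0
    rw [tiltRate] at hbP
    have : b * γ * v b ^ (γ - 1) = tiltSlope γ v b := rfl
    rw [this]
    linarith
  · obtain ⟨m, hm, hm1, hmP⟩ := hup
    have hmβ : 0 < m * β := by positivity
    filter_upwards [eventually_log_partition_le hα hn hγ0 hβ.le hm hm1
      (tendsto_logMGF_freeEnergy hconv hγ hmβ.le (hv _ hmβ)) (show 0 < (a - P) / 2 by linarith),
      tendsto_fst_whp.eventually (eventually_ge_atTop 1)] with p hp hd
    have hd0 : (0 : ℝ) < p.1 := by exact_mod_cast hd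
    rw [one_div, ← div_eq_inv_mul, div_lt_iff₀ hd0, mul_comm]
    refine lt_of_le_of_lt hp (mul_lt_mul_of_pos_left ?_ hd0)
    linarith

/-- Unfrozen phase: m = 1 above and b = β below give the annealed value. -/
lemma tendsto_log_partition_of_lt (hγ : 1 ≤ γ) (hα : 0 < α)
    (hn : Tendsto (fun d : ℕ => Real.log (n d) / (d : ℝ)) atTop (𝓝 α))
    (hconv : ∀ lam : ℝ, 0 < lam → Tendsto (fun p : Σ d, Sp d => logMGF (μ p.1) 1 lam p.2) (whp μ)
      (𝓝 (F lam))) (hv : ∀ b : ℝ, 0 < b → IsTilt F γ b (v b)) {β : ℝ} (hβ : 0 < β)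
    (hβα : tiltRate F γ v β < α) :
    Tendsto (fun p : Σ d, Sp d × (Fin (n d) → Sp d) =>
      1 / (p.1 : ℝ) * Real.log (partition γ β p.2.1 p.2.2)) (whp (jointLaw μ n))
      (𝓝 (α + freeEnergy F γ v β)) := by
  refine tendsto_log_partition hγ hα hn hconv hv hβ ⟨1, one_pos, le_rfl, by simp⟩
    fun ε hε => ⟨β, hβ, hβα, ?_⟩
  rw [freeEnergy_eq hγ (hv β hβ).1]
  linarith

/-- Frozen phase: the points nearest to x, at u ≈ v(b₀), dominate. The choice m = b₀/β turns the
upper bound into exactly -β v(b₀)^γ. -/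
lemma tendsto_log_partition_of_le (hF : IsLimitLogMGF F C) (hγ : 1 ≤ γ) (hα : 0 < α)
    (hn : Tendsto (fun d : ℕ => Real.log (n d) / (d : ℝ)) atTop (𝓝 α))
    (hconv : ∀ lam : ℝ, 0 < lam → Tendsto (fun p : Σ d, Sp d => logMGF (μ p.1) 1 lam p.2) (whp μ)
      (𝓝 (F lam))) (hv : ∀ b : ℝ, 0 < b → IsTilt F γ b (v b))
    (hG : StrictConvexOn ℝ (Ioi 0) (freeEnergy F γ v)) {β b₀ : ℝ} (hb₀ : 0 < b₀)
    (hb₀β : b₀ ≤ β) (hb₀α : tiltRate F γ v b₀ = α) :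
    Tendsto (fun p : Σ d, Sp d × (Fin (n d) → Sp d) =>
      1 / (p.1 : ℝ) * Real.log (partition γ β p.2.1 p.2.2)) (whp (jointLaw μ n))
      (𝓝 (-(β * v b₀ ^ γ))) := by
  have hβ : 0 < β := hb₀.trans_le hb₀β
  refine tendsto_log_partition hγ hα hn hconv hv hβ
    ⟨b₀ / β, by positivity, (div_le_one hβ).2 hb₀β, ?_⟩ fun ε hε => ?_
  · rw [div_mul_cancel₀ _ hβ.ne', freeEnergy_eq hγ (hv b₀ hb₀).1, hb₀α]
    refine le_of_eq ?_
    field_simp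
    ring
  · have h1 : ContinuousAt (fun b => α - tiltRate F γ v b - β * v b ^ γ) b₀ := by
      have k1 := (continuousOn_tiltRate hF hγ hv hG).continuousAt (Ioi_mem_nhds hb₀)
      have k2 := (continuousOn_tilt hF hγ hv hG).continuousAt (Ioi_mem_nhds hb₀)
      exact (continuousAt_const.sub k1).sub (continuousAt_const.mul
        (k2.rpow_const (Or.inr (by linarith))))
    -- At b₀ itself the expected number of points in the window is only subexponential, so the lower
    -- bound is taken at b slightly below b₀ and passed to the limit by continuity.
    have h2 : ∀ᶠ b in 𝓝[<] b₀, -(β * v b₀ ^ γ) - ε < α - tiltRate F γ v b - β * v b ^ γ := by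
      refine (h1.tendsto.mono_left nhdsWithin_le_nhds).eventually_const_lt ?_
      rw [hb₀α]; linarith
    have h3 : ∀ᶠ b in 𝓝[<] b₀, b ∈ Ioi (0 : ℝ) := mem_nhdsWithin_of_mem_nhds (Ioi_mem_nhds hb₀)
    obtain ⟨b, hb1, hb2, hb3⟩ := (h2.and (h3.and self_mem_nhdsWithin)).exists
    have hb2' : (0 : ℝ) < b := hb2
    exact ⟨b, hb2', hb₀α ▸ strictMonoOn_tiltRate hF hγ hv hG hb2 hb₀ hb3, hb1.le⟩

end freeEntropy

/-! ### The rate function -/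

section rate

variable {ρ : (d : ℕ) → Sp d → ℝ} {γ α C : ℝ} {v : ℝ → ℝ}

lemma le_rate (hγ : 1 ≤ γ) (hpure : IsPure ρ) (hmoment : UnifIntMoment ρ γ) {lam : ℝ}
    (hlam : 0 < lam) (u : ℝ) : ((-(lam * u) - limitMGF ρ lam : ℝ) : EReal) ≤ rate ρ 1 u := by
  obtain ⟨C, hC⟩ := exists_limitMGF_bound hγ hpure hmoment
  refine le_trans (le_of_eq ?_)
    (le_iSup (fun lam : ℝ => -(((lam * u : ℝ) : EReal) + fbar ρ 1 lam)) lam)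
  rw [(hC lam hlam).1, ← EReal.coe_add, ← EReal.coe_neg]
  congr 1
  ring

lemma rate_nonneg (hpure : IsPure ρ) (u : ℝ) : 0 ≤ rate ρ 1 u := by
  refine le_trans (le_of_eq ?_)
    (le_iSup (fun lam : ℝ => -(((lam * u : ℝ) : EReal) + fbar ρ 1 lam)) 0)
  simp [fbar_zero hpure]

/-- The supremum defining the rate runs over all real parameters, but purity speaks of positive ones
only. At -l the reverse Jensen bound gives a value at most -(l/λ) S(b) ≤ 0, and at 0 the value is 0;
so the positive slope λ attains the supremum. -/
lemma rate_tilt (hγ : 1 ≤ γ) (hpure : IsPure ρ) (hmoment : UnifIntMoment ρ γ)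
    (hF : IsLimitLogMGF (limitMGF ρ) C) {b : ℝ} (hv : IsTilt (limitMGF ρ) γ b (v b)) :
    rate ρ 1 (v b) = (tiltRate (limitMGF ρ) γ v b : EReal) := by
  obtain ⟨C', hC⟩ := exists_limitMGF_bound hγ hpure hmoment
  have hS := tiltRate_nonneg hF hv
  refine le_antisymm (iSup_le fun lam => ?_) (le_rate hγ hpure hmoment hv.2.1 (v b))
  rcases lt_trichotomy lam 0 with h | rfl | h
  · obtain ⟨l, hl, rfl⟩ : ∃ l : ℝ, 0 < l ∧ lam = -l := ⟨-lam, by linarith, by ring⟩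
    have h1 := le_fbar_neg hγ hpure hmoment hv.2.1 hl
    have hs : 0 < tiltSlope γ v b := hv.2.1
    change ((-(l / tiltSlope γ v b) * limitMGF ρ (tiltSlope γ v b) : ℝ) : EReal) ≤ _ at h1
    refine le_trans (EReal.neg_le_neg_iff.2 (add_le_add_right h1 _)) ?_
    rw [← EReal.coe_add, ← EReal.coe_neg, EReal.coe_le_coe_iff]
    have e : -(-l * v b + -(l / tiltSlope γ v b) * limitMGF ρ (tiltSlope γ v b))
        = -(l / tiltSlope γ v b * tiltRate (limitMGF ρ) γ v b) := by
      rw [tiltRate]; field_simp; ring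
    rw [e]
    have : 0 ≤ l / tiltSlope γ v b * tiltRate (limitMGF ρ) γ v b := by positivity
    linarith
  · simpa [fbar_zero hpure] using hS
  · rw [(hC lam h).1, ← EReal.coe_add, ← EReal.coe_neg, EReal.coe_le_coe_iff]
    have := le_tiltRate hF hv h
    linarith

lemma rateReal_tilt (hγ : 1 ≤ γ) (hpure : IsPure ρ) (hmoment : UnifIntMoment ρ γ)
    (hF : IsLimitLogMGF (limitMGF ρ) C) {b : ℝ} (hv : IsTilt (limitMGF ρ) γ b (v b)) :
    rateReal ρ 1 (v b) = tiltRate (limitMGF ρ) γ v b := by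
  rw [rateReal, rate_tilt hγ hpure hmoment hF hv, EReal.toReal_coe]

/-- A supremum of affine functions of u, for extended-real `fbar`: the value -∞ is excluded by
finiteness of the rate, and +∞ contributes nothing. -/
lemma rate_convex {u₁ u₂ J₁ J₂ a b : ℝ} (h₁ : rate ρ 1 u₁ = (J₁ : EReal))
    (h₂ : rate ρ 1 u₂ = (J₂ : EReal)) (ha : 0 ≤ a) (hb : 0 ≤ b) (hab : a + b = 1) :
    rate ρ 1 (a * u₁ + b * u₂) ≤ ((a * J₁ + b * J₂ : ℝ) : EReal) := by
  refine iSup_le fun lam => ?_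
  have k1 : -(((lam * u₁ : ℝ) : EReal) + fbar ρ 1 lam) ≤ (J₁ : EReal) :=
    h₁ ▸ le_iSup (fun lam : ℝ => -(((lam * u₁ : ℝ) : EReal) + fbar ρ 1 lam)) lam
  have k2 : -(((lam * u₂ : ℝ) : EReal) + fbar ρ 1 lam) ≤ (J₂ : EReal) :=
    h₂ ▸ le_iSup (fun lam : ℝ => -(((lam * u₂ : ℝ) : EReal) + fbar ρ 1 lam)) lam
  revert k1 k2
  induction fbar ρ 1 lam with
  | bot => intro k1; simp at k1
  | top =>
    intro _ _
    rw [EReal.coe_add_top, EReal.neg_top]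
    exact bot_le
  | coe f =>
    intro k1 k2
    rw [← EReal.coe_add, ← EReal.coe_neg, EReal.coe_le_coe_iff] at k1 k2 ⊢
    have k3 := mul_le_mul_of_nonneg_left k1 ha
    have k4 := mul_le_mul_of_nonneg_left k2 hb
    have k5 : f = a * f + b * f := by rw [← add_mul, hab, one_mul]
    linarith

lemma rateReal_le (hpure : IsPure ρ) {u J : ℝ} (h : rate ρ 1 u ≤ (J : EReal)) :
    rateReal ρ 1 u ≤ J :=
  EReal.toReal_le_toReal h (ne_bot_of_le_ne_bot EReal.zero_ne_bot (rate_nonneg hpure u))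
    (EReal.coe_ne_top J)

/-- To the left of a critical point the convex rate function is antitone, so that it cannot
increase there from below `α` to `α`. -/
lemma not_lt_of_hasDerivAt_rate (hpure : IsPure ρ) {w uG utyp Jw : ℝ} (hw : w < uG)
    (hlt : uG < utyp) (hJw : rate ρ 1 w = (Jw : EReal)) (hJG : rate ρ 1 uG = (α : EReal))
    (hJt : rate ρ 1 utyp ≠ ⊤) (hder : HasDerivAt (rateReal ρ 1) 0 utyp) : ¬ Jw < α := by
  intro hJwα
  have hJt' : rate ρ 1 utyp = (rateReal ρ 1 utyp : EReal) :=
    (EReal.coe_toReal hJt (ne_bot_of_le_ne_bot EReal.zero_ne_bot (rate_nonneg hpure utyp))).symm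
  set Jt := rateReal ρ 1 utyp with hJtdef
  have hwt : 0 < utyp - w := by linarith
  have hconv : ∀ u, w ≤ u → u ≤ utyp →
      rate ρ 1 u ≤ ((Jt - (Jt - Jw) / (utyp - w) * (utyp - u) : ℝ) : EReal) := fun u h1 h2 => by
    have h := rate_convex hJw hJt' (a := (utyp - u) / (utyp - w)) (b := (u - w) / (utyp - w))
      (div_nonneg (by linarith) hwt.le) (div_nonneg (by linarith) hwt.le) (by field_simp; ring)
    have e1 : (utyp - u) / (utyp - w) * w + (u - w) / (utyp - w) * utyp = u := by
      field_simp; ring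
    have e2 : (utyp - u) / (utyp - w) * Jw + (u - w) / (utyp - w) * Jt
        = Jt - (Jt - Jw) / (utyp - w) * (utyp - u) := by
      field_simp; ring
    rwa [e1, e2] at h
  -- The chord from w to utyp lies above J at uG. A nonpositive slope would give α = J(uG) ≤ Jw.
  have hκ : 0 < (Jt - Jw) / (utyp - w) := by
    have h := hconv uG hw.le hlt.le
    rw [hJG, EReal.coe_le_coe_iff] at h
    by_contra! hcon
    have h1 : Jt - Jw ≤ 0 := by
      by_contra! h2
      exact absurd (div_pos h2 hwt) (not_lt.2 hcon)
    have h2 : -((Jt - Jw) / (utyp - w) * (utyp - uG)) ≤ -(Jt - Jw) := by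
      have h3 : (utyp - uG) / (utyp - w) ≤ 1 := by rw [div_le_one hwt]; linarith
      have h4 : (Jt - Jw) / (utyp - w) * (utyp - uG)
          = (Jt - Jw) * ((utyp - uG) / (utyp - w)) := by ring
      rw [h4]
      nlinarith
    linarith
  set κ := (Jt - Jw) / (utyp - w) with hκdef
  rw [hasDerivAt_iff_isLittleO, Asymptotics.isLittleO_iff] at hder
  -- Left of utyp the chord forces J down by at least κ (utyp - u), while the vanishing derivative
  -- allows at most half of that.
  have h1 : ∀ᶠ u in 𝓝[<] utyp, ‖rateReal ρ 1 u - rateReal ρ 1 utyp - (u - utyp) • (0 : ℝ)‖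
      ≤ κ / 2 * ‖u - utyp‖ := mem_nhdsWithin_of_mem_nhds (hder (show 0 < κ / 2 by positivity))
  have h2 : ∀ᶠ u in 𝓝[<] utyp, u ∈ Ioi w :=
    mem_nhdsWithin_of_mem_nhds (Ioi_mem_nhds (by linarith))
  obtain ⟨u, hu1, hu2, hu3⟩ := (h1.and (h2.and self_mem_nhdsWithin)).exists
  have hu3' : u < utyp := hu3
  have hu2' : w < u := hu2
  have h4 := rateReal_le hpure (hconv u hu2'.le hu3'.le)
  have h5 : 0 < κ * (utyp - u) := mul_pos hκ (by linarith)
  have h6 : rateReal ρ 1 u - Jt < 0 := by linarith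
  have h7 : u - utyp < 0 := by linarith
  rw [smul_zero, sub_zero, ← hJtdef, Real.norm_eq_abs, Real.norm_eq_abs, abs_of_neg h6,
    abs_of_neg h7] at hu1
  linarith

/-- Under the hypotheses on the optimal bandwidth, the radius `uG` is the tilted mean at the
freezing temperature, and all the tilted means lie below `utyp`. -/
lemma exists_tilt_eq (hγ : 1 ≤ γ) (hα : 0 < α) (hpure : IsPure ρ) (hmoment : UnifIntMoment ρ γ)
    (hF : IsLimitLogMGF (limitMGF ρ) C) (hv : ∀ b : ℝ, 0 < b → IsTilt (limitMGF ρ) γ b (v b))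
    (hG : StrictConvexOn ℝ (Ioi 0) (freeEnergy (limitMGF ρ) γ v)) {uG utyp : ℝ} (huG : 0 < uG)
    (hlt : uG < utyp) (hJG : rate ρ 1 uG = (α : EReal)) (hJt : rate ρ 1 utyp ≠ ⊤)
    (hder : HasDerivAt (rateReal ρ 1) 0 utyp)
    (hcond : ∀ u ∈ Ico uG utyp, -1 < 2 * deriv (rateReal ρ 1) u * u) :
    ∃ b, 0 < b ∧ v b = uG ∧ tiltRate (limitMGF ρ) γ v b = α ∧ ∀ b', 0 < b' → v b' < utyp := by
  have hanti := strictAntiOn_tilt hF hγ hv hG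
  have hvcont := continuousOn_tilt hF hγ hv hG
  have hJd : ∀ b, 0 < b → HasDerivAt (rateReal ρ 1) (-tiltSlope γ v b) (v b) := fun b hb =>
    hasDerivAt_of_eq_tiltRate hF hγ hv hG
      (fun b' hb' => rateReal_tilt hγ hpure hmoment hF (hv b' hb')) hb
  have hivt : ∀ b₁ b₂ u, 0 < b₁ → 0 < b₂ → u ≤ v b₁ → v b₂ ≤ u → ∃ b, 0 < b ∧ v b = u := by
    intro b₁ b₂ u h1 h2 h3 h4
    have h12 : b₁ ≤ b₂ := by
      by_contra! hcon
      have := hanti h2 h1 hcon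
      linarith
    obtain ⟨b, hb, hbu⟩ := intermediate_value_Icc' h12
      (hvcont.mono fun x hx => h1.trans_le hx.1) ⟨h4, h3⟩
    exact ⟨b, h1.trans_le hb.1, hbu⟩
  -- Some tilted mean lies at or above uG: otherwise, for b small, J would be below α at v(b) < uG
  -- and would have to increase up to uG.
  obtain ⟨bA, hbA, hA⟩ : ∃ b, 0 < b ∧ uG ≤ v b := by
    by_contra! hcon
    set M := C * γ * C ^ (γ - 1) with hM
    have hM0 : 0 ≤ M := by have := hF.nonneg; positivity
    have hb : 0 < α / (2 * (M + 1)) := by positivity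
    have h1 := tiltRate_le hF hγ hb (hv _ hb)
    refine not_lt_of_hasDerivAt_rate hpure (hcon _ hb) hlt
      (rate_tilt hγ hpure hmoment hF (hv _ hb)) hJG hJt hder (h1.trans_lt ?_)
    rw [← hM, div_mul_eq_mul_div, div_lt_iff₀ (by positivity)]
    nlinarith
  -- Some tilted mean lies at or below uG: otherwise the slope at v(b) would be arbitrarily large.
  -- The three terms of b are chosen to violate J(uG) = α if v(b) ≥ utyp, to violate the condition
  -- on 2uJ' if v(b) lies in between, and to make the inequalities strict.
  obtain ⟨bB, hbB, hB⟩ : ∃ b, 0 < b ∧ v b ≤ uG := by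
    by_contra! hcon
    set κ := γ * uG ^ (γ - 1) with hκ
    have hκ0 : 0 < κ := by positivity
    have hut : 0 < utyp - uG := by linarith
    set b := (α / (utyp - uG) + 1 / (2 * uG) + 1) / κ with hb
    have hb0 : 0 < b := by positivity
    have h1 : b * κ ≤ tiltSlope γ v b := by
      rw [tiltSlope, hκ, ← mul_assoc]
      have := Real.rpow_le_rpow huG.le (hcon b hb0).le (by linarith : 0 ≤ γ - 1)
      gcongr
    have h2 : b * κ = α / (utyp - uG) + 1 / (2 * uG) + 1 := by rw [hb]; field_simp
    have h3 : 0 < α / (utyp - uG) := by positivity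
    have h4 : 0 < 1 / (2 * uG) := by positivity
    have h5 : v b < utyp := by
      by_contra! hcon2
      have h6 := le_rate hγ hpure hmoment (hv b hb0).2.1 uG
      rw [hJG, EReal.coe_le_coe_iff] at h6
      have h7 := tiltRate_nonneg hF (hv b hb0)
      rw [tiltRate] at h7
      have e : b * γ * v b ^ (γ - 1) = tiltSlope γ v b := rfl
      rw [e] at h6
      have h8 : α / (utyp - uG) * (utyp - uG) < tiltSlope γ v b * (v b - uG) := by
        refine mul_lt_mul (by linarith) (by linarith) hut (by linarith)
      rw [div_mul_cancel₀ _ hut.ne'] at h8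
      linarith
    have h6 := hcond (v b) ⟨(hcon b hb0).le, h5⟩
    rw [(hJd b hb0).deriv] at h6
    have h7 : 1 / (2 * uG) * uG ≤ tiltSlope γ v b * v b :=
      mul_le_mul (by linarith) (hcon b hb0).le huG.le (by linarith)
    have h8 : 1 / (2 * uG) * uG = 1 / 2 := by field_simp
    linarith
  obtain ⟨b, hb, hbu⟩ := hivt bA bB uG hbA hbB hA hB
  refine ⟨b, hb, hbu, ?_, fun b' hb' => ?_⟩
  · have h1 := rate_tilt hγ hpure hmoment hF (hv b hb)
    rw [hbu, hJG] at h1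
    exact (EReal.coe_eq_coe_iff.1 h1).symm
  -- A tilted mean at or above utyp would make utyp itself a tilted mean, where J' is minus a
  -- positive slope and not 0.
  · by_contra! hcon
    obtain ⟨b₁, hb₁, hb₁u⟩ := hivt b' b utyp hb' hb hcon (by linarith)
    have h1 := hJd b₁ hb₁
    rw [hb₁u] at h1
    have h2 := h1.unique hder
    have h3 : 0 < tiltSlope γ v b₁ := (hv b₁ hb₁).2.1
    linarith

end rate

/-! ### The optimal bandwidth -/

/-- Turns the term -log h of the free entropy into (1/(2γ)) log β plus a constant, so that the
optimization runs over β. -/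
lemma log_eq_invTemp {γ h : ℝ} (hγ : 1 ≤ γ) (hh : 0 < h) :
    Real.log h = -(1 / (2 * γ) * Real.log (2 * γ)) - 1 / (2 * γ) * Real.log (invTemp γ h) := by
  have hγ0 : 0 < γ := by linarith
  have e : Real.log (invTemp γ h) = -Real.log (2 * γ) - γ * (2 * Real.log h) := by
    rw [invTemp, Real.log_mul (by positivity) (by positivity), Real.log_rpow (by positivity),
      Real.log_pow, one_div, Real.log_inv]
    push_cast
    ring
  rw [e]
  field_simp
  ring

lemma hasDerivAt_invTemp {γ h : ℝ} (hh : 0 < h) :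
    HasDerivAt (invTemp γ) (-(2 * γ * invTemp γ h / h)) h := by
  have h1 : HasDerivAt (fun h : ℝ => h ^ 2) (2 * h) h := by
    simpa using hasDerivAt_pow 2 h
  have h2 := (h1.rpow_const (p := -γ) (Or.inl (by positivity))).const_mul (1 / (2 * γ))
  refine h2.congr_deriv ?_
  rw [invTemp, Real.rpow_sub_one (by positivity)]
  field_simp

/-- The free energy of the random energy model with freezing temperature `b₀`. -/
def remEnergy (F : ℝ → ℝ) (γ : ℝ) (v : ℝ → ℝ) (α b₀ β : ℝ) : ℝ :=
  if β < b₀ then α + freeEnergy F γ v β else -(β * v b₀ ^ γ)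

/-- On the unfrozen side the derivative 1/(2γβ) - v(β)^γ is positive by the slope condition. On the
frozen side the function is linear plus a logarithm, with its critical point at β₁, which the slope
condition at b₀ places beyond b₀. The two branches agree at b₀. -/
lemma remEnergy_add_log_lt {F : ℝ → ℝ} {C γ α : ℝ} {v : ℝ → ℝ} (hF : IsLimitLogMGF F C)
    (hγ : 1 ≤ γ) (hv : ∀ b : ℝ, 0 < b → IsTilt F γ b (v b))
    {b₀ : ℝ} (hb₀ : 0 < b₀) (hv₀ : 0 < v b₀) (hb₀α : tiltRate F γ v b₀ = α)
    (hcond : ∀ b, 0 < b → b ≤ b₀ → 2 * γ * b * v b ^ γ < 1) {β₁ β : ℝ}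
    (hβ₁ : β₁ * (2 * γ * v b₀ ^ γ) = 1) (hβ : 0 < β) (hne : β ≠ β₁) :
    remEnergy F γ v α b₀ β + 1 / (2 * γ) * Real.log β
      < remEnergy F γ v α b₀ β₁ + 1 / (2 * γ) * Real.log β₁ := by
  have hγ0 : 0 < γ := by linarith
  set a := v b₀ ^ γ with ha
  have ha0 : 0 < a := by positivity
  have hβ₁0 : 0 < β₁ := by
    by_contra! hcon
    have : β₁ * (2 * γ * a) ≤ 0 := mul_nonpos_of_nonpos_of_nonneg hcon (by positivity)
    linarith
  have hlt : b₀ < β₁ := by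
    have h1 := hcond b₀ hb₀ le_rfl
    by_contra! hcon
    have : β₁ * (2 * γ * a) ≤ b₀ * (2 * γ * a) := by gcongr
    linarith
  -- The strict inequality log t < t - 1 at t = b/β₁.
  have hfrozen : ∀ b, 0 < b → b ≠ β₁ → -(b * a) + 1 / (2 * γ) * Real.log b
      < -(β₁ * a) + 1 / (2 * γ) * Real.log β₁ := fun b hb hb1 => by
    have h1 := Real.log_lt_sub_one_of_pos (show 0 < b / β₁ by positivity)
      (fun h => hb1 ((div_eq_one_iff_eq hβ₁0.ne').1 h))
    rw [Real.log_div hb.ne' hβ₁0.ne'] at h1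
    have h2 := mul_lt_mul_of_pos_left h1 (show 0 < 1 / (2 * γ) by positivity)
    have h3 : β₁⁻¹ = 2 * γ * a := by
      rw [inv_eq_iff_eq_inv]
      exact eq_inv_of_mul_eq_one_left hβ₁
    have h4 : 1 / (2 * γ) * (b / β₁ - 1) = b * a - 1 / (2 * γ) := by
      rw [div_eq_mul_inv b, h3]; field_simp
    have h5 : β₁ * a = 1 / (2 * γ) := by
      rw [eq_div_iff (by positivity)]; linarith
    rw [h4] at h2
    linarith
  have e1 : remEnergy F γ v α b₀ β₁ = -(β₁ * a) := if_neg (not_lt.2 hlt.le)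
  rw [e1]
  rcases lt_or_ge β b₀ with h | h
  · have e2 : remEnergy F γ v α b₀ β = α + freeEnergy F γ v β := if_pos h
    rw [e2]
    refine lt_trans ?_ (hfrozen b₀ hb₀ hlt.ne)
    have e3 : -(b₀ * a) = α + freeEnergy F γ v b₀ := by
      rw [freeEnergy_eq hγ (hv b₀ hb₀).1, hb₀α]; ring
    rw [e3]
    have hderiv : ∀ b, 0 < b → HasDerivAt (fun b => α + freeEnergy F γ v b
        + 1 / (2 * γ) * Real.log b) (-v b ^ γ + 1 / (2 * γ) * b⁻¹) b := fun b hb =>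
      ((hasDerivAt_freeEnergy hF hγ hv hb).const_add α).add
        ((Real.hasDerivAt_log hb.ne').const_mul (1 / (2 * γ)))
    have hmono : StrictMonoOn (fun b => α + freeEnergy F γ v b + 1 / (2 * γ) * Real.log b)
        (Icc β b₀) := by
      refine strictMonoOn_of_deriv_pos (convex_Icc _ _)
        (fun b hb => (hderiv b (hβ.trans_le hb.1)).continuousAt.continuousWithinAt) fun b hb => ?_
      rw [interior_Icc] at hb
      have hb0 : 0 < b := hβ.trans hb.1
      rw [(hderiv b hb0).deriv]
      have h1 := hcond b hb0 hb.2.le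
      have h2 : 1 / (2 * γ) * b⁻¹ - v b ^ γ = (1 - 2 * γ * b * v b ^ γ) / (2 * γ * b) := by
        field_simp
      have h3 : 0 < (1 - 2 * γ * b * v b ^ γ) / (2 * γ * b) :=
        div_pos (by linarith) (by positivity)
      linarith
    exact hmono (left_mem_Icc.2 h.le) (right_mem_Icc.2 h.le) h
  · have e2 : remEnergy F γ v α b₀ β = -(β * a) := if_neg (not_lt.2 h)
    rw [e2]
    exact hfrozen β hβ hne

/-! ### Derivatives of the replica free entropy -/

section phi

variable {ρ : (d : ℕ) → Sp d → ℝ} {F : ℝ → ℝ} {γ α c C : ℝ} {v : ℝ → ℝ}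

lemma phi_eq {h m : ℝ} (hm : 0 < m)
    (hgbar : gbar ρ γ h m = m * c + freeEnergy F γ v (m * invTemp γ h) - m * Real.log h) :
    phi ρ γ α h m = c - α - Real.log h + (α + freeEnergy F γ v (m * invTemp γ h)) / m := by
  rw [phi, hgbar]
  field_simp
  ring

/-- The sign is that of S(mβ) - α: at m = 1 this identifies D with S(β) - α, and a critical m is one
for which mβ is the freezing point. -/
lemma hasDerivAt_phi (hF : IsLimitLogMGF F C) (hγ : 1 ≤ γ)
    (hv : ∀ b : ℝ, 0 < b → IsTilt F γ b (v b)) {h m : ℝ} (hh : 0 < h) (hm : 0 < m)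
    (hgbar : ∀ m : ℝ, 0 < m → gbar ρ γ h m
      = m * c + freeEnergy F γ v (m * invTemp γ h) - m * Real.log h) :
    HasDerivAt (fun m => phi ρ γ α h m) ((tiltRate F γ v (m * invTemp γ h) - α) / m ^ 2) m := by
  have hβ := invTemp_pos hγ hh
  set β := invTemp γ h with hβdef
  have hmβ : 0 < m * β := by positivity
  have h1 : HasDerivAt (fun m => freeEnergy F γ v (m * β)) (-v (m * β) ^ γ * β) m := by
    have h0 : HasDerivAt (fun m => m * β) β m := by
      simpa using (hasDerivAt_id m).mul_const β
    exact HasDerivAt.comp (h₂ := freeEnergy F γ v) m (hasDerivAt_freeEnergy hF hγ hv hmβ) h0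
  have h2 := (((h1.const_add α).div (hasDerivAt_id m) hm.ne').const_add (c - α - Real.log h))
  refine (h2.congr_of_eventuallyEq ?_).congr_deriv ?_
  · filter_upwards [Ioi_mem_nhds hm] with x hx
    exact phi_eq hx (hgbar x hx)
  · rw [tiltRate_eq hγ (hv _ hmβ).1]
    simp only [id_eq]
    congr 1
    ring

/-- The derivative of `h ↦ φ` with the Boltzmann factor frozen. -/
lemma hasDerivAt_frozen {a h : ℝ} (hh : 0 < h) (ha : invTemp γ h * (2 * γ * a) = 1) (k : ℝ) :
    HasDerivAt (fun h => k - Real.log h - invTemp γ h * a) 0 h := by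
  have h1 := ((Real.hasDerivAt_log hh.ne').const_sub k).sub
    ((hasDerivAt_invTemp (γ := γ) hh).mul_const a)
  refine h1.congr_deriv ?_
  have : -h⁻¹ - -(2 * γ * invTemp γ h / h) * a = (invTemp γ h * (2 * γ * a) - 1) / h := by
    field_simp
    ring
  rw [this, ha, sub_self, zero_div]

end phi

/-! ### Divergence and free entropy at the freezing point -/

section phases

variable {ρ : (d : ℕ) → Sp d → ℝ} {F : ℝ → ℝ} {γ α c C : ℝ} {n : ℕ → ℕ} {v : ℝ → ℝ}

/-- The asymptotics of the divergence when the random energy model freezes at `b₀`. -/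
lemma kLAsymptotics_remEnergy (hγ : 1 ≤ γ) (hα : 0 < α)
    (hn : Tendsto (fun d : ℕ => Real.log (n d) / (d : ℝ)) atTop (𝓝 α)) (hpure : IsPure ρ)
    (hentropy : ∀ d, Integrable fun x => ρ d x * Real.log (ρ d x))
    (hmoment : UnifIntMoment ρ γ) (hc : Tendsto (kernelConst γ) atTop (𝓝 c))
    (hF : IsLimitLogMGF (limitMGF ρ) C)
    (hv : ∀ b : ℝ, 0 < b → IsTilt (limitMGF ρ) γ b (v b))
    (hG : StrictConvexOn ℝ (Ioi 0) (freeEnergy (limitMGF ρ) γ v)) {b₀ : ℝ} (hb₀ : 0 < b₀)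
    (hb₀α : tiltRate (limitMGF ρ) γ v b₀ = α) {h : ℝ} (hh : 0 < h) :
    KLAsymptotics ρ n γ h
      (-(c - α - Real.log h + remEnergy (limitMGF ρ) γ v α b₀ (invTemp γ h))) := by
  have hprob := hpure.isProbability
  have hβ := invTemp_pos hγ hh
  have hconv := fun (lam : ℝ) (hlam : 0 < lam) => tendsto_logMGF_one hγ hpure hmoment hlam
  refine kLAsymptotics_of_tendsto hγ hα hn hpure hentropy hmoment hc hh ?_
  rw [remEnergy]
  split_ifs with hlt
  · exact tendsto_log_partition_of_lt hγ hα hn hconv hv hβ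
      (hb₀α ▸ strictMonoOn_tiltRate hF hγ hv hG hβ hb₀ hlt)
  · exact tendsto_log_partition_of_le hF hγ hα hn hconv hv hG hb₀ (not_lt.1 hlt) hb₀α

/-- Since α + G(b₀) = -b₀ v(b₀)^γ, the free entropy at m = b₀/β is exactly the frozen free energy.
-/
lemma phi_freezing {h b₀ : ℝ} (hγ : 1 ≤ γ) (hh : 0 < h) (hb₀ : 0 < b₀)
    (hv₀ : IsTilt F γ b₀ (v b₀)) (hb₀α : tiltRate F γ v b₀ = α)
    (hgbar : ∀ m : ℝ, 0 < m → gbar ρ γ h m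
      = m * c + freeEnergy F γ v (m * invTemp γ h) - m * Real.log h) :
    phi ρ γ α h (b₀ / invTemp γ h) = c - α - Real.log h - invTemp γ h * v b₀ ^ γ := by
  have hβ := invTemp_pos hγ hh
  have hm : 0 < b₀ / invTemp γ h := by positivity
  rw [phi_eq hm (hgbar _ hm), div_mul_cancel₀ _ hβ.ne', freeEnergy_eq hγ hv₀.1, hb₀α]
  field_simp
  ring

/-- Here m keeps its value while the bandwidth moves. Since G' = -v^γ, the derivative is the same as
along m*(h), as expected at a critical point in m. -/
lemma hasDerivAt_phi_bandwidth (hF : IsLimitLogMGF F C) (hγ : 1 ≤ γ)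
    (hv : ∀ b : ℝ, 0 < b → IsTilt F γ b (v b)) {h b₀ : ℝ} (hh : 0 < h) (hb₀ : 0 < b₀)
    (hopt : invTemp γ h * (2 * γ * v b₀ ^ γ) = 1)
    (hgbar : ∀ h m : ℝ, 0 < h → 0 < m → gbar ρ γ h m
      = m * c + freeEnergy F γ v (m * invTemp γ h) - m * Real.log h) :
    HasDerivAt (fun h' => phi ρ γ α h' (b₀ / invTemp γ h)) 0 h := by
  have hβ := invTemp_pos hγ hh
  set m := b₀ / invTemp γ h with hmdef
  have hm : 0 < m := by positivity
  have hmb : m * invTemp γ h = b₀ := div_mul_cancel₀ _ hβ.ne'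
  have h1 : HasDerivAt (fun h' => freeEnergy F γ v (m * invTemp γ h'))
      (-v b₀ ^ γ * (m * -(2 * γ * invTemp γ h / h))) h :=
    HasDerivAt.comp (h₂ := freeEnergy F γ v) h
      (hmb.symm ▸ hasDerivAt_freeEnergy hF hγ hv hb₀) ((hasDerivAt_invTemp hh).const_mul m)
  have h2 := ((Real.hasDerivAt_log hh.ne').const_sub (c - α)).add ((h1.const_add α).div_const m)
  refine (h2.congr_of_eventuallyEq ?_).congr_deriv ?_
  · filter_upwards [Ioi_mem_nhds hh] with x hx
    exact phi_eq hm (hgbar x m hx hm)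
  · have e : -h⁻¹ + -v b₀ ^ γ * (m * -(2 * γ * invTemp γ h / h)) / m
        = (invTemp γ h * (2 * γ * v b₀ ^ γ) - 1) / h := by
      field_simp
      ring
    rw [e, hopt, sub_self, zero_div]

end phases

end

end KDE

/-! ### The phases and the optimal bandwidth -/

theorem corollary7 (ρ : (d : ℕ) → KDE.Sp d → ℝ) (γ α : ℝ) (n : ℕ → ℕ)
    (hγ : 1 ≤ γ) (hα : 0 < α)
    (hn : Tendsto (fun d : ℕ => Real.log (n d) / (d : ℝ)) atTop (𝓝 α))
    (hpure : KDE.IsPure ρ)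
    (hentropy : ∀ d, Integrable fun x => ρ d x * Real.log (ρ d x))
    (hmoment : KDE.UnifIntMoment ρ γ)
    (hfbar : ∀ lam : ℝ, 0 < lam →
      DifferentiableAt ℝ (fun s : ℝ => (KDE.fbar ρ 1 s).toReal) lam)
    (hconvex : ∀ h : ℝ, 0 < h → StrictConvexOn ℝ (Ioi 0) fun m => KDE.gbar ρ γ h m) :
    -- the replica free entropy is well defined
    (∀ h m : ℝ, 0 < h → 0 < m →
      (∀ᶠ d : ℕ in atTop,
        Integrable (KDE.logMoment γ (ρ d) h m) (KDE.law (ρ d))) ∧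
      Tendsto (fun d : ℕ => KDE.meanLogMoment γ (ρ d) h m) atTop (𝓝 (KDE.gbar ρ γ h m))) ∧
    -- the replica symmetric phase
    (∀ h : ℝ, 0 < h → KDE.glassD ρ γ α h < 0 →
      KDE.KLAsymptotics ρ n γ h (-KDE.phi ρ γ α h 1)) ∧
    ∃ mstar : ℝ → ℝ,
      -- the 1RSB phase
      (∀ h : ℝ, 0 < h → 0 < KDE.glassD ρ γ α h →
        mstar h ∈ Ioo (0 : ℝ) 1 ∧
        (∀ m ∈ Ioo (0 : ℝ) 1,
          HasDerivAt (fun m' => KDE.phi ρ γ α h m') 0 m ↔ m = mstar h) ∧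
        KDE.KLAsymptotics ρ n γ h (-KDE.phi ρ γ α h (mstar h))) ∧
      -- the optimal bandwidth
      (∀ uG utyp : ℝ, 0 < uG → uG < utyp →
        KDE.rate ρ 1 uG = (α : EReal) →
        KDE.rate ρ 1 utyp ≠ ⊤ → HasDerivAt (KDE.rateReal ρ 1) 0 utyp →
        (∀ u ∈ Ico uG utyp, -1 < 2 * deriv (KDE.rateReal ρ 1) u * u) →
        ∃ L : ℝ → ℝ, (∀ h : ℝ, 0 < h → KDE.KLAsymptotics ρ n γ h (L h)) ∧
          ∃ hopt : ℝ, 0 < hopt ∧ (∀ h : ℝ, 0 < h → h ≠ hopt → L hopt < L h) ∧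
            0 < KDE.glassD ρ γ α hopt ∧
            HasDerivAt (fun h => KDE.phi ρ γ α h (mstar hopt)) 0 hopt ∧
            HasDerivAt (fun h => KDE.phi ρ γ α h (mstar h)) 0 hopt) := by
  have hγ0 : 0 < γ := by linarith
  have hprob := hpure.isProbability
  obtain ⟨c, hc⟩ := KDE.exists_tendsto_kernelConst hγ
  obtain ⟨C, hF⟩ := KDE.exists_isLimitLogMGF hγ hpure hmoment hfbar
  have hconv := fun (lam : ℝ) (hlam : 0 < lam) => KDE.tendsto_logMGF_one hγ hpure hmoment hlam
  have hne := KDE.exists_limitMGF_neg hγ hpure hmoment hc (hconvex 1 one_pos)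
  -- The tilted mean is made a total function of b, with an arbitrary value for b ≤ 0.
  have hex : ∀ b : ℝ, ∃ w : ℝ, 0 < b → KDE.IsTilt (KDE.limitMGF ρ) γ b w := fun b => by
    by_cases hb : 0 < b
    · obtain ⟨w, hw⟩ := hF.exists_isTilt hγ hb hne
      exact ⟨w, fun _ => hw⟩
    · exact ⟨0, fun h => absurd h hb⟩
  choose v hv using hex
  set F := KDE.limitMGF ρ
  have hlim : ∀ h m : ℝ, 0 < h → 0 < m →
      (∀ᶠ d : ℕ in atTop, Integrable (KDE.logMoment γ (ρ d) h m) (KDE.law (ρ d))) ∧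
      Tendsto (fun d : ℕ => KDE.meanLogMoment γ (ρ d) h m) atTop
        (𝓝 (m * c + KDE.freeEnergy F γ v (m * KDE.invTemp γ h) - m * Real.log h)) :=
    fun h m hh hm => by
      have hb : 0 < m * KDE.invTemp γ h := mul_pos hm (KDE.invTemp_pos hγ hh)
      exact KDE.tendsto_meanLogMoment hγ hpure hmoment hc hh hm
        (KDE.tendsto_logMGF_freeEnergy hconv hγ hb.le (hv _ hb))
  have hgbar : ∀ h m : ℝ, 0 < h → 0 < m → KDE.gbar ρ γ h m
      = m * c + KDE.freeEnergy F γ v (m * KDE.invTemp γ h) - m * Real.log h :=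
    fun h m hh hm => (hlim h m hh hm).2.limUnder_eq
  have hG : StrictConvexOn ℝ (Ioi 0) (KDE.freeEnergy F γ v) :=
    KDE.strictConvexOn_freeEnergy (c := c) hγ (hconvex 1 one_pos) fun m hm => by
      rw [hgbar 1 m one_pos hm, Real.log_one, mul_zero, sub_zero]
  have hmono := KDE.strictMonoOn_tiltRate hF hγ hv hG
  have hphi : ∀ h m : ℝ, 0 < h → 0 < m → HasDerivAt (fun m => KDE.phi ρ γ α h m)
      ((KDE.tiltRate F γ v (m * KDE.invTemp γ h) - α) / m ^ 2) m := fun h m hh hm =>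
    KDE.hasDerivAt_phi hF hγ hv hh hm fun m hm => hgbar h m hh hm
  have hD : ∀ h : ℝ, 0 < h →
      KDE.glassD ρ γ α h = KDE.tiltRate F γ v (KDE.invTemp γ h) - α := fun h hh => by
    rw [KDE.glassD, (hphi h 1 hh one_pos).deriv, one_mul, one_pow, div_one]
  refine ⟨fun h m hh hm => ?_, fun h hh hD0 => ?_, ?_⟩
  · rw [hgbar h m hh hm]
    exact hlim h m hh hm
  · have hβ := KDE.invTemp_pos hγ hh
    rw [hD h hh] at hD0
    rw [KDE.phi_eq one_pos (hgbar h 1 hh one_pos), one_mul, div_one]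
    exact KDE.kLAsymptotics_of_tendsto hγ hα hn hpure hentropy hmoment hc hh
      (KDE.tendsto_log_partition_of_lt hγ hα hn hconv hv hβ (by linarith))
  -- If S never takes the value α, it stays below α, so there is no 1RSB phase; the hypotheses on uG
  -- also produce a freezing point, hence are void in that case.
  by_cases hfreeze : ∃ b₀, 0 < b₀ ∧ KDE.tiltRate F γ v b₀ = α
  · obtain ⟨b₀, hb₀, hb₀α⟩ := hfreeze
    have hinj : ∀ b, 0 < b → KDE.tiltRate F γ v b = α → b = b₀ := fun b hb hbα =>
      hmono.injOn hb hb₀ (hbα.trans hb₀α.symm)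
    refine ⟨fun h => b₀ / KDE.invTemp γ h, fun h hh hD0 => ?_, ?_⟩
    · have hβ := KDE.invTemp_pos hγ hh
      rw [hD h hh, ← hb₀α, sub_pos, hmono.lt_iff_lt hb₀ hβ] at hD0
      refine ⟨⟨by positivity, (div_lt_one hβ).2 hD0⟩, fun m hm => ?_, ?_⟩
      · have hm0 : 0 < m := hm.1
        rw [eq_div_iff hβ.ne']
        constructor
        · intro h0
          have h1 := (hphi h m hh hm0).unique h0
          rw [div_eq_zero_iff, or_iff_left (by positivity)] at h1
          exact hinj _ (by positivity) (by linarith)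
        · intro h0
          refine (hphi h m hh hm0).congr_deriv ?_
          rw [h0, hb₀α, sub_self, zero_div]
      · rw [KDE.phi_freezing hγ hh hb₀ (hv b₀ hb₀) hb₀α fun m hm => hgbar h m hh hm, sub_eq_add_neg]
        exact KDE.kLAsymptotics_of_tendsto hγ hα hn hpure hentropy hmoment hc hh
          (KDE.tendsto_log_partition_of_le hF hγ hα hn hconv hv hG hb₀ hD0.le hb₀α)
    · intro uG utyp huG hlt hJG hJt hder hcond
      obtain ⟨b, hb, hbu, hbα, hbt⟩ :=
        KDE.exists_tilt_eq hγ hα hpure hmoment hF hv hG huG hlt hJG hJt hder hcond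
      obtain rfl := hinj b hb hbα
      have hanti := KDE.strictAntiOn_tilt hF hγ hv hG
      -- For b' ≤ b the tilted mean v(b') lies in [uG, utyp). There J' = -λ and λ v = γ b' v^γ, so
      -- the condition on 2uJ' takes this form.
      have hslope : ∀ b', 0 < b' → b' ≤ b → 2 * γ * b' * v b' ^ γ < 1 := fun b' hb' hle => by
        have h1 := hcond (v b') ⟨hbu ▸ hanti.antitoneOn hb' hb hle, hbt b' hb'⟩
        rw [(KDE.hasDerivAt_of_eq_tiltRate hF hγ hv hG (fun b hb =>
          KDE.rateReal_tilt hγ hpure hmoment hF (hv b hb)) hb').deriv] at h1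
        have h2 := KDE.tiltSlope_mul hγ (hv b' hb').1
        linarith
      have hvb : 0 < v b := hbu ▸ huG
      have hsq : 0 < √(v b) := Real.sqrt_pos.2 hvb
      have hβ := KDE.invTemp_pos hγ hsq
      -- The choice h² = v(b) = uG solves the frozen critical equation, as β = h^(-2γ)/(2γ).
      have hopt : KDE.invTemp γ √(v b) * (2 * γ * v b ^ γ) = 1 := by
        rw [KDE.invTemp, Real.sq_sqrt hvb.le, Real.rpow_neg hvb.le]
        field_simp
      have hbβ : b < KDE.invTemp γ √(v b) := by
        have h1 := hslope b hb le_rfl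
        by_contra! hcon
        have : KDE.invTemp γ √(v b) * (2 * γ * v b ^ γ) ≤ b * (2 * γ * v b ^ γ) := by gcongr
        linarith
      refine ⟨_, fun h hh => KDE.kLAsymptotics_remEnergy hγ hα hn hpure hentropy hmoment hc hF hv
        hG hb hbα hh, √(v b), hsq, fun h hh hne => ?_, ?_, ?_, ?_⟩
      · have h1 := KDE.log_eq_invTemp hγ hh
        have h2 := KDE.log_eq_invTemp hγ hsq
        have h3 : KDE.invTemp γ h ≠ KDE.invTemp γ √(v b) := fun h3 => by
          rw [h3, ← h2] at h1
          exact hne (Real.log_injOn_pos hh hsq h1)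
        have h4 := KDE.remEnergy_add_log_lt hF hγ hv hb hvb hbα hslope hopt
          (KDE.invTemp_pos hγ hh) h3
        linarith
      · rw [hD _ hsq, sub_pos, ← hbα]
        exact hmono hb hβ hbβ
      · exact KDE.hasDerivAt_phi_bandwidth hF hγ hv hsq hb hopt hgbar
      · refine (KDE.hasDerivAt_frozen hsq hopt (c - α)).congr_of_eventuallyEq ?_
        filter_upwards [Ioi_mem_nhds hsq] with h hh
        exact KDE.phi_freezing hγ hh hb (hv b hb) hbα fun m hm => hgbar h m hh hm
  -- Without a freezing point every statement about m* is vacuous, and its value is arbitrary.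
  · refine ⟨fun _ => 0, fun h hh hD0 => ?_, ?_⟩
    · rw [hD h hh, sub_pos] at hD0
      obtain ⟨b, hb, -, hbα⟩ :=
        KDE.exists_tiltRate_eq hF hγ hv hG hα (KDE.invTemp_pos hγ hh) hD0
      exact absurd ⟨b, hb, hbα⟩ hfreeze
    · intro uG utyp huG hlt hJG hJt hder hcond
      obtain ⟨b, hb, -, hbα, -⟩ :=
        KDE.exists_tilt_eq hγ hα hpure hmoment hF hv hG huG hlt hJG hJt hder hcond
      exact absurd ⟨b, hb, hbα⟩ hfreeze
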